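/- Let $N_0\ge 1$ be an integer, let $\tau_1,\tau_2>0$ and $\rho>-1/2$ be constants, and for every $n$ let $c_{n,0},\dots,c_{n,n}$ be deterministic real numbers such that $|c_{n,i}|\le\tau_2$ for all $0\le i\le n$ with $i<N_0$, and $\tau_1 i^{\rho}\le|c_{n,i}|\le\tau_2 i^{\rho}$ for all $N_0\le i<n$. Let $\tilde\xi_0,\tilde\xi_1,\dots$ be i.i.d. standard Gaussian random variables and let $\tilde P_n(x)=\sum_{i=0}^{n}c_{n,i}\tilde\xi_i x^i$. For $S\subset\mathbb{R}$ let $\tilde N_n(S)$ be the number of roots of $\tilde P_n$ in $S$, counted with multiplicity (and $0$ if $\tilde P_n$ is the zero polynomial). Let $0<c<1$ be a constant and let $(a_n)$, $(b_n)$ be real sequences such that, for all sufficiently large $n$, $$\frac{(\log n)^2}{n}\le b_n<a_n\le\exp\left(-(\log n)^c\right),$$ and such that $\log(a_n/b_n)=\Theta(\log n)$ as $n\to\infty$. Put $$\mathfrak J=\mathfrak J_{a_n,b_n}=\pm(1-a_n,1-b_n)\cup\pm(1-a_n,1-b_n)^{-1},$$ where $S^{-1}=\{x^{-1}:x\in S\}$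 and $\pm S=-S\cup S$, and suppose that $\operatorname{Var}\tilde N_n(\mathfrak J)=\Omega(\log n)$ as $n\to\infty$. Then $$\frac{\tilde N_n(\mathfrak J)-\mathbb{E}\,\tilde N_n(\mathfrak J)}{\sqrt{\operatorname{Var}\tilde N_n(\mathfrak J)}}\xrightarrow{\ d\ }\mathcal N(0,1)\qquad(n\to\infty).$$ -/

import Mathlib

open MeasureTheory ProbabilityTheory Filter Asymptotics
open scoped Topology Pointwise

/-- The coefficients `c n i` (`0 ≤ i ≤ n`) of the degree `n` polynomials are deterministic reals of
polynomial growth of order `ρ`, with constants that do not depend on `n`. The leading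
coefficient `c n n` is constrained only when `n < N₀`. -/
def PolynomialGrowth (N₀ : ℕ) (τ₁ τ₂ ρ : ℝ) (c : ℕ → ℕ → ℝ) : Prop :=
  ∀ n i : ℕ,
    (i ≤ n → i < N₀ → |c n i| ≤ τ₂) ∧
    (N₀ ≤ i → i < n → τ₁ * (i : ℝ) ^ ρ ≤ |c n i| ∧ |c n i| ≤ τ₂ * (i : ℝ) ^ ρ)

/-- The polynomial `∑_{i=0}^n c_i x_i X^i`. -/
noncomputable def weightedPoly (n : ℕ) (c x : ℕ → ℝ) : Polynomial ℝ :=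
  ∑ i ∈ Finset.range (n + 1), Polynomial.C (c i * x i) * Polynomial.X ^ i

open Classical in
/-- The number of real roots of `p` in `S`, counted with multiplicity. -/
noncomputable def rootCount (p : Polynomial ℝ) (S : Set ℝ) : ℕ :=
  p.roots.countP (fun x => x ∈ S)

/-- The core region `±(1 - a, 1 - b) ∪ ±(1 - a, 1 - b)⁻¹`, where `S⁻¹ = {x⁻¹ : x ∈ S}` and
`±S = -S ∪ S`. -/
def core (a b : ℝ) : Set ℝ :=
  (-Set.Ioo (1 - a) (1 - b) ∪ Set.Ioo (1 - a) (1 - b)) ∪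
    (-(Set.Ioo (1 - a) (1 - b))⁻¹ ∪ (Set.Ioo (1 - a) (1 - b))⁻¹)

/-- The number of roots in the core `core (a n) (b n)` of the random polynomial
`∑_{i=0}^n c_{n,i} ξ_i X^i`, as a real random variable. -/
noncomputable def coreRoots {Ω : Type*} (c : ℕ → ℕ → ℝ) (ξ : ℕ → Ω → ℝ) (a b : ℕ → ℝ)
    (n : ℕ) (ω : Ω) : ℝ :=
  (rootCount (weightedPoly n (c n) (fun i => ξ i ω)) (core (a n) (b n)) : ℝ)

/-!
The strategy is to write the number of roots in the core as a sum of almost independent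
contributions of many scales, and to apply a central limit theorem with blocks and gaps.

*Reduction to the neighbourhood of `1`.* The maps `x ↦ -x` and `x ↦ 1 / x` carry the four parts of
the core to `(1 - a, 1 - b)`, at the price of replacing the polynomial by four polynomials with the
same Gaussian coefficients, up to sign and order (`rootCount_core`). The interval is cut into
pieces on which `log (1 - x)` varies by `h`, where `h` is of order `(log n) ^ (c / 100)`.

*Local approximation.* At distance `v` from `1` the indices of order `1 / v` carry almost all of
the variance, and each derivative costs a factor `1 / v` (`exists_regularOn`). On one piece the
polynomial is therefore close to its truncation to a window of indices. Rolle's theorem bounds a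
polynomial with `k` roots in a short interval by its `k`-th derivative, while a Gaussian variable
is rarely much smaller than its standard deviation. Hence short cells rarely contain several roots,
which bounds the fourth moments (`IsStdGaussianSeq.integral_rootCount_pow_four_le`). As the two
polynomials moreover rarely differ in sign at an endpoint of a cell, they have the same number of
roots with high probability (`IsStdGaussianSeq.measureReal_rootCount_ne_le`).

*The unconstrained coefficient.* Nothing is assumed on `coeff n n`, the leading coefficient of the
polynomial and the constant one of the reversed polynomial. Its term changes so fast from one piece
to the next, in comparison with the other terms, that it is negligible or dominant on all but at
most three pieces; where it is dominant there are no roots, with high probability. On the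
exceptional pieces a moment bound is enough. It comes from a polynomial without this coefficient,
namely `x p'`, or its analogue for the reversed order, which by Rolle's theorem loses at most one
root (`rootCount_le_rootCount_index_mul`, `rootCount_le_rootCount_sub_index_mul`).

*Central limit theorem.* The truncated counts of two pieces use disjoint sets of variables as soon
as the pieces are separated by a few others. The pieces are grouped into long blocks separated by
gaps of four pieces: the blocks are independent and satisfy Lyapunov's condition, while the
variance of the gaps and the truncation error are of smaller order than `log n`, hence than the
variance of the number of roots (`tendstoInDistribution_of_blocks`, `block_moments_le`).

The count `rootCount` of a random polynomial is measurable because the polynomials with at least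
`k` roots in a `σ`-compact set form, up to the zero polynomial, a `σ`-compact set
(`isSigmaCompact_le_rootCount`).
-/

/-! ### A central limit theorem for sums of blocks -/

/-- Second-order Taylor estimate for the complex exponential on the imaginary axis. -/
lemma norm_exp_I_mul_sub_taylor_le (x : ℝ) :
    ‖Complex.exp (x * Complex.I) - (1 + x * Complex.I - (x ^ 2 / 2 : ℝ))‖ ≤ 4 * |x| ^ 3 := by
  rcases le_total |x| 1 with hx | hx
  · have h := Complex.exp_bound (x := x * Complex.I) (by simpa using hx) (n := 3) (by norm_num)
    have e : ∑ m ∈ Finset.range 3, (x * Complex.I) ^ m / (m.factorial : ℂ)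
        = 1 + x * Complex.I - (x ^ 2 / 2 : ℝ) := by
      simp [Finset.sum_range_succ, Nat.factorial, mul_pow]
      ring
    rw [e] at h
    refine h.trans ?_
    simp [Nat.factorial]
    nlinarith [pow_nonneg (abs_nonneg x) 3]
  · have h1 : ‖Complex.exp (x * Complex.I)‖ = 1 := Complex.norm_exp_ofReal_mul_I x
    have h2 : ‖(1 + x * Complex.I - (x ^ 2 / 2 : ℝ) : ℂ)‖ ≤ 1 + |x| + |x| ^ 2 / 2 := by
      refine (norm_sub_le _ _).trans ?_
      gcongr
      · refine (norm_add_le _ _).trans ?_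
        simp
      · rw [Complex.norm_real]; simp
    refine (norm_sub_le _ _).trans ?_
    rw [h1]
    have h3 : |x| ≤ |x| ^ 3 := by nlinarith [sq_nonneg (|x|), mul_self_nonneg (|x| - 1)]
    have h4 : |x| ^ 2 ≤ |x| ^ 3 := by nlinarith [sq_nonneg (|x|)]
    linarith

/-- A product of complex numbers in the closed unit disc is Lipschitz in its factors. -/
lemma norm_prod_sub_prod_le_sum {ι : Type*} (s : Finset ι) (a b : ι → ℂ)
    (ha : ∀ i ∈ s, ‖a i‖ ≤ 1) (hb : ∀ i ∈ s, ‖b i‖ ≤ 1) :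
    ‖∏ i ∈ s, a i - ∏ i ∈ s, b i‖ ≤ ∑ i ∈ s, ‖a i - b i‖ := by
  classical
  induction s using Finset.induction_on with
  | empty => simp
  | insert j s hj ih =>
    rw [Finset.prod_insert hj, Finset.prod_insert hj, Finset.sum_insert hj]
    have e : a j * ∏ i ∈ s, a i - b j * ∏ i ∈ s, b i
        = (a j - b j) * ∏ i ∈ s, a i + b j * (∏ i ∈ s, a i - ∏ i ∈ s, b i) := by ring
    rw [e]
    refine (norm_add_le _ _).trans ?_
    rw [norm_mul, norm_mul]
    have h1 : ‖∏ i ∈ s, a i‖ ≤ 1 := by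
      rw [norm_prod]
      exact Finset.prod_le_one (fun _ _ => norm_nonneg _)
        (fun i hi => ha i (Finset.mem_insert_of_mem hi))
    have h2 := hb j (Finset.mem_insert_self _ _)
    have h3 := ih (fun i hi => ha i (Finset.mem_insert_of_mem hi))
      (fun i hi => hb i (Finset.mem_insert_of_mem hi))
    nlinarith [norm_nonneg (a j - b j), norm_nonneg (∏ i ∈ s, a i - ∏ i ∈ s, b i),
      norm_nonneg (b j), norm_nonneg (∏ i ∈ s, a i)]

lemma abs_exp_neg_sub_one_sub_le {y : ℝ} (hy : 0 ≤ y) : |Real.exp (-y) - (1 - y)| ≤ y ^ 2 := by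
  have h1 : 1 - y ≤ Real.exp (-y) := by linarith [Real.add_one_le_exp (-y)]
  rw [abs_of_nonneg (by linarith)]
  rcases le_total y 1 with h | h
  · have h2 := Real.norm_exp_sub_one_sub_id_le (x := -y) (by simpa [abs_of_nonneg hy] using h)
    simp only [Real.norm_eq_abs, sq_abs, neg_sq] at h2
    have := le_abs_self (Real.exp (-y) - 1 - -y)
    linarith
  · have : Real.exp (-y) ≤ 1 := Real.exp_le_one_iff.2 (by linarith)
    nlinarith

section

variable {Ω : Type*} [MeasurableSpace Ω] {P : Measure Ω} [IsProbabilityMeasure P]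

lemma integrable_pow_of_memLp_four {W : Ω → ℝ} (hW : MemLp W 4 P) {k : ℕ} (hk : k ≤ 4) :
    Integrable (fun ω => W ω ^ k) P := by
  have h : MemLp W k P := hW.mono_exponent (by exact_mod_cast hk)
  have := h.integrable_norm_pow'
  refine this.mono (h.aestronglyMeasurable.pow k) ?_
  filter_upwards with ω
  simp

/-- Comparison of the characteristic function of a centred variable with the Gaussian one of the
same variance; `α` is a free parameter, which trades the second moment for the fourth. -/
lemma norm_charFun_sub_exp_le {W : Ω → ℝ} (hW : MemLp W 4 P) (h0 : ∫ ω, W ω ∂P = 0) (t : ℝ)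
    {α : ℝ} (hα : 0 < α) :
    ‖charFun (P.map W) t - Complex.exp (-(t ^ 2 * (∫ ω, W ω ^ 2 ∂P) / 2 : ℝ))‖ ≤
      2 * α * t ^ 2 * ∫ ω, W ω ^ 2 ∂P + (2 * t ^ 4 / α + t ^ 4 / 4) * ∫ ω, W ω ^ 4 ∂P := by
  have i1 : Integrable W P := by simpa using integrable_pow_of_memLp_four hW (k := 1) (by norm_num)
  have i2 := integrable_pow_of_memLp_four hW (k := 2) (by norm_num)
  have i4 := integrable_pow_of_memLp_four hW (k := 4) (by norm_num)
  set σ := ∫ ω, W ω ^ 2 ∂P with hσ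
  set q := ∫ ω, W ω ^ 4 ∂P with hq
  have hσ0 : 0 ≤ σ := integral_nonneg fun ω => sq_nonneg _
  have hσq : σ ^ 2 ≤ q := by
    have : 0 ≤ ∫ ω, (W ω ^ 2 - σ) ^ 2 ∂P := integral_nonneg fun ω => sq_nonneg _
    have e : ∀ ω, (W ω ^ 2 - σ) ^ 2 = W ω ^ 4 - 2 * σ * W ω ^ 2 + σ ^ 2 := fun ω => by ring
    simp_rw [e] at this
    have i42 : Integrable (fun ω => W ω ^ 4 - 2 * σ * W ω ^ 2) P := i4.sub (i2.const_mul _)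
    rw [integral_add i42 (integrable_const _),
      integral_sub i4 (i2.const_mul _), integral_const_mul] at this
    simp only [integral_const, probReal_univ, one_smul] at this
    rw [← hσ, ← hq] at this
    nlinarith
  have e1 : charFun (P.map W) t = ∫ ω, Complex.exp ((t * W ω : ℝ) * Complex.I) ∂P := by
    rw [charFun_apply_real, integral_map hW.aestronglyMeasurable.aemeasurable
      (by fun_prop)]
    simp
  have ie : Integrable (fun ω => Complex.exp ((t * W ω : ℝ) * Complex.I)) P := by
    refine (integrable_const (1 : ℝ)).mono ?_ ?_
    · have := hW.aestronglyMeasurable.aemeasurable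
      exact (Complex.measurable_exp.comp_aemeasurable
        ((Complex.measurable_ofReal.comp_aemeasurable (this.const_mul t)).mul_const
          _)).aestronglyMeasurable
    · filter_upwards with ω
      rw [Complex.norm_exp_ofReal_mul_I]; simp
  have j1 : Integrable (fun ω => ((t * W ω : ℝ) : ℂ) * Complex.I) P :=
    ((i1.const_mul t).ofReal (𝕜 := ℂ)).mul_const _
  have j3 : Integrable (fun ω => 1 + ((t * W ω : ℝ) : ℂ) * Complex.I) P :=
    (integrable_const _).add j1
  have hsq : ∀ ω, (t * W ω) ^ 2 / 2 = t ^ 2 / 2 * W ω ^ 2 := fun ω => by ring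
  have j2 : Integrable (fun ω => (((t * W ω) ^ 2 / 2 : ℝ) : ℂ)) P := by
    simp_rw [hsq]
    exact (i2.const_mul (t ^ 2 / 2)).ofReal (𝕜 := ℂ)
  have ip : Integrable (fun ω => (1 + (t * W ω : ℝ) * Complex.I - ((t * W ω) ^ 2 / 2 : ℝ) : ℂ)) P :=
    j3.sub j2
  have e2 : ∫ ω, (1 + (t * W ω : ℝ) * Complex.I - ((t * W ω) ^ 2 / 2 : ℝ) : ℂ) ∂P
      = ((1 - t ^ 2 * σ / 2 : ℝ) : ℂ) := by
    rw [integral_sub j3 j2,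
      integral_add (integrable_const _) j1, integral_mul_const, integral_complex_ofReal,
      integral_complex_ofReal,      integral_const_mul, h0]
    simp_rw [hsq, integral_const_mul]
    simp
    ring
  have main : ‖charFun (P.map W) t - ((1 - t ^ 2 * σ / 2 : ℝ) : ℂ)‖ ≤
      2 * α * t ^ 2 * σ + 2 * t ^ 4 / α * q := by
    rw [e1, ← e2, ← integral_sub ie ip]
    refine (norm_integral_le_integral_norm _).trans ?_
    have : ∀ ω, ‖Complex.exp ((t * W ω : ℝ) * Complex.I) -
        (1 + (t * W ω : ℝ) * Complex.I - ((t * W ω) ^ 2 / 2 : ℝ))‖ ≤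
        2 * α * t ^ 2 * W ω ^ 2 + 2 * t ^ 4 / α * W ω ^ 4 := by
      intro ω
      refine (norm_exp_I_mul_sub_taylor_le _).trans ?_
      set x := t * W ω
      have hx : 2 * α * t ^ 2 * W ω ^ 2 + 2 * t ^ 4 / α * W ω ^ 4
          = 2 * α * |x| ^ 2 + 2 * |x| ^ 4 / α := by
        have : |x| ^ 4 = x ^ 4 := by
          rw [show |x| ^ 4 = (|x| ^ 2) ^ 2 by ring, sq_abs]; ring
        rw [sq_abs, this]; simp only [x]; ring
      rw [hx]
      have : 0 ≤ 2 * |x| ^ 2 * (|x| - α) ^ 2 / α := by positivity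
      have e : 2 * |x| ^ 2 * (|x| - α) ^ 2 / α
          = 2 * α * |x| ^ 2 + 2 * |x| ^ 4 / α - 4 * |x| ^ 3 := by
        field_simp; ring
      linarith
    refine (integral_mono (ie.sub ip).norm ((i2.const_mul _).add (i4.const_mul _)) this).trans ?_
    simp only [Pi.add_apply]
    rw [integral_add (i2.const_mul _) (i4.const_mul _), integral_const_mul, integral_const_mul]
  have hy : ‖((1 - t ^ 2 * σ / 2 : ℝ) : ℂ) - Complex.exp (-(t ^ 2 * σ / 2 : ℝ))‖ ≤
      t ^ 4 / 4 * q := by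
    rw [← Complex.ofReal_neg, ← Complex.ofReal_exp, ← Complex.ofReal_sub, Complex.norm_real,
      Real.norm_eq_abs, abs_sub_comm]
    refine (abs_exp_neg_sub_one_sub_le (by positivity)).trans ?_
    nlinarith [pow_nonneg (sq_nonneg t) 2]
  calc _ ≤ _ := norm_sub_le_norm_sub_add_norm_sub _ ((1 - t ^ 2 * σ / 2 : ℝ) : ℂ) _
    _ ≤ _ := add_le_add main hy
    _ = _ := by ring

lemma variance_add_le_two_mul {A B : Ω → ℝ} (hA : MemLp A 2 P) (hB : MemLp B 2 P) :
    Var[A + B; P] ≤ 2 * Var[A; P] + 2 * Var[B; P] := by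
  have h1 := variance_add hA hB
  have h2 := variance_sub hA hB
  have h3 := variance_nonneg (A - B) P
  linarith

/-- Centring increases the fourth moment by at most a constant factor. -/
lemma integral_sub_integral_pow_four_le {Y : Ω → ℝ} (hY : MemLp Y 4 P) :
    ∫ ω, (Y ω - ∫ ω', Y ω' ∂P) ^ 4 ∂P ≤ 16 * ∫ ω, Y ω ^ 4 ∂P := by
  have i1 : Integrable Y P := by simpa using integrable_pow_of_memLp_four hY (k := 1) (by norm_num)
  have i4 := integrable_pow_of_memLp_four hY (k := 4) (by norm_num)
  set e := ∫ ω, Y ω ∂P with he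
  have hc : MemLp (fun ω => Y ω - e) 4 P := hY.sub (memLp_const e)
  have ic := integrable_pow_of_memLp_four hc (k := 4) (by norm_num)
  have hj : e ^ 4 ≤ ∫ ω, Y ω ^ 4 ∂P := by
    -- Jensen's inequality for `x ↦ x ^ 4`, through its tangent line at `e`
    have h : ∀ ω, e ^ 4 + 4 * e ^ 3 * (Y ω - e) ≤ Y ω ^ 4 := fun ω => by
      nlinarith [sq_nonneg (Y ω ^ 2 - e ^ 2), sq_nonneg (e * (Y ω - e)), sq_nonneg (Y ω - e)]
    have i5 : Integrable (fun ω => 4 * e ^ 3 * (Y ω - e)) P :=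
      (i1.sub (integrable_const _)).const_mul _
    have h2 := integral_mono ((integrable_const (e ^ 4)).add i5) i4 h
    simp only [Pi.add_apply] at h2
    rw [integral_add (integrable_const _) i5, integral_const_mul,
      integral_sub i1 (integrable_const _)] at h2
    simpa [← he] using h2
  have h : ∀ ω, (Y ω - e) ^ 4 ≤ 8 * Y ω ^ 4 + 8 * e ^ 4 := fun ω => by
    have h1 : (Y ω - e) ^ 2 ≤ 2 * Y ω ^ 2 + 2 * e ^ 2 := by nlinarith [sq_nonneg (Y ω + e)]
    have h2 : ((Y ω - e) ^ 2) ^ 2 ≤ (2 * Y ω ^ 2 + 2 * e ^ 2) ^ 2 := by gcongr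
    nlinarith [sq_nonneg (Y ω ^ 2 - e ^ 2)]
  have := integral_mono ic ((i4.const_mul 8).add (integrable_const (8 * e ^ 4))) h
  simp only [Pi.add_apply] at this
  rw [integral_add (i4.const_mul 8) (integrable_const _), integral_const_mul] at this
  simp at this
  linarith

/-- A non-asymptotic form of the block central limit theorem: `X` is the sum of the blocks `Y m`,
of the gaps `G m` and of a remainder. -/
lemma norm_charFun_standardized_sub_le {X : Ω → ℝ} {Y G : ℕ → Ω → ℝ} {K : ℕ}
    (hX : MemLp X 2 P) (hY : ∀ m, MemLp (Y m) 4 P) (hG : ∀ m, MemLp (G m) 2 P)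
    (iY : iIndepFun Y P) (iG : iIndepFun G P) (hv : 0 < Var[X; P]) {α q r : ℝ} (hα : 0 < α)
    (hq : (∑ m ∈ Finset.range K, 16 * ∫ ω, Y m ω ^ 4 ∂P) / Var[X; P] ^ 2 ≤ q)
    (hr : (2 * (∑ m ∈ Finset.range K, ∫ ω, G m ω ^ 2 ∂P) + 2 * ∫ ω, (X ω
      - ∑ m ∈ Finset.range K, Y m ω - ∑ m ∈ Finset.range K, G m ω) ^ 2 ∂P) / Var[X; P] ≤ r)
    (t : ℝ) :
    ∃ s : ℝ, |s - 1| ≤ α + r / α + r ∧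
    ‖charFun (P.map (fun ω => (X ω - ∫ ω', X ω' ∂P) / √(Var[X; P]))) t -
      Complex.exp (-(t ^ 2 * s / 2 : ℝ))‖ ≤
      |t| * (α + r / α) + (2 * α * t ^ 2 * s + (2 * t ^ 4 / α + t ^ 4 / 4) * q) := by
  set v := Var[X; P] with hvdef
  have hsv : 0 < √v := Real.sqrt_pos.2 hv
  have hsv2 : √v ^ 2 = v := Real.sq_sqrt hv.le
  have hY2 : ∀ m, MemLp (Y m) 2 P := fun m => (hY m).mono_exponent (by norm_num)
  set eX := ∫ ω, X ω ∂P with heX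
  set A : Ω → ℝ := fun ω => ∑ m ∈ Finset.range K, Y m ω with hA
  set B : Ω → ℝ := fun ω => ∑ m ∈ Finset.range K, G m ω with hB
  have mA : MemLp A 2 P := memLp_finsetSum _ fun m _ => hY2 m
  have mB : MemLp B 2 P := memLp_finsetSum _ fun m _ => hG m
  set D : Ω → ℝ := fun ω => X ω - A ω - B ω with hD
  have mD : MemLp D 2 P := (hX.sub mA).sub mB
  have mBD : MemLp (B + D) 2 P := mB.add mD
  set eA := ∫ ω, A ω ∂P with heA
  have eAsum : eA = ∑ m ∈ Finset.range K, ∫ ω, Y m ω ∂P := by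
    rw [heA, hA]
    exact integral_finsetSum _ fun m _ => (hY2 m).integrable (by norm_num)
  set R : Ω → ℝ := fun ω => (X ω - eX) - (A ω - eA) with hR
  have mR : MemLp R 2 P := (hX.sub (memLp_const _)).sub (mA.sub (memLp_const _))
  -- the variance of the part of `X` outside the blocks
  have hRr : ∫ ω, R ω ^ 2 ∂P ≤ r * v := by
    have h1 : ∫ ω, R ω ^ 2 ∂P = Var[B + D; P] := by
      rw [variance_eq_integral mBD.aestronglyMeasurable.aemeasurable]
      have : P[B + D] = eX - eA := by
        have : B + D = fun ω => X ω - A ω := by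
          funext ω; simp only [Pi.add_apply, hD]; ring
        rw [this, integral_sub (hX.integrable (by norm_num)) (mA.integrable (by norm_num))]
      rw [this]
      congr 1; funext ω
      simp only [Pi.add_apply, hD, hR]; ring
    have h2 : Var[B; P] ≤ ∑ m ∈ Finset.range K, ∫ ω, G m ω ^ 2 ∂P := by
      have : B = ∑ m ∈ Finset.range K, G m := by funext ω; simp [hB]
      rw [this, IndepFun.variance_sum (fun m _ => hG m)
        (fun i _ j _ hij => iG.indepFun hij)]
      exact Finset.sum_le_sum fun m _ => variance_le_expectation_sq (hG m).aestronglyMeasurable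
    have h3 : Var[D; P] ≤ ∫ ω, D ω ^ 2 ∂P := variance_le_expectation_sq mD.aestronglyMeasurable
    rw [h1]
    have h4 := variance_add_le_two_mul mB mD
    rw [div_le_iff₀ hv] at hr
    linarith
  have hXv : ∫ ω, (X ω - eX) ^ 2 ∂P = v :=
    (variance_eq_integral hX.aestronglyMeasurable.aemeasurable).symm
  -- the normalized blocks
  set W : ℕ → Ω → ℝ := fun m ω => (Y m ω - ∫ ω', Y m ω' ∂P) / √v with hW
  have mW : ∀ m, MemLp (W m) 4 P := fun m => by
    have := ((hY m).sub (memLp_const (∫ ω', Y m ω' ∂P))).const_mul (√v)⁻¹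
    refine this.congr_norm ?_ ?_
    · have h := ((hY m).aestronglyMeasurable.sub
        (aestronglyMeasurable_const (b := ∫ ω', Y m ω' ∂P))).const_mul (√v)⁻¹
      refine h.congr ?_
      filter_upwards with ω
      simp [hW]; ring
    · filter_upwards with ω
      simp [hW, div_eq_inv_mul]
  have W0 : ∀ m, ∫ ω, W m ω ∂P = 0 := fun m => by
    simp only [hW]
    rw [integral_div, integral_sub ((hY2 m).integrable (by norm_num)) (integrable_const _)]
    simp
  have W2 : ∀ m, ∫ ω, W m ω ^ 2 ∂P = Var[Y m; P] / v := fun m => by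
    simp only [hW, div_pow, hsv2]
    rw [integral_div, variance_eq_integral (hY m).aestronglyMeasurable.aemeasurable]
  have W4 : ∀ m, ∫ ω, W m ω ^ 4 ∂P ≤ 16 * (∫ ω, Y m ω ^ 4 ∂P) / v ^ 2 := fun m => by
    simp only [hW, div_pow]
    rw [show √v ^ 4 = (√v ^ 2) ^ 2 by ring, hsv2, integral_div]
    gcongr
    exact integral_sub_integral_pow_four_le (hY m)
  set s := ∑ m ∈ Finset.range K, ∫ ω, W m ω ^ 2 ∂P with hs
  have hsA : s * v = ∫ ω, (A ω - eA) ^ 2 ∂P := by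
    have h1 : ∫ ω, (A ω - eA) ^ 2 ∂P = Var[A; P] :=
      (variance_eq_integral mA.aestronglyMeasurable.aemeasurable).symm
    have : A = ∑ m ∈ Finset.range K, Y m := by funext ω; simp [hA]
    rw [h1, this, IndepFun.variance_sum (fun m _ => hY2 m)
      (fun i _ j _ hij => iY.indepFun hij), hs, Finset.sum_mul]
    refine Finset.sum_congr rfl fun m _ => ?_
    rw [W2]; field_simp
  have iX2 : Integrable (fun ω => (X ω - eX) ^ 2) P := (hX.sub (memLp_const _)).integrable_sq
  have iR2 : Integrable (fun ω => R ω ^ 2) P := mR.integrable_sq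
  have iA2 : Integrable (fun ω => (A ω - eA) ^ 2) P := (mA.sub (memLp_const _)).integrable_sq
  have hR0 : 0 ≤ ∫ ω, R ω ^ 2 ∂P := integral_nonneg fun ω => sq_nonneg _
  refine ⟨s, ?_, ?_⟩
  · -- `∫ (A - eA)² = ∫ (X - eX - R)²`
    have h1 : ∀ ω, (A ω - eA) ^ 2 ≤ (1 + α) * (X ω - eX) ^ 2 + (1 + 1 / α) * R ω ^ 2 := by
      intro ω
      have : A ω - eA = (X ω - eX) - R ω := by simp [hR]
      rw [this]
      set x := X ω - eX
      set y := R ω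
      have : 0 ≤ (α * x + y) ^ 2 / α := by positivity
      have e : (α * x + y) ^ 2 / α = α * x ^ 2 + 2 * x * y + 1 / α * y ^ 2 := by field_simp; ring
      nlinarith
    have h2 : ∀ ω, (1 - α) * (X ω - eX) ^ 2 + (1 - 1 / α) * R ω ^ 2 ≤ (A ω - eA) ^ 2 := by
      intro ω
      have : A ω - eA = (X ω - eX) - R ω := by simp [hR]
      rw [this]
      set x := X ω - eX
      set y := R ω
      have : 0 ≤ (α * x - y) ^ 2 / α := by positivity
      have e : (α * x - y) ^ 2 / α = α * x ^ 2 - 2 * x * y + 1 / α * y ^ 2 := by field_simp; ring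
      nlinarith
    have h3 := integral_mono iA2 ((iX2.const_mul (1 + α)).add (iR2.const_mul (1 + 1 / α))) h1
    have h4 := integral_mono ((iX2.const_mul (1 - α)).add (iR2.const_mul (1 - 1 / α))) iA2 h2
    simp only [Pi.add_apply] at h3 h4
    rw [integral_add (iX2.const_mul _) (iR2.const_mul _), integral_const_mul, integral_const_mul,
      hXv, ← hsA] at h3 h4
    have hα' : 0 < 1 / α := by positivity
    have h5 : 1 / α * ∫ ω, R ω ^ 2 ∂P ≤ 1 / α * (r * v) := by gcongr
    have h6 : (s - 1) * v ≤ (α + r / α + r) * v := by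
      have : (α + r / α + r) * v = α * v + 1 / α * (r * v) + r * v := by ring
      linarith
    have h7 : -(α + r / α + r) * v ≤ (s - 1) * v := by
      have : -(α + r / α + r) * v = -(α * v + 1 / α * (r * v) + r * v) := by ring
      have h0 : 0 ≤ r * v := hR0.trans hRr
      linarith
    rw [abs_le]
    exact ⟨le_of_mul_le_mul_right h7 hv, le_of_mul_le_mul_right h6 hv⟩
  · have ae1 : AEMeasurable (fun ω => (X ω - eX) / √v) P :=
      ((hX.aestronglyMeasurable.aemeasurable).sub_const _).div_const _
    have aeW : ∀ m, AEMeasurable (W m) P := fun m => (mW m).aestronglyMeasurable.aemeasurable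
    have aeS : AEMeasurable (fun ω => ∑ m ∈ Finset.range K, W m ω) P :=
      Finset.aemeasurable_fun_sum _ fun m _ => aeW m
    have hSA : ∀ ω, ∑ m ∈ Finset.range K, W m ω = (A ω - eA) / √v := fun ω => by
      simp only [hW, hA, eAsum, ← Finset.sum_div, Finset.sum_sub_distrib]
    -- replacing `X` by the blocks
    have c1 : ‖charFun (P.map (fun ω => (X ω - eX) / √v)) t -
        charFun (P.map (fun ω => ∑ m ∈ Finset.range K, W m ω)) t‖ ≤ |t| * (α + r / α) := by
      rw [charFun_apply_real, charFun_apply_real, integral_map ae1 (by fun_prop),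
        integral_map aeS (by fun_prop)]
      have hint : ∀ {f : Ω → ℝ}, AEMeasurable f P →
          Integrable (fun ω => Complex.exp (t * f ω * Complex.I)) P := fun {f} hf => by
        refine (integrable_const (1 : ℝ)).mono ?_ ?_
        · exact (Complex.measurable_exp.comp_aemeasurable
            (((Complex.measurable_ofReal.comp_aemeasurable hf).const_mul _).mul_const
              _)).aestronglyMeasurable
        · filter_upwards with ω
          rw [← Complex.ofReal_mul, Complex.norm_exp_ofReal_mul_I]; simp
      rw [← integral_sub (hint ae1) (hint aeS)]
      refine (norm_integral_le_integral_norm _).trans ?_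
      have hpt : ∀ ω, ‖Complex.exp (t * ((X ω - eX) / √v : ℝ) * Complex.I) -
          Complex.exp (t * (∑ m ∈ Finset.range K, W m ω : ℝ) * Complex.I)‖ ≤
          |t| * (α + (1 / (α * v)) * R ω ^ 2) := by
        intro ω
        rw [hSA ω]
        have e : Complex.exp (t * ((X ω - eX) / √v : ℝ) * Complex.I) -
            Complex.exp (t * ((A ω - eA) / √v : ℝ) * Complex.I) =
            Complex.exp ((t * ((A ω - eA) / √v) : ℝ) * Complex.I) *
              (Complex.exp (Complex.I * (t * (R ω / √v) : ℝ)) - 1) := by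
          rw [mul_sub, ← Complex.exp_add, mul_one]
          congr 2
          · simp only [hR]; push_cast; ring
          · push_cast; ring
        rw [e, norm_mul, Complex.norm_exp_ofReal_mul_I, one_mul]
        refine Real.norm_exp_I_mul_ofReal_sub_one_le.trans ?_
        rw [Real.norm_eq_abs, abs_mul]
        gcongr
        set y := R ω / √v with hy
        have hy2 : 1 / (α * v) * R ω ^ 2 = y ^ 2 / α := by
          rw [hy, div_pow, hsv2]; field_simp
        rw [hy2]
        have : 0 ≤ (|y| - α) ^ 2 / α := by positivity
        have e : (|y| - α) ^ 2 / α = y ^ 2 / α + α - 2 * |y| := by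
          rw [← sq_abs y]; field_simp; ring
        linarith [abs_nonneg y]
      refine (integral_mono ((hint ae1).sub (hint aeS)).norm
        (((integrable_const α).add (iR2.const_mul _)).const_mul |t|) hpt).trans ?_
      simp only [Pi.add_apply]
      rw [integral_const_mul, integral_add (integrable_const α) (iR2.const_mul _),
        integral_const_mul]
      simp only [integral_const, probReal_univ, one_smul]
      gcongr
      calc 1 / (α * v) * ∫ ω, R ω ^ 2 ∂P ≤ 1 / (α * v) * (r * v) := by gcongr
        _ = r / α := by field_simp
    -- replacing the blocks by Gaussians
    have iW : iIndepFun W P := by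
      have := iY.comp (fun m x => (x - ∫ ω', Y m ω' ∂P) / √v) (fun m => by fun_prop)
      exact this
    have c2 : ‖charFun (P.map (fun ω => ∑ m ∈ Finset.range K, W m ω)) t -
        Complex.exp (-(t ^ 2 * s / 2 : ℝ))‖ ≤
        2 * α * t ^ 2 * s + (2 * t ^ 4 / α + t ^ 4 / 4) * q := by
      have e1 : charFun (P.map (fun ω => ∑ m ∈ Finset.range K, W m ω)) t =
          ∏ m ∈ Finset.range K, charFun (P.map (W m)) t := by
        rw [iIndepFun.charFun_map_fun_finsetSum_eq_prod (fun m _ => aeW m) (iW.restrict _)]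
        simp
      have e2 : Complex.exp (-(t ^ 2 * s / 2 : ℝ)) =
          ∏ m ∈ Finset.range K, Complex.exp (-(t ^ 2 * (∫ ω, W m ω ^ 2 ∂P) / 2 : ℝ)) := by
        rw [← Complex.exp_sum]
        congr 1
        rw [hs, Finset.mul_sum, Finset.sum_div, Finset.sum_neg_distrib]
        push_cast
        rfl
      rw [e1, e2]
      have : ∀ m, IsProbabilityMeasure (P.map (W m)) := fun m =>
        Measure.isProbabilityMeasure_map (aeW m)
      refine (norm_prod_sub_prod_le_sum _ _ _ (fun m _ => norm_charFun_le_one t) ?_).trans ?_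
      · intro m _
        rw [← Complex.ofReal_neg, ← Complex.ofReal_exp, Complex.norm_real, Real.norm_eq_abs,
          Real.abs_exp]
        refine Real.exp_le_one_iff.2 ?_
        have : 0 ≤ ∫ ω, W m ω ^ 2 ∂P := integral_nonneg fun ω => sq_nonneg _
        have : 0 ≤ t ^ 2 * ∫ ω, W m ω ^ 2 ∂P := by positivity
        linarith
      · refine (Finset.sum_le_sum fun m _ => norm_charFun_sub_exp_le (mW m) (W0 m) t hα).trans ?_
        rw [Finset.sum_add_distrib, ← Finset.mul_sum, ← Finset.mul_sum]
        gcongr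
        refine (Finset.sum_le_sum fun m _ => W4 m).trans ?_
        rw [← Finset.sum_div]
        exact hq
    exact (norm_sub_le_norm_sub_add_norm_sub _ _ _).trans (add_le_add c1 c2)

/-- **Central limit theorem for sums of blocks.** The variables `X n` are, up to a remainder that is
negligible in mean square, sums of independent blocks satisfying Lyapunov's condition and of
independent gaps of negligible second moment. -/
theorem tendstoInDistribution_of_blocks {X : ℕ → Ω → ℝ} {K : ℕ → ℕ} {Y G : ℕ → ℕ → Ω → ℝ}
    (hX : ∀ n, MemLp (X n) 2 P) (hY : ∀ n m, MemLp (Y n m) 4 P) (hG : ∀ n m, MemLp (G n m) 2 P)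
    (iY : ∀ᶠ n in atTop, iIndepFun (Y n) P) (iG : ∀ᶠ n in atTop, iIndepFun (G n) P)
    (hv : ∀ᶠ n in atTop, 0 < Var[X n; P])
    (h4 : Tendsto (fun n => (∑ m ∈ Finset.range (K n), ∫ ω, Y n m ω ^ 4 ∂P) / Var[X n; P] ^ 2)
      atTop (𝓝 0))
    (h2 : Tendsto (fun n => (∑ m ∈ Finset.range (K n), ∫ ω, G n m ω ^ 2 ∂P) / Var[X n; P])
      atTop (𝓝 0))
    (hD : Tendsto (fun n => (∫ ω, (X n ω - ∑ m ∈ Finset.range (K n), Y n m ω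
      - ∑ m ∈ Finset.range (K n), G n m ω) ^ 2 ∂P) / Var[X n; P]) atTop (𝓝 0)) :
    TendstoInDistribution
      (fun n ω => (X n ω - ∫ ω', X n ω' ∂P) / √(Var[X n; P])) atTop (id : ℝ → ℝ)
      (fun _ => P) (gaussianReal 0 1) where
  forall_aemeasurable n :=
    ((hX n).aestronglyMeasurable.aemeasurable.sub_const _).div_const _
  aemeasurable_limit := aemeasurable_id
  tendsto := by
    refine ProbabilityMeasure.tendsto_iff_tendsto_charFun.2 fun t => ?_
    simp only [ProbabilityMeasure.coe_mk, Measure.map_id, charFun_gaussianReal]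
    set q : ℕ → ℝ := fun n =>
      (∑ m ∈ Finset.range (K n), 16 * ∫ ω, Y n m ω ^ 4 ∂P) / Var[X n; P] ^ 2 with hq
    set r : ℕ → ℝ := fun n => (2 * (∑ m ∈ Finset.range (K n), ∫ ω, G n m ω ^ 2 ∂P) +
      2 * ∫ ω, (X n ω - ∑ m ∈ Finset.range (K n), Y n m ω
      - ∑ m ∈ Finset.range (K n), G n m ω) ^ 2 ∂P) / Var[X n; P] with hr
    have tq : Tendsto q atTop (𝓝 0) := by
      have := h4.const_mul 16
      rw [mul_zero] at this
      refine this.congr fun n => ?_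
      rw [hq, ← mul_div_assoc, Finset.mul_sum]
    have tr : Tendsto r atTop (𝓝 0) := by
      have := (h2.const_mul 2).add (hD.const_mul 2)
      rw [mul_zero, add_zero] at this
      refine this.congr fun n => ?_
      simp only [hr]; ring
    have q0 : ∀ n, 0 ≤ q n := fun n => by
      refine div_nonneg (Finset.sum_nonneg fun m _ => ?_) (sq_nonneg _)
      exact mul_nonneg (by norm_num) (integral_nonneg fun ω => by positivity)
    have r0 : ∀ n, 0 ≤ r n := fun n => by
      refine div_nonneg (add_nonneg (mul_nonneg (by norm_num) (Finset.sum_nonneg fun m _ =>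
        integral_nonneg fun ω => by positivity)) (mul_nonneg (by norm_num)
          (integral_nonneg fun ω => by positivity))) (variance_nonneg _ _)
    -- the free parameter is chosen so that `q / α`, `r / α` and `α` all tend to `0`
    set α : ℕ → ℝ := fun n => √(q n + r n) + 1 / ((n : ℝ) + 1) with hα
    have αpos : ∀ n, 0 < α n := fun n => by positivity
    have tα : Tendsto α atTop (𝓝 0) := by
      have h1 : Tendsto (fun n => √(q n + r n)) atTop (𝓝 0) := by
        have := (tq.add tr).sqrt
        simpa using this
      have := h1.add tendsto_one_div_add_atTop_nhds_zero_nat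
      simpa [hα] using this
    have hqr : ∀ n, (q n + r n) / α n ≤ √(q n + r n) := fun n => by
      rw [div_le_iff₀ (αpos n)]
      have h1 : √(q n + r n) * √(q n + r n) = q n + r n :=
        Real.mul_self_sqrt (add_nonneg (q0 n) (r0 n))
      have h2 : 0 ≤ √(q n + r n) * (1 / ((n : ℝ) + 1)) := by positivity
      simp only [hα]
      linarith
    have tqr : Tendsto (fun n => √(q n + r n)) atTop (𝓝 0) := by
      have := (tq.add tr).sqrt
      simpa using this
    have tqα : Tendsto (fun n => q n / α n) atTop (𝓝 0) :=
      squeeze_zero (fun n => div_nonneg (q0 n) (αpos n).le)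
        (fun n => (by
          gcongr
          linarith [r0 n] : q n / α n ≤ (q n + r n) / α n).trans (hqr n)) tqr
    have trα : Tendsto (fun n => r n / α n) atTop (𝓝 0) :=
      squeeze_zero (fun n => div_nonneg (r0 n) (αpos n).le)
        (fun n => (by
          gcongr
          linarith [q0 n] : r n / α n ≤ (q n + r n) / α n).trans (hqr n)) tqr
    have key : ∀ᶠ n in atTop, ∃ s : ℝ, |s - 1| ≤ α n + r n / α n + r n ∧
        ‖charFun (P.map (fun ω => (X n ω - ∫ ω', X n ω' ∂P) / √(Var[X n; P]))) t -
          Complex.exp (-(t ^ 2 * s / 2 : ℝ))‖ ≤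
        |t| * (α n + r n / α n) +
          (2 * α n * t ^ 2 * s + (2 * t ^ 4 / α n + t ^ 4 / 4) * q n) := by
      filter_upwards [iY, iG, hv] with n h1 h2 h3
      exact norm_charFun_standardized_sub_le (hX n) (hY n) (hG n) h1 h2 h3 (αpos n) le_rfl le_rfl t
    obtain ⟨s, hs⟩ : ∃ s : ℕ → ℝ, ∀ᶠ n in atTop, |s n - 1| ≤ α n + r n / α n + r n ∧
        ‖charFun (P.map (fun ω => (X n ω - ∫ ω', X n ω' ∂P) / √(Var[X n; P]))) t -
          Complex.exp (-(t ^ 2 * s n / 2 : ℝ))‖ ≤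
        |t| * (α n + r n / α n) +
          (2 * α n * t ^ 2 * s n + (2 * t ^ 4 / α n + t ^ 4 / 4) * q n) := by
      exact key.choice
    have ts : Tendsto s atTop (𝓝 1) := by
      rw [tendsto_iff_norm_sub_tendsto_zero]
      refine squeeze_zero' (Eventually.of_forall fun n => norm_nonneg _)
        (hs.mono fun n h => h.1) ?_
      simpa using (tα.add trα).add tr
    have tb : Tendsto (fun n => |t| * (α n + r n / α n) +
          (2 * α n * t ^ 2 * s n + (2 * t ^ 4 / α n + t ^ 4 / 4) * q n)) atTop (𝓝 0) := by
      have e : (fun n => |t| * (α n + r n / α n) +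
          (2 * α n * t ^ 2 * s n + (2 * t ^ 4 / α n + t ^ 4 / 4) * q n)) = fun n =>
          |t| * (α n + r n / α n) + (2 * t ^ 2 * (α n * s n) + (2 * t ^ 4 * (q n / α n)
            + t ^ 4 / 4 * q n)) := by
        funext n; ring
      rw [e]
      simpa using ((tα.add trα).const_mul |t|).add (((tα.mul ts).const_mul (2 * t ^ 2)).add
        ((tqα.const_mul (2 * t ^ 4)).add (tq.const_mul (t ^ 4 / 4))))
    have t1 := squeeze_zero_norm' (hs.mono fun n h => h.2) tb
    have t2 : Tendsto (fun n => Complex.exp (-(t ^ 2 * s n / 2 : ℝ))) atTop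
        (𝓝 (Complex.exp (-(t ^ 2 * 1 / 2 : ℝ)))) := by
      have hc : Continuous fun x : ℝ => Complex.exp (-(t ^ 2 * x / 2 : ℝ)) := by fun_prop
      exact (hc.tendsto 1).comp ts
    have t3 := t1.add t2
    rw [zero_add] at t3
    convert! t3 using 2
    · ring
    · congr 1; push_cast; ring

end

/-! ### Counting real roots -/

open Classical in
lemma rootCount_eq_sum (p : Polynomial ℝ) (S : Set ℝ) :
    rootCount p S = ∑ x ∈ p.roots.toFinset with x ∈ S, p.rootMultiplicity x := by
  unfold rootCount
  rw [Multiset.countP_eq_card_filter, ← Multiset.toFinset_sum_count_eq, Multiset.toFinset_filter]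
  refine Finset.sum_congr (by ext; simp) fun x hx => ?_
  rw [Finset.mem_filter] at hx
  rw [Multiset.count_filter_of_pos (by simpa using hx.2), Polynomial.count_roots]

lemma rootCount_eq_finsum (p : Polynomial ℝ) (S : Set ℝ) :
    rootCount p S = ∑ᶠ x ∈ S, p.rootMultiplicity x := by
  classical
  rw [rootCount_eq_sum]
  refine (finsum_mem_eq_sum_of_inter_support_eq _ ?_).symm
  ext x
  simp only [Finset.coe_filter, Set.mem_inter_iff, Function.mem_support, Set.mem_ofPred_eq,
    Multiset.mem_toFinset]
  rw [← Polynomial.count_roots, Multiset.count_ne_zero]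
  tauto

lemma rootCount_image {p q : Polynomial ℝ} {S : Set ℝ} {f : ℝ → ℝ} (hf : Set.InjOn f S)
    (h : ∀ x ∈ S, p.rootMultiplicity (f x) = q.rootMultiplicity x) :
    rootCount p (f '' S) = rootCount q S := by
  rw [rootCount_eq_finsum, rootCount_eq_finsum, finsum_mem_image hf]
  exact finsum_mem_congr rfl h

lemma rootCount_le_natDegree (p : Polynomial ℝ) (S : Set ℝ) : rootCount p S ≤ p.natDegree := by
  classical
  unfold rootCount
  exact (Multiset.countP_le_card _ _).trans p.card_roots'

lemma rootCount_union (p : Polynomial ℝ) {S T : Set ℝ} (h : Disjoint S T) :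
    rootCount p (S ∪ T) = rootCount p S + rootCount p T := by
  classical
  unfold rootCount
  induction p.roots using Multiset.induction_on with
  | empty => simp
  | cons x s ih =>
    rw [Multiset.countP_cons, Multiset.countP_cons, Multiset.countP_cons, ih]
    have : x ∈ S → x ∉ T := fun h' => Set.disjoint_left.1 h h'
    have hu : x ∈ S ∪ T ↔ x ∈ S ∨ x ∈ T := Iff.rfl
    by_cases h1 : x ∈ S
    · have h2 : x ∉ T := this h1
      simp only [hu, h1, h2, or_false, if_true, if_false]; omega
    · by_cases h2 : x ∈ T
      · simp only [hu, h1, h2, or_true, if_true, if_false]; omega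
      · simp only [hu, h1, h2, or_self, if_false]; omega

lemma rootCount_pos_iff {p : Polynomial ℝ} {S : Set ℝ} :
    0 < rootCount p S ↔ p ≠ 0 ∧ ∃ x ∈ S, p.eval x = 0 := by
  classical
  unfold rootCount
  simp only [Multiset.countP_pos]
  constructor
  · rintro ⟨x, hx, hS⟩
    rw [Polynomial.mem_roots'] at hx
    exact ⟨hx.1, x, hS, hx.2⟩
  · rintro ⟨h, x, hS, hx⟩
    exact ⟨x, (Polynomial.mem_roots h).2 hx, hS⟩

lemma rootCount_Ioc_succ (p : Polynomial ℝ) {x : ℕ → ℝ} (hx : Monotone x) (m : ℕ) :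
    rootCount p (Set.Ioc (x 0) (x m)) =
      ∑ l ∈ Finset.range m, rootCount p (Set.Ioc (x l) (x (l + 1))) := by
  induction m with
  | zero => simp [rootCount]
  | succ m ih =>
    rw [Finset.sum_range_succ, ← ih, ← rootCount_union,
      Set.Ioc_union_Ioc_eq_Ioc (hx (Nat.zero_le _)) (hx (Nat.le_succ _))]
    rw [Set.disjoint_left]
    intro y h1 h2
    exact absurd h1.2 (not_le.2 h2.1)

open Polynomial in
/-- **Rolle's theorem** for the roots in an interval, counted with multiplicity. -/
lemma rootCount_le_rootCount_derivative (p : ℝ[X]) {S : Set ℝ} (hS : S.OrdConnected) :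
    rootCount p S ≤ rootCount (derivative p) S + 1 := by
  classical
  rcases eq_or_ne (derivative p) 0 with hp' | hp'
  · rw [eq_C_of_derivative_eq_zero hp']
    simp [rootCount]
  have hp : p ≠ 0 := ne_of_apply_ne derivative (by rwa [derivative_zero])
  set A := {x ∈ p.roots.toFinset | x ∈ S} with hA
  set A' := {x ∈ (derivative p).roots.toFinset | x ∈ S} with hA'
  have hRolle : A.card ≤ (A' \ A).card + 1 := by
    refine Finset.card_le_sdiff_of_interleaved (s := A) (t := A') fun x hx y hy hxy hxy' => ?_
    simp only [hA, Finset.mem_filter, Multiset.mem_toFinset, mem_roots hp] at hx hy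
    obtain ⟨z, hz1, hz2⟩ := exists_deriv_eq_zero hxy p.continuousOn (hx.1.trans hy.1.symm)
    refine ⟨z, ?_, hz1⟩
    simp only [hA', Finset.mem_filter, Multiset.mem_toFinset, mem_roots hp']
    exact ⟨by rwa [IsRoot, ← p.deriv], hS.out hx.2 hy.2 ⟨hz1.1.le, hz1.2.le⟩⟩
  have hmem : ∀ x ∈ A, 1 ≤ p.rootMultiplicity x := fun x hx => by
    simp only [hA, Finset.mem_filter, Multiset.mem_toFinset] at hx
    rw [← count_roots]
    exact Multiset.count_pos.2 hx.1
  have hmem' : ∀ x ∈ A', 1 ≤ (derivative p).rootMultiplicity x := fun x hx => by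
    simp only [hA', Finset.mem_filter, Multiset.mem_toFinset] at hx
    rw [← count_roots]
    exact Multiset.count_pos.2 hx.1
  rw [rootCount_eq_sum, rootCount_eq_sum, ← hA, ← hA']
  calc ∑ x ∈ A, p.rootMultiplicity x = ∑ x ∈ A, (p.rootMultiplicity x - 1 + 1) :=
        Finset.sum_congr rfl fun x hx => (Nat.sub_add_cancel (hmem x hx)).symm
    _ = ∑ x ∈ A, (p.rootMultiplicity x - 1) + A.card := by
        rw [Finset.sum_add_distrib, Finset.card_eq_sum_ones]
    _ ≤ ∑ x ∈ A, (derivative p).rootMultiplicity x + ((A' \ A).card + 1) :=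
        add_le_add (Finset.sum_le_sum fun x _ =>
          rootMultiplicity_sub_one_le_derivative_rootMultiplicity _ _) hRolle
    _ ≤ ∑ x ∈ A ∩ A', (derivative p).rootMultiplicity x +
          (∑ x ∈ A' \ A, (derivative p).rootMultiplicity x + 1) := by
        rw [Finset.card_eq_sum_ones]
        refine add_le_add ?_ (Nat.add_le_add_right (Finset.sum_le_sum fun x hx => ?_) 1)
        · refine (Finset.sum_subset (s₁ := A ∩ A') (s₂ := A)
            (f := fun x => (derivative p).rootMultiplicity x)
            Finset.inter_subset_left fun x hx hx' => ?_).ge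
          have hxA : x ∈ S := (Finset.mem_filter.1 hx).2
          by_contra h0
          refine hx' (Finset.mem_inter.2 ⟨hx, ?_⟩)
          simp only [hA', Finset.mem_filter, Multiset.mem_toFinset]
          refine ⟨?_, hxA⟩
          rw [← Multiset.count_pos, count_roots]
          omega
        · exact hmem' x (Finset.mem_sdiff.1 hx).1
    _ = ∑ x ∈ A', (derivative p).rootMultiplicity x + 1 := by
        rw [Finset.inter_comm, ← add_assoc, Finset.sum_inter_add_sum_sdiff]

open Polynomial in
/-- Iterated form of Rolle's theorem: a polynomial with `k` roots in an interval and its first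
`k - 1` derivatives each vanish somewhere in it. -/
lemma exists_eval_iterate_derivative_eq_zero {p : ℝ[X]} {S : Set ℝ} (hS : S.OrdConnected) {k : ℕ}
    (hk : k ≤ rootCount p S) {j : ℕ} (hj : j < k) :
    ∃ x ∈ S, (derivative^[j] p).eval x = 0 := by
  have h : ∀ i, rootCount p S ≤ rootCount (derivative^[i] p) S + i := by
    intro i
    induction i with
    | zero => simp
    | succ i ih =>
      have := rootCount_le_rootCount_derivative (derivative^[i] p) hS
      rw [Function.iterate_succ_apply']
      omega
  have := h j
  exact (rootCount_pos_iff.1 (by omega : 0 < rootCount (derivative^[j] p) S)).2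

/-- A polynomial with a root in an interval is controlled by the mean square of its derivative. -/
lemma sq_eval_le_of_root {p : Polynomial ℝ} {α β r x : ℝ} (hr : r ∈ Set.Icc α β)
    (hx : x ∈ Set.Icc α β) :
    (p.eval x - p.eval r) ^ 2 ≤
      (β - α) * ∫ y in α..β, (p.derivative.eval y) ^ 2 := by
  have key : ∀ u ∈ Set.Icc α β, ∀ v ∈ Set.Icc α β, u ≤ v → (p.eval v - p.eval u) ^ 2 ≤
      (β - α) * ∫ y in α..β, (p.derivative.eval y) ^ 2 := by
    intro u hu v hv huv
    have hc : Continuous fun y => p.derivative.eval y := p.derivative.continuous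
    have h1 : ∫ y in u..v, p.derivative.eval y = p.eval v - p.eval u :=
      intervalIntegral.integral_eq_sub_of_hasDerivAt (fun y _ => p.hasDerivAt y)
        (hc.intervalIntegrable _ _)
    have h2 : (∫ y in u..v, p.derivative.eval y) ^ 2 ≤
        (v - u) * ∫ y in u..v, (p.derivative.eval y) ^ 2 := by
      set c := ∫ y in u..v, p.derivative.eval y with hc'
      -- Cauchy-Schwarz, by expanding a square
      have h0 : 0 ≤ ∫ y in u..v, ((v - u) * p.derivative.eval y - c) ^ 2 :=
        intervalIntegral.integral_nonneg huv fun y _ => sq_nonneg _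
      have e : ∀ y, ((v - u) * p.derivative.eval y - c) ^ 2 =
          (v - u) ^ 2 * (p.derivative.eval y) ^ 2
          - 2 * (v - u) * c * p.derivative.eval y + c ^ 2 := fun y => by ring
      simp_rw [e] at h0
      rw [intervalIntegral.integral_add (Continuous.intervalIntegrable (by fun_prop) _ _)
        (Continuous.intervalIntegrable (by fun_prop) _ _),
        intervalIntegral.integral_sub (Continuous.intervalIntegrable (by fun_prop) _ _)
        (Continuous.intervalIntegrable (by fun_prop) _ _), intervalIntegral.integral_const_mul,
        intervalIntegral.integral_const_mul, ← hc', intervalIntegral.integral_const,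
        smul_eq_mul] at h0
      rcases huv.eq_or_lt with h | h
      · have : c = 0 := by rw [hc', h]; simp
        rw [this, h]; simp
      · have : 0 ≤ (v - u) * ((v - u) * (∫ y in u..v, (p.derivative.eval y) ^ 2) - c ^ 2) := by
          linarith
        have := nonneg_of_mul_nonneg_right this (by linarith)
        linarith
    rw [h1] at h2
    refine h2.trans ?_
    have h3 : ∫ y in u..v, (p.derivative.eval y) ^ 2 ≤ ∫ y in α..β, (p.derivative.eval y) ^ 2 :=
      intervalIntegral.integral_mono_interval hu.1 huv hv.2
        (Eventually.of_forall fun y => sq_nonneg _)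
        (Continuous.intervalIntegrable (by fun_prop) _ _)
    have h4 : 0 ≤ ∫ y in u..v, (p.derivative.eval y) ^ 2 :=
      intervalIntegral.integral_nonneg huv fun y _ => sq_nonneg _
    have h5 : v - u ≤ β - α := by linarith [hu.1, hv.2]
    nlinarith [hu.1, hv.2]
  rcases le_total r x with h | h
  · exact key r hr x hx h
  · have := key x hx r hr h
    rwa [show (p.eval x - p.eval r) ^ 2 = (p.eval r - p.eval x) ^ 2 by ring]

open Polynomial in
/-- If `p` has at least `k ≥ 1` roots in an interval, then it is small there, compared with its
`k`-th derivative. -/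
lemma sq_eval_le_of_le_rootCount {p : ℝ[X]} {α β : ℝ} {S : Set ℝ}
    (hS : S.OrdConnected) (hSαβ : S ⊆ Set.Icc α β) {k : ℕ} (hk : k + 1 ≤ rootCount p S) {x : ℝ}
    (hx : x ∈ Set.Icc α β) :
    (p.eval x) ^ 2 ≤ (β - α) ^ (2 * k + 1) * ∫ y in α..β, ((derivative^[k + 1] p).eval y) ^ 2 := by
  have hαβ : 0 ≤ β - α := by linarith [hx.1, hx.2]
  have hroot : ∀ j < k + 1, ∃ r ∈ Set.Icc α β, (derivative^[j] p).eval r = 0 := fun j hj => by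
    obtain ⟨r, hr, h⟩ := exists_eval_iterate_derivative_eq_zero hS hk hj
    exact ⟨r, hSαβ hr, h⟩
  clear hk
  induction k generalizing p x with
  | zero =>
    obtain ⟨r, hr, h⟩ := hroot 0 (by norm_num)
    have := sq_eval_le_of_root (p := p) hr hx
    simp only [Function.iterate_zero, id] at h
    rw [h, sub_zero] at this
    simpa using this
  | succ k ih =>
    have ih' : ∀ y ∈ Set.Icc α β, ((derivative p).eval y) ^ 2 ≤
        (β - α) ^ (2 * k + 1) * ∫ y in α..β, ((derivative^[k + 1 + 1] p).eval y) ^ 2 := by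
      intro y hy
      exact ih (p := derivative p) hy fun j hj => hroot (j + 1) (by omega)
    obtain ⟨r, hr, h⟩ := hroot 0 (by omega)
    have h1 := sq_eval_le_of_root (p := p) hr hx
    simp only [Function.iterate_zero, id] at h
    rw [h, sub_zero] at h1
    refine h1.trans ?_
    set J := ∫ y in α..β, ((derivative^[k + 1 + 1] p).eval y) ^ 2
    have h2 : ∫ y in α..β, ((derivative p).eval y) ^ 2 ≤
        ∫ y in α..β, (β - α) ^ (2 * k + 1) * J :=
      intervalIntegral.integral_mono_on (by linarith)
        (Continuous.intervalIntegrable (by fun_prop) _ _)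
        (Continuous.intervalIntegrable (by fun_prop) _ _) ih'
    rw [intervalIntegral.integral_const, smul_eq_mul] at h2
    calc _ ≤ (β - α) * ((β - α) * ((β - α) ^ (2 * k + 1) * J)) := by gcongr
      _ = _ := by ring

lemma rootCount_neg_set (p : Polynomial ℝ) (S : Set ℝ) :
    rootCount p (-S) = rootCount (p.comp (-Polynomial.X)) S := by
  rw [← Set.image_neg_eq_neg]
  refine rootCount_image neg_injective.injOn fun x _ => ?_
  have := p.rootMultiplicity_comp_C_mul_X_add_C (-1) 0 x (by simp)
  simpa using this.symm

open Polynomial in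
lemma reflect_X_sub_C_pow (y : ℝ) (m : ℕ) :
    reflect m ((X - C y) ^ m) = (1 - C y * X) ^ m := by
  induction m with
  | zero => simp [reflect_one]
  | succ m ih =>
    rw [pow_succ, reflect_mul _ _ (by simp [natDegree_pow]) (by simp), ih, pow_succ]
    congr 1
    rw [reflect_sub, reflect_one_X, reflect_C, pow_one]

open Polynomial in
/-- Reversing the coefficients inverts the nonzero roots; equality follows by applying the
inequality twice. -/
lemma rootMultiplicity_le_reflect {p : ℝ[X]} {n : ℕ} (hp : p.natDegree ≤ n) {x : ℝ} (hx : x ≠ 0) :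
    p.rootMultiplicity x⁻¹ ≤ (reflect n p).rootMultiplicity x := by
  rcases eq_or_ne p 0 with rfl | h0
  · simp
  have hr : reflect n p ≠ 0 := by simpa using h0
  obtain ⟨q, hq⟩ := pow_rootMultiplicity_dvd p x⁻¹
  set m := p.rootMultiplicity x⁻¹
  have hm : ((X - C x⁻¹) ^ m).natDegree = m := by simp [natDegree_pow]
  have hq0 : q ≠ 0 := by rintro rfl; simp at hq; exact h0 hq
  have hdeg : m + q.natDegree ≤ n := by
    rw [hq, natDegree_mul (pow_ne_zero _ (X_sub_C_ne_zero _)) hq0, hm] at hp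
    exact hp
  rw [le_rootMultiplicity_iff hr, hq, show n = m + (n - m) by omega,
    reflect_mul _ _ hm.le (by omega), reflect_X_sub_C_pow]
  refine Dvd.dvd.mul_right (pow_dvd_pow_of_dvd ⟨C (-x⁻¹), ?_⟩ m) _
  rw [sub_mul, ← C_mul, mul_neg, mul_inv_cancel₀ hx]
  simp; ring

open Polynomial in
lemma rootCount_inv_set {p : ℝ[X]} {n : ℕ} (hp : p.natDegree ≤ n) {S : Set ℝ} (hS : (0 : ℝ) ∉ S) :
    rootCount p S⁻¹ = rootCount (reflect n p) S := by
  rw [← Set.image_inv_eq_inv]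
  refine rootCount_image inv_injective.injOn fun x hx => ?_
  have hx0 : x ≠ 0 := fun h => hS (h ▸ hx)
  refine le_antisymm (rootMultiplicity_le_reflect hp hx0) ?_
  have h := rootMultiplicity_le_reflect (p := reflect n p) (n := n)
    (natDegree_reflect_le.trans (by simp [hp])) (inv_ne_zero hx0)
  rwa [inv_inv, reflect_reflect] at h

lemma eval_mul_eval_pos_of_rootCount_eq_zero {p : Polynomial ℝ} {α β : ℝ} (hαβ : α ≤ β)
    (hα : p.eval α ≠ 0) (h : rootCount p (Set.Ioc α β) = 0) : 0 < p.eval α * p.eval β := by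
  have hp : p ≠ 0 := by rintro rfl; simp at hα
  have hne : ∀ x ∈ Set.Icc α β, p.eval x ≠ 0 := fun x hx h0 => by
    rcases hx.1.eq_or_lt with h1 | h1
    · exact hα (h1 ▸ h0)
    · have : 0 < rootCount p (Set.Ioc α β) := rootCount_pos_iff.2 ⟨hp, x, ⟨h1, hx.2⟩, h0⟩
      omega
  have hα' := hne α (Set.left_mem_Icc.2 hαβ)
  have hβ' := hne β (Set.right_mem_Icc.2 hαβ)
  by_contra hneg
  have hlt : p.eval α * p.eval β < 0 := lt_of_le_of_ne (not_lt.1 hneg) (mul_ne_zero hα' hβ')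
  have hc : ContinuousOn (fun x => p.eval x) (Set.Icc α β) := p.continuous.continuousOn
  rcases mul_neg_iff.1 hlt with ⟨h1, h2⟩ | ⟨h1, h2⟩
  · obtain ⟨x, hx, h0⟩ := intermediate_value_Icc' hαβ hc ⟨h2.le, h1.le⟩
    exact hne x hx h0
  · obtain ⟨x, hx, h0⟩ := intermediate_value_Icc hαβ hc ⟨h1.le, h2.le⟩
    exact hne x hx h0

open Polynomial in
lemma eval_mul_eval_neg_of_rootCount_eq_one {p : ℝ[X]} {α β : ℝ}
    (hα : p.eval α ≠ 0) (hβ : p.eval β ≠ 0) (h : rootCount p (Set.Ioc α β) = 1) :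
    p.eval α * p.eval β < 0 := by
  obtain ⟨hp, r, hr, h0⟩ := rootCount_pos_iff.1 (by omega : 0 < rootCount p (Set.Ioc α β))
  obtain ⟨q, rfl⟩ := dvd_iff_isRoot.2 (show IsRoot p r from h0)
  have hq : rootCount q (Set.Ioc α β) = 0 := by
    unfold rootCount at h ⊢
    rw [roots_mul hp, Multiset.countP_add, roots_X_sub_C] at h
    rw [← Multiset.cons_zero, Multiset.countP_cons, if_pos hr] at h
    omega
  rw [eval_mul] at hα hβ
  have h1 := eval_mul_eval_pos_of_rootCount_eq_zero (hr.1.le.trans hr.2)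
    (right_ne_zero_of_mul hα) hq
  have h2 : eval β (X - C r) ≠ 0 := left_ne_zero_of_mul hβ
  simp only [eval_mul, eval_sub, eval_X, eval_C] at h2 ⊢
  have h3 : α - r < 0 := by linarith [hr.1]
  have h4 : 0 < β - r := lt_of_le_of_ne (by linarith [hr.2]) h2.symm
  have : (α - r) * eval α q * ((β - r) * eval β q) =
    -((r - α) * (β - r) * (eval α q * eval β q)) := by ring
  rw [this]
  have : 0 < (r - α) * (β - r) * (eval α q * eval β q) := by
    have : 0 < r - α := by linarith
    positivity
  linarith

/-- Two polynomials with at most one root each in an interval, and of the same sign at each of its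
endpoints, have the same number of roots there. -/
lemma rootCount_eq_of_sign {p q : Polynomial ℝ} {α β : ℝ} (hαβ : α ≤ β)
    (hp : rootCount p (Set.Ioc α β) ≤ 1) (hq : rootCount q (Set.Ioc α β) ≤ 1)
    (h1 : 0 < p.eval α * q.eval α) (h2 : 0 < p.eval β * q.eval β) :
    rootCount p (Set.Ioc α β) = rootCount q (Set.Ioc α β) := by
  have a1 := left_ne_zero_of_mul h1.ne'
  have a2 := right_ne_zero_of_mul h1.ne'
  have a3 := left_ne_zero_of_mul h2.ne'
  have a4 := right_ne_zero_of_mul h2.ne'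
  have key : 0 < (p.eval α * p.eval β) * (q.eval α * q.eval β) := by
    have := mul_pos h1 h2
    linarith
  rcases Nat.le_one_iff_eq_zero_or_eq_one.1 hp with e1 | e1 <;>
    rcases Nat.le_one_iff_eq_zero_or_eq_one.1 hq with e2 | e2
  · rw [e1, e2]
  · have := eval_mul_eval_pos_of_rootCount_eq_zero hαβ a1 e1
    have := eval_mul_eval_neg_of_rootCount_eq_one a2 a4 e2
    nlinarith
  · have := eval_mul_eval_pos_of_rootCount_eq_zero hαβ a2 e2
    have := eval_mul_eval_neg_of_rootCount_eq_one a1 a3 e1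
    nlinarith
  · rw [e1, e2]

/-! ### Measurability of root counts -/

lemma IsSigmaCompact.measurableSet' {X : Type*} [TopologicalSpace X] [T2Space X]
    [MeasurableSpace X] [BorelSpace X] {s : Set X} (hs : IsSigmaCompact s) : MeasurableSet s := by
  obtain ⟨K, hK, rfl⟩ := hs
  exact MeasurableSet.iUnion fun i => (hK i).isClosed.measurableSet

lemma IsSigmaCompact.prod_set {X Y : Type*} [TopologicalSpace X] [TopologicalSpace Y]
    {s : Set X} {t : Set Y} (hs : IsSigmaCompact s) (ht : IsSigmaCompact t) :
    IsSigmaCompact (s ×ˢ t) := by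
  obtain ⟨K, hK, rfl⟩ := hs
  obtain ⟨L, hL, rfl⟩ := ht
  simp_rw [Set.iUnion_prod_const, Set.prod_iUnion]
  exact isSigmaCompact_iUnion _ fun i => isSigmaCompact_iUnion _ fun j =>
    ((hK i).prod (hL j)).isSigmaCompact

lemma IsSigmaCompact.union_set {X : Type*} [TopologicalSpace X]
    {s t : Set X} (hs : IsSigmaCompact s) (ht : IsSigmaCompact t) : IsSigmaCompact (s ∪ t) := by
  rw [Set.union_eq_iUnion]
  exact isSigmaCompact_iUnion _ fun b => by cases b <;> simpa

lemma IsOpen.isSigmaCompact_real {s : Set ℝ} (hs : IsOpen s) : IsSigmaCompact s := by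
  obtain ⟨F, hF, -, h, -⟩ := hs.exists_iUnion_isClosed
  rw [← h]
  exact isSigmaCompact_iUnion _ fun i =>
    isSigmaCompact_univ.of_isClosed_subset (hF i) (Set.subset_univ _)

lemma IsOpen.isSigmaCompact_inv {s : Set ℝ} (hs : IsOpen s) : IsSigmaCompact s⁻¹ := by
  have h : s⁻¹ = (fun x : ℝ => x⁻¹) '' (s \ {0}) ∪ (s ∩ {0}) := by
    ext x
    simp only [Set.mem_inv, Set.mem_union, Set.mem_image, Set.mem_sdiff, Set.mem_singleton_iff,
      Set.mem_inter_iff]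
    constructor
    · intro h
      by_cases hx : x = 0
      · right; subst hx; simpa using h
      · left; exact ⟨x⁻¹, ⟨h, inv_ne_zero hx⟩, inv_inv x⟩
    · rintro (⟨y, ⟨hy, _⟩, rfl⟩ | ⟨h, rfl⟩)
      · simpa using hy
      · simpa using h
  rw [h]
  refine IsSigmaCompact.union_set ?_ ?_
  · refine (hs.sdiff isClosed_singleton).isSigmaCompact_real.image_of_continuousOn ?_
    exact continuousOn_inv₀.mono fun x hx => hx.2
  · exact ((Set.finite_singleton (0 : ℝ)).subset Set.inter_subset_right).isCompact.isSigmaCompact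

lemma isSigmaCompact_Ioc (α β : ℝ) : IsSigmaCompact (Set.Ioc α β) := by
  rcases lt_or_ge α β with h | h
  · rw [← Set.Ioo_union_right h]
    exact isOpen_Ioo.isSigmaCompact_real.union_set isCompact_singleton.isSigmaCompact
  · rw [Set.Ioc_eq_empty (not_lt.2 h)]
    exact isSigmaCompact_empty

lemma isSigmaCompact_core (a b : ℝ) : IsSigmaCompact (core a b) := by
  have h1 : IsSigmaCompact (Set.Ioo (1 - a) (1 - b)) := isOpen_Ioo.isSigmaCompact_real
  have h2 : IsSigmaCompact (Set.Ioo (1 - a) (1 - b))⁻¹ := isOpen_Ioo.isSigmaCompact_inv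
  have hneg : ∀ {s : Set ℝ}, IsSigmaCompact s → IsSigmaCompact (-s) := fun {s} hs => by
    rw [← Set.image_neg_eq_neg]
    exact hs.image continuous_neg
  exact ((hneg h1).union_set h1).union_set ((hneg h2).union_set h2)

open Polynomial in
/-- The vectors of coefficients of the polynomials with at least `k` roots in `S` form a `σ`-compact
set: such a polynomial is a product of `X - C r`, with `r ∈ S`, and of a polynomial with at least
`k - 1` roots in `S`. -/
lemma isSigmaCompact_le_rootCount {S : Set ℝ} (hS : IsSigmaCompact S) (n k : ℕ) :
    IsSigmaCompact {v : Fin n → ℝ | ofFn n v = 0 ∨ k ≤ rootCount (ofFn n v) S} := by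
  induction k generalizing n with
  | zero => simp [isSigmaCompact_univ]
  | succ k ih =>
    cases n with
    | zero => simp [isSigmaCompact_univ]
    | succ n =>
      set A := {v : Fin n → ℝ | ofFn n v = 0 ∨ k ≤ rootCount (ofFn n v) S} with hA
      set F : ℝ × (Fin n → ℝ) → (Fin (n + 1) → ℝ) :=
        fun z => toFn (n + 1) ((X - C z.1) * ofFn n z.2) with hF
      have hcoeff : ∀ j, Continuous fun z : ℝ × (Fin n → ℝ) => (ofFn n z.2).coeff j := by
        intro j
        by_cases hj : j < n
        · simp_rw [ofFn_coeff_eq_val_of_lt _ hj]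
          fun_prop
        · simp_rw [ofFn_coeff_eq_zero_of_ge _ (not_lt.1 hj)]
          fun_prop
      have hFc : Continuous F := by
        refine continuous_pi fun i => ?_
        have e : ∀ z : ℝ × (Fin n → ℝ), F z i =
            (X * ofFn n z.2).coeff i - z.1 * (ofFn n z.2).coeff i := fun z => by
          simp [hF, toFn, sub_mul]
        simp_rw [e]
        rcases i with ⟨i, hi⟩
        cases i with
        | zero => simp only [coeff_X_mul_zero]; have := hcoeff 0; fun_prop
        | succ i => simp only [coeff_X_mul]; have := hcoeff i; have := hcoeff (i + 1); fun_prop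
      have hdeg : ∀ z : ℝ × (Fin n → ℝ), ((X - C z.1) * ofFn n z.2).natDegree < n + 1 := by
        intro z
        rcases Nat.eq_zero_or_pos n with h | h
        · subst h; simp
        · have := ofFn_natDegree_lt h z.2
          have := natDegree_mul_le (p := X - C z.1) (q := ofFn n z.2)
          rw [natDegree_X_sub_C] at this
          omega
      have heq : {v : Fin (n + 1) → ℝ | ofFn (n + 1) v = 0 ∨
          k + 1 ≤ rootCount (ofFn (n + 1) v) S} = {0} ∪ F '' (S ×ˢ A) := by
        ext v
        simp only [Set.mem_ofPred_eq, Set.mem_union, Set.mem_singleton_iff, Set.mem_image,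
          Set.mem_prod]
        constructor
        · rintro (h | h)
          · left
            exact injective_ofFn _ (by rw [h, ofFn_zero])
          · right
            obtain ⟨h0, r, hr, hroot⟩ := rootCount_pos_iff.1
              (by omega : 0 < rootCount (ofFn (n + 1) v) S)
            obtain ⟨q, hq⟩ := dvd_iff_isRoot.2 (show IsRoot _ r from hroot)
            have hq0 : q ≠ 0 := by rintro rfl; simp at hq; exact h0 hq
            have hqdeg : q.natDegree < n := by
              have h1 := ofFn_natDegree_lt (by omega : 1 ≤ n + 1) v
              rw [hq, natDegree_mul (X_sub_C_ne_zero r) hq0, natDegree_X_sub_C] at h1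
              omega
            refine ⟨(r, toFn n q), ⟨hr, ?_⟩, ?_⟩
            · right
              rw [ofFn_comp_toFn_eq_id_of_natDegree_lt hqdeg]
              unfold rootCount at h ⊢
              rw [hq, roots_mul (hq ▸ h0), Multiset.countP_add, roots_X_sub_C,
                ← Multiset.cons_zero, Multiset.countP_cons, if_pos hr] at h
              simp only [Multiset.countP_zero] at h
              omega
            · simp only [hF]
              rw [ofFn_comp_toFn_eq_id_of_natDegree_lt hqdeg, ← hq, toFn_comp_ofFn_eq_id]
        · rintro (rfl | ⟨z, ⟨hr, hw⟩, rfl⟩)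
          · left; simp
          · simp only [hF]
            rw [ofFn_comp_toFn_eq_id_of_natDegree_lt (hdeg z)]
            rcases hw with h | h
            · left; rw [h, mul_zero]
            · by_cases h0 : (X - C z.1) * ofFn n z.2 = 0
              · left; exact h0
              · right
                unfold rootCount at h ⊢
                rw [roots_mul h0, Multiset.countP_add, roots_X_sub_C,
                  ← Multiset.cons_zero, Multiset.countP_cons, if_pos hr]
                omega
      rw [heq]
      exact isCompact_singleton.isSigmaCompact.union_set ((hS.prod_set (ih n)).image hFc)

open Polynomial in
/-- The zero polynomial, whose root count is `0` by convention, is a single point of the space of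
coefficients and is treated apart. -/
lemma measurable_rootCount_ofFn {S : Set ℝ} (hS : IsSigmaCompact S) (n : ℕ) :
    Measurable fun v : Fin n → ℝ => rootCount (ofFn n v) S := by
  refine measurable_of_Ici fun k => ?_
  rcases Nat.eq_zero_or_pos k with rfl | hk
  · simp
  · have h : (fun v : Fin n → ℝ => rootCount (ofFn n v) S) ⁻¹' Set.Ici k =
        {v : Fin n → ℝ | ofFn n v = 0 ∨ k ≤ rootCount (ofFn n v) S} \ {0} := by
      ext v
      simp only [Set.mem_preimage, Set.mem_Ici, Set.mem_sdiff, Set.mem_ofPred_eq,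
        Set.mem_singleton_iff]
      constructor
      · intro h
        refine ⟨Or.inr h, ?_⟩
        rintro rfl
        simp [rootCount] at h
        omega
      · rintro ⟨h | h, h0⟩
        · exact absurd (injective_ofFn _ (by rw [h, ofFn_zero])) h0
        · exact h
    rw [h]
    exact (isSigmaCompact_le_rootCount hS n k).measurableSet'.diff (measurableSet_singleton 0)

lemma weightedPoly_coeff (n : ℕ) (c x : ℕ → ℝ) (i : ℕ) :
    (weightedPoly n c x).coeff i = if i < n + 1 then c i * x i else 0 := by
  simp [weightedPoly, Polynomial.finsetSum_coeff, Polynomial.coeff_C_mul, Polynomial.coeff_X_pow,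
    -map_mul]

lemma natDegree_weightedPoly_le (n : ℕ) (c x : ℕ → ℝ) : (weightedPoly n c x).natDegree ≤ n := by
  rw [Polynomial.natDegree_le_iff_coeff_eq_zero]
  intro i hi
  rw [weightedPoly_coeff, if_neg (by omega)]

open Polynomial in
lemma weightedPoly_eq_ofFn (n : ℕ) (c x : ℕ → ℝ) :
    weightedPoly n c x = ofFn (n + 1) (fun i : Fin (n + 1) => c i * x i) := by
  ext i
  rw [weightedPoly_coeff]
  split_ifs with h
  · rw [ofFn_coeff_eq_val_of_lt _ h]
  · rw [ofFn_coeff_eq_zero_of_ge _ (by omega)]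

/-- Only the variables with a nonzero weight have to be measurable, so that a truncated polynomial
has a root count measurable with respect to the variables in its window. -/
lemma measurable_rootCount_weightedPoly {S : Set ℝ} (hS : IsSigmaCompact S) (n : ℕ) (c : ℕ → ℝ)
    {Ω : Type*} [MeasurableSpace Ω] {ζ : ℕ → Ω → ℝ} (hζ : ∀ i ≤ n, c i ≠ 0 → Measurable (ζ i)) :
    Measurable fun ω => rootCount (weightedPoly n c fun i => ζ i ω) S := by
  simp_rw [weightedPoly_eq_ofFn]
  refine (measurable_rootCount_ofFn hS (n + 1)).comp (measurable_pi_lambda _ fun i => ?_)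
  by_cases h : c i = 0
  · simp [h]
  · exact (hζ i (by omega) h).const_mul _

/-! ### Gaussian random polynomials -/

section

variable {Ω : Type*} [MeasurableSpace Ω] {P : Measure Ω} [IsProbabilityMeasure P]

/-- A sequence of measurable, independent standard Gaussian variables. -/
structure IsStdGaussianSeq (ζ : ℕ → Ω → ℝ) (P : Measure Ω) : Prop where
  measurable : ∀ i, Measurable (ζ i)
  indep : iIndepFun ζ P
  law : ∀ i, HasLaw (ζ i) (gaussianReal 0 1) P

omit [IsProbabilityMeasure P] in
lemma IsStdGaussianSeq.comp_injective {ζ : ℕ → Ω → ℝ} (hζ : IsStdGaussianSeq ζ P) {g : ℕ → ℕ}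
    (hg : Function.Injective g) : IsStdGaussianSeq (fun i => ζ (g i)) P :=
  ⟨fun _ => hζ.measurable _, hζ.indep.precomp hg, fun _ => hζ.law _⟩

lemma IsStdGaussianSeq.map_sum {ζ : ℕ → Ω → ℝ} (hζ : IsStdGaussianSeq ζ P) (s : Finset ℕ)
    (a : ℕ → ℝ) : P.map (fun ω => ∑ i ∈ s, a i * ζ i ω) =
      gaussianReal 0 (∑ i ∈ s, a i ^ 2).toNNReal := by
  have hm : ∀ i, Measurable fun ω => a i * ζ i ω := fun i => (hζ.measurable i).const_mul _
  have : IsProbabilityMeasure (P.map (fun ω => ∑ i ∈ s, a i * ζ i ω)) :=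
    Measure.isProbabilityMeasure_map (Finset.measurable_fun_sum _ fun i _ => hm i).aemeasurable
  refine Measure.ext_of_charFun ?_
  funext t
  have hi : iIndepFun (fun i ω => a i * ζ i ω) P :=
    hζ.indep.comp (fun i x => a i * x) (fun i => by fun_prop)
  rw [iIndepFun.charFun_map_fun_finsetSum_eq_prod (fun i _ => (hm i).aemeasurable) (hi.restrict _)]
  have h1 : ∀ i, charFun (P.map fun ω => a i * ζ i ω) t =
      Complex.exp (-((a i ^ 2 * t ^ 2 / 2 : ℝ))) := by
    intro i
    rw [(gaussianReal_const_mul (hζ.law i) (a i)).map_eq, charFun_gaussianReal]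
    congr 1
    simp
  simp only [Finset.prod_apply, h1]
  rw [charFun_gaussianReal, ← Complex.exp_sum]
  congr 1
  have h2 : (((∑ i ∈ s, a i ^ 2).toNNReal : ℝ) : ℂ) = ((∑ i ∈ s, a i ^ 2 : ℝ) : ℂ) := by
    rw [Real.coe_toNNReal _ (Finset.sum_nonneg fun i _ => sq_nonneg _)]
  rw [h2]
  push_cast
  simp only [mul_zero, zero_mul, zero_sub]
  rw [Finset.sum_mul, Finset.sum_div, Finset.sum_neg_distrib]

lemma IsStdGaussianSeq.lintegral_sq_sum {ζ : ℕ → Ω → ℝ} (hζ : IsStdGaussianSeq ζ P) (s : Finset ℕ)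
    (a : ℕ → ℝ) : ∫⁻ ω, ENNReal.ofReal ((∑ i ∈ s, a i * ζ i ω) ^ 2) ∂P =
      ENNReal.ofReal (∑ i ∈ s, a i ^ 2) := by
  have hm : Measurable fun ω => ∑ i ∈ s, a i * ζ i ω :=
    Finset.measurable_fun_sum _ fun i _ => (hζ.measurable i).const_mul _
  have h1 : ∫⁻ ω, ENNReal.ofReal ((∑ i ∈ s, a i * ζ i ω) ^ 2) ∂P =
      ∫⁻ x, ENNReal.ofReal (x ^ 2) ∂(P.map fun ω => ∑ i ∈ s, a i * ζ i ω) := by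
    rw [lintegral_map (by fun_prop) hm]
  rw [h1, hζ.map_sum]
  set v := (∑ i ∈ s, a i ^ 2).toNNReal with hv
  have h2 := variance_fun_id_gaussianReal (μ := 0) (v := v)
  have hmem := memLp_id_gaussianReal (μ := 0) (v := v) 2
  rw [variance_of_integral_eq_zero (by fun_prop) (by simp)] at h2
  have hint : Integrable (fun x : ℝ => x ^ 2) (gaussianReal 0 v) := hmem.integrable_sq
  rw [← ofReal_integral_eq_lintegral_ofReal hint
    (Eventually.of_forall fun x => sq_nonneg _), h2, hv,
    Real.coe_toNNReal _ (Finset.sum_nonneg fun i _ => sq_nonneg _)]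

/-- The density of a Gaussian variable of variance `v` is at most `1 / (2√v)`. -/
lemma IsStdGaussianSeq.measure_abs_sum_le {ζ : ℕ → Ω → ℝ} (hζ : IsStdGaussianSeq ζ P)
    (s : Finset ℕ) (a : ℕ → ℝ) (h0 : 0 < ∑ i ∈ s, a i ^ 2) (t : ℝ) :
    P {ω | |∑ i ∈ s, a i * ζ i ω| ≤ t} ≤ ENNReal.ofReal (t / √(∑ i ∈ s, a i ^ 2)) := by
  have hm : Measurable fun ω => ∑ i ∈ s, a i * ζ i ω :=
    Finset.measurable_fun_sum _ fun i _ => (hζ.measurable i).const_mul _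
  have h1 : P {ω | |∑ i ∈ s, a i * ζ i ω| ≤ t} =
      (P.map fun ω => ∑ i ∈ s, a i * ζ i ω) (Set.Icc (-t) t) := by
    rw [Measure.map_apply hm measurableSet_Icc]
    congr 1
    ext ω
    simp [abs_le]
  rw [h1, hζ.map_sum]
  set V := ∑ i ∈ s, a i ^ 2 with hV
  have hv : V.toNNReal ≠ 0 := by simpa using h0
  rw [gaussianReal_apply _ hv]
  have hpdf : ∀ x, gaussianPDF 0 V.toNNReal x ≤ ENNReal.ofReal (1 / (2 * √V)) := by
    intro x
    rw [gaussianPDF_def]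
    refine ENNReal.ofReal_le_ofReal ?_
    rw [gaussianPDFReal_def]
    simp only [Real.coe_toNNReal _ h0.le]
    have e1 : Real.exp (-(x - 0) ^ 2 / (2 * V)) ≤ 1 := by
      refine Real.exp_le_one_iff.2 ?_
      have : 0 ≤ (x - 0) ^ 2 / (2 * V) := by positivity
      rw [neg_div]; linarith
    have e2 : 2 * √V ≤ √(2 * Real.pi * V) := by
      rw [show 2 * √V = √(4 * V) by
        rw [Real.sqrt_mul (by norm_num), show (4 : ℝ) = 2 ^ 2 by norm_num,
          Real.sqrt_sq (by norm_num)]]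
      refine Real.sqrt_le_sqrt ?_
      nlinarith [Real.pi_gt_three]
    have hs : 0 < √V := Real.sqrt_pos.2 h0
    calc (√(2 * Real.pi * V))⁻¹ * Real.exp (-(x - 0) ^ 2 / (2 * V)) ≤ (2 * √V)⁻¹ * 1 := by
          gcongr
      _ = 1 / (2 * √V) := by simp
  calc ∫⁻ x in Set.Icc (-t) t, gaussianPDF 0 V.toNNReal x
      ≤ ∫⁻ x in Set.Icc (-t) t, ENNReal.ofReal (1 / (2 * √V)) := lintegral_mono fun x => hpdf x
    _ = ENNReal.ofReal (1 / (2 * √V)) * ENNReal.ofReal (2 * t) := by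
        rw [setLIntegral_const, Real.volume_Icc]
        congr 2; ring
    _ = ENNReal.ofReal (t / √V) := by
        rw [← ENNReal.ofReal_mul (by positivity)]
        congr 1
        field_simp

/-- **Anti-concentration.** A Gaussian variable is rarely smaller than a random quantity whose mean
square is small compared with its variance. -/
lemma IsStdGaussianSeq.measureReal_sq_sum_le {ζ : ℕ → Ω → ℝ} (hζ : IsStdGaussianSeq ζ P)
    (s : Finset ℕ) (a : ℕ → ℝ) (h0 : 0 < ∑ i ∈ s, a i ^ 2) {Z : Ω → ℝ} (hZ : AEMeasurable Z P)
    {μ : ℝ} (hμ : 0 < μ)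
    (h : ∫⁻ ω, ENNReal.ofReal (Z ω) ∂P ≤ ENNReal.ofReal (μ ^ 3 * ∑ i ∈ s, a i ^ 2)) :
    P.real {ω | (∑ i ∈ s, a i * ζ i ω) ^ 2 ≤ Z ω} ≤ 2 * μ := by
  set V := ∑ i ∈ s, a i ^ 2 with hV
  have hs : 0 < √V := Real.sqrt_pos.2 h0
  have hsub : {ω | (∑ i ∈ s, a i * ζ i ω) ^ 2 ≤ Z ω} ⊆
      {ω | |∑ i ∈ s, a i * ζ i ω| ≤ μ * √V} ∪
        {ω | ENNReal.ofReal (μ ^ 2 * V) ≤ ENNReal.ofReal (Z ω)} := by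
    intro ω hω
    by_cases h1 : |∑ i ∈ s, a i * ζ i ω| ≤ μ * √V
    · exact Or.inl h1
    · right
      refine ENNReal.ofReal_le_ofReal (le_trans ?_ hω)
      rw [← sq_abs (∑ i ∈ s, a i * ζ i ω)]
      calc μ ^ 2 * V = (μ * √V) ^ 2 := by rw [mul_pow, Real.sq_sqrt h0.le]
        _ ≤ _ := by gcongr; exact (not_le.1 h1).le
  have h1 := hζ.measure_abs_sum_le s a h0 (μ * √V)
  rw [← hV, mul_div_assoc, div_self hs.ne', mul_one] at h1
  have h2 : P {ω | ENNReal.ofReal (μ ^ 2 * V) ≤ ENNReal.ofReal (Z ω)} ≤ ENNReal.ofReal μ := by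
    have := mul_meas_ge_le_lintegral₀ hZ.ennreal_ofReal (ENNReal.ofReal (μ ^ 2 * V))
    have h3 := this.trans h
    rw [show μ ^ 3 * V = (μ ^ 2 * V) * μ by ring,
      ENNReal.ofReal_mul (p := μ ^ 2 * V) (by positivity)] at h3
    exact (ENNReal.mul_le_mul_iff_right (by simpa using by positivity) ENNReal.ofReal_ne_top).1 h3
  have h3 : P {ω | (∑ i ∈ s, a i * ζ i ω) ^ 2 ≤ Z ω} ≤ ENNReal.ofReal (2 * μ) := by
    refine (measure_mono hsub).trans ((measure_union_le _ _).trans ((add_le_add h1 h2).trans ?_))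
    rw [← ENNReal.ofReal_add hμ.le hμ.le]
    exact ENNReal.ofReal_le_ofReal (by linarith)
  exact ENNReal.toReal_le_of_le_ofReal (by positivity) h3

/-- The variance at `y` of the `k`-th derivative of the random polynomial with weights `d`. -/
noncomputable def derivVar (n : ℕ) (d : ℕ → ℝ) (k : ℕ) (y : ℝ) : ℝ :=
  ∑ i ∈ Finset.range (n + 1), (d i * (i.descFactorial k : ℝ) * y ^ (i - k)) ^ 2

lemma derivVar_nonneg (n : ℕ) (d : ℕ → ℝ) (k : ℕ) (y : ℝ) : 0 ≤ derivVar n d k y :=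
  Finset.sum_nonneg fun _ _ => sq_nonneg _

open Polynomial in
lemma eval_iterate_derivative_weightedPoly (n : ℕ) (d x : ℕ → ℝ) (k : ℕ) (y : ℝ) :
    (derivative^[k] (weightedPoly n d x)).eval y =
      ∑ i ∈ Finset.range (n + 1), (d i * (i.descFactorial k : ℝ) * y ^ (i - k)) * x i := by
  unfold weightedPoly
  rw [iterate_derivative_sum, eval_finsetSum]
  refine Finset.sum_congr rfl fun i _ => ?_
  rw [iterate_derivative_C_mul, iterate_derivative_X_pow_eq_natCast_mul]
  simp
  ring

lemma eval_weightedPoly (n : ℕ) (d x : ℕ → ℝ) (y : ℝ) :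
    (weightedPoly n d x).eval y = ∑ i ∈ Finset.range (n + 1), (d i * y ^ i) * x i := by
  simpa using eval_iterate_derivative_weightedPoly n d x 0 y

lemma derivVar_zero (n : ℕ) (d : ℕ → ℝ) (y : ℝ) :
    derivVar n d 0 y = ∑ i ∈ Finset.range (n + 1), (d i * y ^ i) ^ 2 := by
  simp [derivVar]

section
variable {ζ : ℕ → Ω → ℝ}

open Polynomial in
/-- Tonelli's theorem turns a pointwise bound on the variance into one on the mean of `∫ (p⁽ᵏ⁾)²`.
-/
lemma IsStdGaussianSeq.lintegral_integral_sq_le (hζ : IsStdGaussianSeq ζ P) (n : ℕ) (d : ℕ → ℝ)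
    (k : ℕ) {α β M : ℝ} (hαβ : α ≤ β) (hM : ∀ y ∈ Set.Icc α β, derivVar n d k y ≤ M) :
    ∫⁻ ω, ENNReal.ofReal (∫ y in α..β,
      ((derivative^[k] (weightedPoly n d fun i => ζ i ω)).eval y) ^ 2) ∂P ≤
      ENNReal.ofReal ((β - α) * M) := by
  have h1 : ∀ ω, ENNReal.ofReal (∫ y in α..β,
      ((derivative^[k] (weightedPoly n d fun i => ζ i ω)).eval y) ^ 2) =
      ∫⁻ y in Set.Ioc α β,
        ENNReal.ofReal (((derivative^[k] (weightedPoly n d fun i => ζ i ω)).eval y) ^ 2) := by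
    intro ω
    rw [intervalIntegral.integral_of_le hαβ, ofReal_integral_eq_lintegral_ofReal]
    · exact ((Continuous.integrableOn_Icc (by fun_prop)).mono_set Set.Ioc_subset_Icc_self)
    · exact Eventually.of_forall fun y => sq_nonneg _
  simp_rw [h1]
  rw [lintegral_lintegral_swap]
  · calc _ = ∫⁻ y in Set.Ioc α β, ENNReal.ofReal (derivVar n d k y) := by
          refine lintegral_congr fun y => ?_
          simp_rw [eval_iterate_derivative_weightedPoly]
          exact hζ.lintegral_sq_sum _ _
      _ ≤ ∫⁻ y in Set.Ioc α β, ENNReal.ofReal M :=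
          setLIntegral_mono' measurableSet_Ioc fun y hy =>
            ENNReal.ofReal_le_ofReal (hM y ⟨hy.1.le, hy.2⟩)
      _ = ENNReal.ofReal ((β - α) * M) := by
          rw [setLIntegral_const, Real.volume_Ioc, mul_comm, ← ENNReal.ofReal_mul (by linarith)]
  · refine Measurable.aemeasurable ?_
    simp only [Function.uncurry_def, eval_iterate_derivative_weightedPoly]
    refine ENNReal.measurable_ofReal.comp (Measurable.pow_const ?_ 2)
    refine Finset.measurable_fun_sum _ fun i _ => ?_
    have : Measurable fun z : Ω × ℝ => ζ i z.1 := (hζ.measurable i).comp measurable_fst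
    exact Measurable.mul (by fun_prop) this

omit [IsProbabilityMeasure P] in
open Polynomial in
lemma IsStdGaussianSeq.measurable_integral_sq (hζ : IsStdGaussianSeq ζ P) (n : ℕ) (d : ℕ → ℝ)
    (k : ℕ) (α β : ℝ) : Measurable fun ω => ∫ y in α..β,
      ((derivative^[k] (weightedPoly n d fun i => ζ i ω)).eval y) ^ 2 := by
  have h : StronglyMeasurable (Function.uncurry fun (ω : Ω) (y : ℝ) =>
      ((derivative^[k] (weightedPoly n d fun i => ζ i ω)).eval y) ^ 2) := by
    refine Measurable.stronglyMeasurable ?_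
    simp only [Function.uncurry_def, eval_iterate_derivative_weightedPoly]
    refine Measurable.pow_const ?_ 2
    refine Finset.measurable_fun_sum _ fun i _ => ?_
    have : Measurable fun z : Ω × ℝ => ζ i z.1 := (hζ.measurable i).comp measurable_fst
    exact Measurable.mul (by fun_prop) this
  simp only [intervalIntegral]
  exact (h.integral_prod_right.measurable).sub (h.integral_prod_right.measurable)

/-- Many roots in a short interval are unlikely: the polynomial would be small there compared with
one of its derivatives. -/
lemma IsStdGaussianSeq.measureReal_le_rootCount (hζ : IsStdGaussianSeq ζ P) (n : ℕ) (d : ℕ → ℝ)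
    (k : ℕ) {α β M x μ : ℝ} (hx : x ∈ Set.Icc α β)
    (hM : ∀ y ∈ Set.Icc α β, derivVar n d (k + 1) y ≤ M) (h0 : 0 < derivVar n d 0 x) (hμ : 0 < μ)
    (h : (β - α) ^ (2 * k + 2) * M ≤ μ ^ 3 * derivVar n d 0 x) :
    P.real {ω | k + 1 ≤ rootCount (weightedPoly n d fun i => ζ i ω) (Set.Ioc α β)} ≤ 2 * μ := by
  have hαβ : α ≤ β := hx.1.trans hx.2
  have hlen : 0 ≤ β - α := by linarith
  rw [derivVar_zero] at h0 h
  refine (measureReal_mono ?_).trans (hζ.measureReal_sq_sum_le (Finset.range (n + 1))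
    (fun i => d i * x ^ i) h0 (Z := fun ω => (β - α) ^ (2 * k + 1) * ∫ y in α..β,
      ((Polynomial.derivative^[k + 1] (weightedPoly n d fun i => ζ i ω)).eval y) ^ 2)
    ((hζ.measurable_integral_sq n d (k + 1) α β).const_mul _).aemeasurable hμ ?_)
  · intro ω hω
    have := sq_eval_le_of_le_rootCount Set.ordConnected_Ioc Set.Ioc_subset_Icc_self hω hx
    rw [eval_weightedPoly] at this
    exact this
  · simp_rw [ENNReal.ofReal_mul (pow_nonneg hlen (2 * k + 1))]
    rw [lintegral_const_mul _ (hζ.measurable_integral_sq n d (k + 1) α β).ennreal_ofReal]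
    refine (mul_le_mul_right (hζ.lintegral_integral_sq_le n d (k + 1) hαβ hM) _).trans ?_
    rw [← ENNReal.ofReal_mul (pow_nonneg hlen _)]
    refine ENNReal.ofReal_le_ofReal (le_trans (le_of_eq ?_) h)
    ring

/-- The signs at a point of two polynomials with close weights rarely differ. -/
lemma IsStdGaussianSeq.measureReal_sign_ne (hζ : IsStdGaussianSeq ζ P) (n : ℕ) (d d' : ℕ → ℝ)
    {x μ : ℝ} (h0 : 0 < derivVar n d 0 x) (hμ : 0 < μ)
    (h : derivVar n (fun i => d i - d' i) 0 x ≤ μ ^ 3 * derivVar n d 0 x) :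
    P.real {ω | ¬ 0 < (weightedPoly n d fun i => ζ i ω).eval x *
      (weightedPoly n d' fun i => ζ i ω).eval x} ≤ 2 * μ := by
  rw [derivVar_zero, derivVar_zero] at h
  rw [derivVar_zero] at h0
  refine (measureReal_mono ?_).trans (hζ.measureReal_sq_sum_le (Finset.range (n + 1))
    (fun i => d i * x ^ i) h0 (Z := fun ω => (∑ i ∈ Finset.range (n + 1),
      ((d i - d' i) * x ^ i) * ζ i ω) ^ 2) ?_ hμ ?_)
  · intro ω hω
    simp only [Set.mem_ofPred_eq, eval_weightedPoly] at hω ⊢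
    have e : ∑ i ∈ Finset.range (n + 1), ((d i - d' i) * x ^ i) * ζ i ω =
        ∑ i ∈ Finset.range (n + 1), (d i * x ^ i) * ζ i ω -
          ∑ i ∈ Finset.range (n + 1), (d' i * x ^ i) * ζ i ω := by
      rw [← Finset.sum_sub_distrib]
      exact Finset.sum_congr rfl fun i _ => by ring
    rw [e]
    set u := ∑ i ∈ Finset.range (n + 1), (d i * x ^ i) * ζ i ω
    set v := ∑ i ∈ Finset.range (n + 1), (d' i * x ^ i) * ζ i ω
    nlinarith [sq_nonneg v]
  · exact ((Finset.measurable_fun_sum _ fun i _ =>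
      (hζ.measurable i).const_mul _).pow_const 2).aemeasurable
  · rw [hζ.lintegral_sq_sum]
    exact ENNReal.ofReal_le_ofReal h

/-- A polynomial with a dominant monomial `m ζ_j x ^ j` rarely has a root. -/
lemma IsStdGaussianSeq.measureReal_one_le_rootCount (hζ : IsStdGaussianSeq ζ P) (n : ℕ)
    (d : ℕ → ℝ) {j : ℕ} (hj : j ≤ n) {α β M M' x m μ : ℝ} (hx : x ∈ Set.Icc α β)
    (hM : ∀ y ∈ Set.Icc α β, derivVar n (Function.update d j 0) 1 y ≤ M)
    (hM' : derivVar n (Function.update d j 0) 0 x ≤ M') (hm : 0 < m)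
    (hdom : ∀ y ∈ Set.Icc α β, m ≤ (d j * y ^ j) ^ 2) (hμ : 0 < μ)
    (h : 2 * M' + 2 * (β - α) ^ 2 * M ≤ μ ^ 3 * m) :
    P.real {ω | 1 ≤ rootCount (weightedPoly n d fun i => ζ i ω) (Set.Ioc α β)} ≤ 2 * μ := by
  have hαβ : α ≤ β := hx.1.trans hx.2
  have hlen : 0 ≤ β - α := by linarith
  set d' := Function.update d j 0 with hd'
  have hev : ∀ ω y, (weightedPoly n d fun i => ζ i ω).eval y =
      (weightedPoly n d' fun i => ζ i ω).eval y + d j * y ^ j * ζ j ω := by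
    intro ω y
    rw [eval_weightedPoly, eval_weightedPoly]
    rw [← Finset.add_sum_erase _ _ (Finset.mem_range.2 (Nat.lt_succ_of_le hj)),
      ← Finset.add_sum_erase _ (fun i => (d' i * y ^ i) * ζ i ω)
        (Finset.mem_range.2 (Nat.lt_succ_of_le hj))]
    have : ∀ i ∈ (Finset.range (n + 1)).erase j, d' i = d i := fun i hi => by
      simp [hd', (Finset.ne_of_mem_erase hi)]
    rw [Finset.sum_congr rfl fun i hi => by rw [← this i hi]]
    simp [hd']
    ring
  set Q : Ω → Polynomial ℝ := fun ω => weightedPoly n d' fun i => ζ i ω with hQ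
  have hsum : ∑ i ∈ ({j} : Finset ℕ), (fun _ => √m) i ^ 2 = m := by
    simp [Real.sq_sqrt hm.le]
  have hmQ : Measurable fun ω => (Q ω).eval x := by
    simp only [hQ, eval_weightedPoly]
    exact Finset.measurable_fun_sum _ fun i _ => (hζ.measurable i).const_mul _
  have hmI := hζ.measurable_integral_sq n d' 1 α β
  refine (measureReal_mono ?_).trans (hζ.measureReal_sq_sum_le {j} (fun _ => √m)
    (by rw [hsum]; exact hm) (Z := fun ω => 2 * (Q ω).eval x ^ 2 + (2 * (β - α)) * ∫ y in α..β,
      ((Polynomial.derivative^[1] (Q ω)).eval y) ^ 2)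
    (((hmQ.pow_const 2).const_mul _).add (hmI.const_mul _)).aemeasurable hμ ?_)
  · intro ω hω
    obtain ⟨-, r, hr, hr0⟩ := rootCount_pos_iff.1 hω
    have hr' := Set.Ioc_subset_Icc_self hr
    rw [hev ω r] at hr0
    have h1 := sq_eval_le_of_root (p := Q ω) hx hr'
    simp only [Finset.sum_singleton, Set.mem_ofPred_eq, Function.iterate_one]
    have h2 : m * ζ j ω ^ 2 ≤ (d j * r ^ j) ^ 2 * ζ j ω ^ 2 := by gcongr; exact hdom r hr'
    have h3 : (d j * r ^ j) ^ 2 * ζ j ω ^ 2 = ((Q ω).eval r) ^ 2 := by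
      have : (Q ω).eval r = -(d j * r ^ j * ζ j ω) := by
        rw [hQ]; linarith
      rw [this]; ring
    rw [mul_pow, Real.sq_sqrt hm.le]
    nlinarith [sq_nonneg ((Q ω).eval r - 2 * (Q ω).eval x)]
  · have hE : ∀ ω, ENNReal.ofReal (2 * (Q ω).eval x ^ 2 + (2 * (β - α)) * ∫ y in α..β,
        ((Polynomial.derivative^[1] (Q ω)).eval y) ^ 2) =
        ENNReal.ofReal 2 * ENNReal.ofReal ((Q ω).eval x ^ 2) + ENNReal.ofReal (2 * (β - α)) *
          ENNReal.ofReal (∫ y in α..β, ((Polynomial.derivative^[1] (Q ω)).eval y) ^ 2) := by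
      intro ω
      rw [ENNReal.ofReal_add (by positivity) (mul_nonneg (by positivity)
        (intervalIntegral.integral_nonneg hαβ fun y _ => sq_nonneg _)),
        ENNReal.ofReal_mul (by norm_num), ENNReal.ofReal_mul (by positivity)]
    simp_rw [hE]
    rw [lintegral_add_left ((hmQ.pow_const 2).ennreal_ofReal.const_mul _),
      lintegral_const_mul _ (hmQ.pow_const 2).ennreal_ofReal,
      lintegral_const_mul _ hmI.ennreal_ofReal, hsum]
    have h1 : ∫⁻ ω, ENNReal.ofReal ((Q ω).eval x ^ 2) ∂P ≤ ENNReal.ofReal M' := by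
      simp only [hQ, eval_weightedPoly]
      rw [hζ.lintegral_sq_sum, ← derivVar_zero]
      exact ENNReal.ofReal_le_ofReal hM'
    have h2 := hζ.lintegral_integral_sq_le n d' 1 hαβ hM
    have hM0 : 0 ≤ M := (derivVar_nonneg _ _ _ _).trans (hM x hx)
    have hM0' : 0 ≤ M' := (derivVar_nonneg _ _ _ _).trans hM'
    refine (add_le_add (mul_le_mul_right h1 _) (mul_le_mul_right h2 _)).trans ?_
    rw [← ENNReal.ofReal_mul (by norm_num), ← ENNReal.ofReal_mul (by positivity),
      ← ENNReal.ofReal_add (by positivity) (by positivity)]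
    refine ENNReal.ofReal_le_ofReal (le_trans (le_of_eq ?_) h)
    ring

end

end

/-! ### Root counts on a geometric interval -/

section

variable {Ω : Type*} [MeasurableSpace Ω] {P : Measure Ω} [IsProbabilityMeasure P]

/-- On `S` the random polynomial with weights `d` has variance of order `B (1 - x) ^ (-p)`, and each
of its first twelve derivatives loses a factor `1 - x`, as for a smooth process on the scale
`1 - x`. Twelve roots in a cell of logarithmic length `h` then have probability of order `h ^ 8`,
which is enough for fourth moments. -/
structure RegularOn (n : ℕ) (d : ℕ → ℝ) (B p C : ℝ) (S : Set ℝ) : Prop where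
  lower : ∀ x ∈ S, B * (1 - x) ^ (-p) ≤ C * derivVar n d 0 x
  upper : ∀ x ∈ S, ∀ k ≤ 12, derivVar n d k x * (1 - x) ^ (2 * k) ≤ C * (B * (1 - x) ^ (-p))

lemma RegularOn.mono {n : ℕ} {d : ℕ → ℝ} {B p C : ℝ} {S T : Set ℝ} (h : RegularOn n d B p C T)
    (hST : S ⊆ T) : RegularOn n d B p C S :=
  ⟨fun x hx => h.lower x (hST hx), fun x hx => h.upper x (hST hx)⟩

/-- The `l`-th point of the partition of a left neighbourhood of `1` which is geometric in the
distance to `1`. -/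
noncomputable def geomPt (u h : ℝ) (l : ℕ) : ℝ := 1 - u * Real.exp (-(h * l))

lemma geomPt_mono {u h : ℝ} (hu : 0 ≤ u) (hh : 0 ≤ h) : Monotone (geomPt u h) := by
  intro l m hlm
  have : (l : ℝ) ≤ m := by exact_mod_cast hlm
  unfold geomPt
  gcongr

lemma geomPt_zero (u h : ℝ) : geomPt u h 0 = 1 - u := by simp [geomPt]

lemma one_sub_geomPt (u h : ℝ) (l : ℕ) : 1 - geomPt u h l = u * Real.exp (-(h * l)) := by
  simp [geomPt]

lemma geomPt_succ (u h : ℝ) (l : ℕ) :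
    geomPt u h (l + 1) = 1 - (1 - geomPt u h l) * Real.exp (-h) := by
  rw [one_sub_geomPt, geomPt, mul_assoc, ← Real.exp_add]
  congr 3
  push_cast
  ring

lemma mem_cell {u h x : ℝ} (hx : x ∈ Set.Icc (1 - u) (1 - u * Real.exp (-h))) :
    u * Real.exp (-h) ≤ 1 - x ∧ 1 - x ≤ u :=
  ⟨by linarith [hx.2], by linarith [hx.1]⟩

lemma rpow_neg_cell_le {u h x p : ℝ} (hu : 0 < u) (h1 : h ≤ 1) (hp : 0 ≤ p)
    (hx : x ∈ Set.Icc (1 - u) (1 - u * Real.exp (-h))) :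
    (1 - x) ^ (-p) ≤ Real.exp p * u ^ (-p) := by
  obtain ⟨h2, -⟩ := mem_cell hx
  have h3 : 0 < u * Real.exp (-h) := by positivity
  calc (1 - x) ^ (-p) ≤ (u * Real.exp (-h)) ^ (-p) :=
        Real.rpow_le_rpow_of_nonpos h3 h2 (by linarith)
    _ = Real.exp (h * p) * u ^ (-p) := by
        rw [Real.mul_rpow hu.le (Real.exp_pos _).le, ← Real.exp_mul]
        ring_nf
    _ ≤ _ := by gcongr; nlinarith

/-- The derivative bound on a cell, in terms of the scale of the cell. -/
lemma derivVar_cell_le {n : ℕ} {d : ℕ → ℝ} {B p C u h x : ℝ} {k : ℕ} (hB : 0 < B) (hC : 0 ≤ C)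
    (hp : 0 ≤ p) (hu : 0 < u) (h1 : h ≤ 1)
    (hx : x ∈ Set.Icc (1 - u) (1 - u * Real.exp (-h)))
    (hd : derivVar n d k x * (1 - x) ^ (2 * k) ≤ C * (B * (1 - x) ^ (-p))) :
    derivVar n d k x ≤ C * Real.exp (p + 2 * k) * (B * u ^ (-p)) / u ^ (2 * k) := by
  obtain ⟨h2, -⟩ := mem_cell hx
  have h3 : 0 < u * Real.exp (-h) := by positivity
  rw [le_div_iff₀ (by positivity)]
  have h4 : u ≤ (1 - x) * Real.exp 1 := by
    calc u = u * Real.exp (-h) * Real.exp h := by rw [mul_assoc, ← Real.exp_add]; simp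
      _ ≤ _ := by
        have : 0 ≤ 1 - x := h3.le.trans h2
        gcongr
  have h5 : u ^ (2 * k) ≤ (1 - x) ^ (2 * k) * Real.exp (2 * k) := by
    calc u ^ (2 * k) ≤ ((1 - x) * Real.exp 1) ^ (2 * k) := by gcongr
      _ = _ := by
        rw [mul_pow, ← Real.exp_nat_mul]
        push_cast
        ring_nf
  have h6 := rpow_neg_cell_le hu h1 hp hx
  have h0 := derivVar_nonneg n d k x
  calc derivVar n d k x * u ^ (2 * k)
      ≤ derivVar n d k x * ((1 - x) ^ (2 * k) * Real.exp (2 * k)) := by gcongr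
    _ = derivVar n d k x * (1 - x) ^ (2 * k) * Real.exp (2 * k) := by ring
    _ ≤ C * (B * (1 - x) ^ (-p)) * Real.exp (2 * k) :=
        mul_le_mul_of_nonneg_right hd (Real.exp_pos _).le
    _ ≤ C * (B * (Real.exp p * u ^ (-p))) * Real.exp (2 * k) := by gcongr
    _ = _ := by rw [Real.exp_add]; ring

lemma cell_length_le {u h : ℝ} (hu : 0 ≤ u) :
    (1 - u * Real.exp (-h)) - (1 - u) ≤ u * h := by
  have := Real.add_one_le_exp (-h)
  nlinarith

section
variable {ζ : ℕ → Ω → ℝ}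

/-- The bound on the probability of `k` roots in a cell of logarithmic length `h`: up to constants
it is `h ^ (2 * k / 3)`, written with a parameter `μ` to avoid the root. -/
lemma IsStdGaussianSeq.measureReal_le_rootCount_cell (hζ : IsStdGaussianSeq ζ P) {n : ℕ}
    {d : ℕ → ℝ} {B p C u h μ : ℝ} {k : ℕ} (hB : 0 < B) (hC : 0 < C) (hp : 0 ≤ p) (hu : 0 < u)
    (h0 : 0 ≤ h) (h1 : h ≤ 1) (hk1 : 1 ≤ k) (hk : k ≤ 12)
    (hd : RegularOn n d B p C (Set.Icc (1 - u) (1 - u * Real.exp (-h)))) (hμ : 0 < μ)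
    (hμ' : C ^ 2 * Real.exp (p + 2 * k) * h ^ (2 * k) ≤ μ ^ 3) :
    P.real {ω | k ≤ rootCount (weightedPoly n d fun i => ζ i ω)
      (Set.Ioc (1 - u) (1 - u * Real.exp (-h)))} ≤ 2 * μ := by
  have hle : 1 - u ≤ 1 - u * Real.exp (-h) := by
    have : Real.exp (-h) ≤ 1 := Real.exp_le_one_iff.2 (by linarith)
    nlinarith
  obtain ⟨k, rfl⟩ : ∃ k', k = k' + 1 := ⟨k - 1, by omega⟩
  have hx := Set.left_mem_Icc.2 hle
  have hlow := hd.lower _ hx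
  have e1 : 1 - (1 - u) = u := by ring
  rw [e1] at hlow
  have hBu : 0 < B * u ^ (-p) := by positivity
  have hV : 0 < derivVar n d 0 (1 - u) := by
    by_contra hcon
    have := derivVar_nonneg n d 0 (1 - u)
    have : derivVar n d 0 (1 - u) = 0 := by linarith
    rw [this] at hlow
    linarith
  refine hζ.measureReal_le_rootCount n d k (x := 1 - u) (μ := μ) hx
    (M := C * Real.exp (p + 2 * (k + 1 : ℕ)) * (B * u ^ (-p)) / u ^ (2 * (k + 1)))
    (fun y hy => derivVar_cell_le hB hC.le hp hu h1 hy (hd.upper y hy _ hk)) hV hμ ?_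
  have hlen := cell_length_le (h := h) hu.le
  have hlen0 : 0 ≤ (1 - u * Real.exp (-h)) - (1 - u) := by linarith
  calc _ ≤ (u * h) ^ (2 * k + 2) *
        (C * Real.exp (p + 2 * (k + 1 : ℕ)) * (B * u ^ (-p)) / u ^ (2 * (k + 1))) := by gcongr
    _ = C * Real.exp (p + 2 * (k + 1 : ℕ)) * h ^ (2 * (k + 1)) * (B * u ^ (-p)) := by
        rw [mul_pow, show 2 * k + 2 = 2 * (k + 1) by ring]
        field_simp
    _ ≤ C * Real.exp (p + 2 * (k + 1 : ℕ)) * h ^ (2 * (k + 1)) *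
        (C * derivVar n d 0 (1 - u)) := by gcongr
    _ = C ^ 2 * Real.exp (p + 2 * (k + 1 : ℕ)) * h ^ (2 * (k + 1)) * derivVar n d 0 (1 - u) := by
        ring
    _ ≤ _ := by gcongr

lemma cell_subset {u g h : ℝ} {m l : ℕ} (hu : 0 ≤ u) (hh : 0 ≤ h) (hg : h * m = g) (hl : l < m) :
    Set.Icc (geomPt u h l) (geomPt u h (l + 1)) ⊆ Set.Icc (1 - u) (1 - u * Real.exp (-g)) := by
  refine Set.Icc_subset_Icc ?_ ?_
  · rw [← geomPt_zero u h]
    exact geomPt_mono hu hh (Nat.zero_le _)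
  · rw [← hg]
    exact geomPt_mono hu hh hl

/-- Subdivision of an interval into `m` cells, on each of which many roots are unlikely. -/
lemma IsStdGaussianSeq.measureReal_exists_cell_le (hζ : IsStdGaussianSeq ζ P) {n : ℕ}
    {d : ℕ → ℝ} {B p C u g h μ : ℝ} {k m : ℕ} (hB : 0 < B) (hC : 0 < C) (hp : 0 ≤ p) (hu : 0 < u)
    (h0 : 0 ≤ h) (h1 : h ≤ 1) (hg : h * m = g) (hk1 : 1 ≤ k) (hk : k ≤ 12)
    (hd : RegularOn n d B p C (Set.Icc (1 - u) (1 - u * Real.exp (-g)))) (hμ : 0 < μ)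
    (hμ' : C ^ 2 * Real.exp (p + 2 * k) * h ^ (2 * k) ≤ μ ^ 3) :
    P.real {ω | ∃ l < m, k ≤ rootCount (weightedPoly n d fun i => ζ i ω)
      (Set.Ioc (geomPt u h l) (geomPt u h (l + 1)))} ≤ m * (2 * μ) := by
  have hset : {ω | ∃ l < m, k ≤ rootCount (weightedPoly n d fun i => ζ i ω)
      (Set.Ioc (geomPt u h l) (geomPt u h (l + 1)))} = ⋃ l ∈ Finset.range m,
        {ω | k ≤ rootCount (weightedPoly n d fun i => ζ i ω)
      (Set.Ioc (geomPt u h l) (geomPt u h (l + 1)))} := by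
    ext ω; simp
  rw [hset]
  refine (measureReal_biUnion_finset_le _ _).trans ?_
  calc _ ≤ ∑ l ∈ Finset.range m, 2 * μ := by
        refine Finset.sum_le_sum fun l hl => ?_
        have hsub := cell_subset hu.le h0 hg (Finset.mem_range.1 hl)
        have e : geomPt u h l = 1 - (1 - geomPt u h l) := by ring
        rw [geomPt_succ] at hsub ⊢
        nth_rewrite 1 [e] at hsub ⊢
        refine hζ.measureReal_le_rootCount_cell hB hC hp ?_ h0 h1 hk1 hk (hd.mono hsub) hμ hμ'
        rw [one_sub_geomPt]; positivity
    _ = m * (2 * μ) := by simp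

lemma sum_one_div_pow_four_le (n : ℕ) :
    ∑ t ∈ Finset.range n, 1 / ((t : ℝ) + 1) ^ 4 ≤ 2 := by
  have h : ∀ n : ℕ, ∑ t ∈ Finset.range n, 1 / ((t : ℝ) + 1) ^ 4 ≤ 2 - 2 / ((n : ℝ) + 1) := by
    intro n
    induction n with
    | zero => simp
    | succ n ih =>
      rw [Finset.sum_range_succ]
      have hx : (0 : ℝ) ≤ n := Nat.cast_nonneg n
      have h1 : 1 / ((n : ℝ) + 1) ^ 4 ≤ 2 / (n + 1) - 2 / (n + 1 + 1) := by
        rw [div_sub_div _ _ (by positivity) (by positivity), div_le_div_iff₀ (by positivity)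
          (by positivity)]
        nlinarith [pow_nonneg hx 2, pow_nonneg hx 3, pow_nonneg hx 4]
      push_cast
      linarith
  refine (h n).trans ?_
  have : (0 : ℝ) ≤ 2 / ((n : ℝ) + 1) := by positivity
  linarith

/-- **Moments.** The fourth moment of the number of roots in an interval of logarithmic length `g`
is at most of order `g ^ 5`. -/
lemma IsStdGaussianSeq.integral_rootCount_pow_four_le (hζ : IsStdGaussianSeq ζ P) {n : ℕ}
    {d : ℕ → ℝ} {B p C D u g : ℝ} (hB : 0 < B) (hC : 0 < C) (hp : 0 ≤ p) (hu : 0 < u)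
    (hD : 0 < D) (hCD : C ^ 2 * Real.exp (p + 24) ≤ D ^ 3) (hg : 1 ≤ g)
    (hd : RegularOn n d B p C (Set.Icc (1 - u) (1 - u * Real.exp (-g)))) :
    ∫ ω, (rootCount (weightedPoly n d fun i => ζ i ω)
      (Set.Ioc (1 - u) (1 - u * Real.exp (-g))) : ℝ) ^ 4 ∂P ≤ 24 ^ 4 * (1 + 120 * D) * g ^ 5 := by
  set I := Set.Ioc (1 - u) (1 - u * Real.exp (-g)) with hI
  set N : Ω → ℕ := fun ω => rootCount (weightedPoly n d fun i => ζ i ω) I with hN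
  have hNm : Measurable N := measurable_rootCount_weightedPoly (isSigmaCompact_Ioc _ _) n d
    fun i _ _ => hζ.measurable i
  have hNn : ∀ ω, N ω ≤ n := fun ω =>
    (rootCount_le_natDegree _ _).trans (natDegree_weightedPoly_le n d _)
  set G := ⌈g⌉₊ with hG
  have hgG : g ≤ G := Nat.le_ceil g
  have hG2 : (G : ℝ) ≤ 2 * g := by
    have := Nat.ceil_lt_add_one (by linarith : 0 ≤ g)
    linarith
  have hG1 : 1 ≤ G := Nat.one_le_cast.1 (hg.trans hgG)
  have hG0 : (0 : ℝ) < G := by exact_mod_cast hG1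
  -- the tail: the interval is divided into `G (t + 1)` cells, one of which has twelve roots
  have tail : ∀ t : ℕ, P.real {ω | 12 * (G * (t + 1)) ≤ N ω} ≤ 2 * D * G / ((t : ℝ) + 1) ^ 7 := by
    intro t
    set m := G * (t + 1) with hm
    have hm0 : (0 : ℝ) < m := by positivity
    set h := g / m with hh
    have hh0 : 0 < h := by positivity
    have ht : h ≤ 1 / ((t : ℝ) + 1) := by
      rw [hh, div_le_div_iff₀ hm0 (by positivity), hm]
      push_cast
      nlinarith [(Nat.cast_nonneg t : (0 : ℝ) ≤ t)]
    have hh1 : h ≤ 1 := ht.trans (by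
      rw [div_le_one (by positivity)]
      linarith [(Nat.cast_nonneg t : (0 : ℝ) ≤ t)])
    have hhm : h * m = g := by rw [hh]; field_simp
    have hmain := hζ.measureReal_exists_cell_le (k := 12) (μ := D * h ^ 8) hB hC hp hu hh0.le hh1
      hhm (by norm_num) le_rfl hd (by positivity) (by
        calc C ^ 2 * Real.exp (p + 2 * (12 : ℕ)) * h ^ (2 * 12) ≤ D ^ 3 * h ^ 24 := by
              have : p + 2 * ((12 : ℕ) : ℝ) = p + 24 := by norm_num
              rw [this]
              gcongr
          _ = _ := by ring)
    have hsub : {ω | 12 * m ≤ N ω} ⊆ {ω | ∃ l < m, 12 ≤ rootCount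
        (weightedPoly n d fun i => ζ i ω) (Set.Ioc (geomPt u h l) (geomPt u h (l + 1)))} := by
      intro ω hω
      by_contra hcon
      simp only [Set.mem_ofPred_eq, not_exists, not_and, not_le] at hcon hω
      have h1 := rootCount_Ioc_succ (weightedPoly n d fun i => ζ i ω)
        (geomPt_mono hu.le hh0.le) m
      rw [geomPt_zero] at h1
      have h2 : geomPt u h m = 1 - u * Real.exp (-g) := by rw [geomPt, hhm]
      rw [h2] at h1
      have h3 : ∑ l ∈ Finset.range m, rootCount (weightedPoly n d fun i => ζ i ω)
          (Set.Ioc (geomPt u h l) (geomPt u h (l + 1))) ≤ ∑ l ∈ Finset.range m, 11 :=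
        Finset.sum_le_sum fun l hl => by
          have := hcon l (Finset.mem_range.1 hl)
          omega
      have h4 : N ω ≤ m * 11 := by
        simp only [hN, hI]
        rw [h1]
        simpa using h3
      have h5 : 1 ≤ m := by exact_mod_cast hm0
      omega
    refine (measureReal_mono hsub).trans (hmain.trans ?_)
    calc (m : ℝ) * (2 * (D * h ^ 8)) ≤ m * (2 * (D * (1 / ((t : ℝ) + 1)) ^ 8)) := by gcongr
      _ = 2 * D * G / ((t : ℝ) + 1) ^ 7 := by
        rw [hm]
        push_cast
        field_simp
  -- summation by parts
  have hpt : ∀ ω, (N ω : ℝ) ^ 4 ≤ (12 * G) ^ 4 * (1 + ∑ t ∈ Finset.range n,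
      15 * ((t : ℝ) + 1) ^ 3 *
        Set.indicator {ω | 12 * (G * (t + 1)) ≤ N ω} (fun _ => (1 : ℝ)) ω) := by
    intro ω
    set T := N ω / (12 * G) with hT
    have h1 : N ω < 12 * G * (T + 1) := by
      have := Nat.lt_mul_div_succ (N ω) (by omega : 0 < 12 * G)
      simpa using this
    have hTn : T ≤ n := (Nat.div_le_self _ _).trans (hNn ω)
    have h2 : ((T : ℝ) + 1) ^ 4 ≤ 1 + ∑ t ∈ Finset.range T, 15 * ((t : ℝ) + 1) ^ 3 := by
      have : ∀ T : ℕ, ((T : ℝ) + 1) ^ 4 ≤ 1 + ∑ t ∈ Finset.range T, 15 * ((t : ℝ) + 1) ^ 3 := by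
        intro T
        induction T with
        | zero => simp
        | succ T ih =>
          rw [Finset.sum_range_succ]
          push_cast
          have hx : (0 : ℝ) ≤ T := Nat.cast_nonneg T
          nlinarith [pow_nonneg hx 2, pow_nonneg hx 3]
      exact this T
    have h3 : ∑ t ∈ Finset.range T, 15 * ((t : ℝ) + 1) ^ 3 ≤ ∑ t ∈ Finset.range n,
      15 * ((t : ℝ) + 1) ^ 3 *
        Set.indicator {ω | 12 * (G * (t + 1)) ≤ N ω} (fun _ => (1 : ℝ)) ω := by
      calc _ = ∑ t ∈ Finset.range T, 15 * ((t : ℝ) + 1) ^ 3 *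
            Set.indicator {ω | 12 * (G * (t + 1)) ≤ N ω} (fun _ => (1 : ℝ)) ω := by
            refine Finset.sum_congr rfl fun t ht => ?_
            rw [Set.indicator_of_mem, mul_one]
            have h5 : t + 1 ≤ T := Finset.mem_range.1 ht
            have h6 : 12 * G * T ≤ N ω := Nat.mul_div_le _ _
            have h7 : 12 * G * (t + 1) ≤ 12 * G * T := Nat.mul_le_mul_left _ h5
            simp only [Set.mem_ofPred_eq]
            rw [← mul_assoc]
            omega
        _ ≤ _ := by
            refine Finset.sum_le_sum_of_subset_of_nonneg
              (Finset.range_subset_range.2 hTn) fun t _ _ => ?_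
            exact mul_nonneg (by positivity) (Set.indicator_nonneg (fun _ _ => zero_le_one) _)
    calc (N ω : ℝ) ^ 4 ≤ (12 * G * (T + 1)) ^ 4 := by
          gcongr
          exact_mod_cast h1.le
      _ = (12 * G) ^ 4 * ((T : ℝ) + 1) ^ 4 := by ring
      _ ≤ _ := by gcongr; linarith
  have hms : ∀ t : ℕ, MeasurableSet {ω | 12 * (G * (t + 1)) ≤ N ω} := fun t =>
    measurableSet_le measurable_const hNm
  have hint : ∀ t ∈ Finset.range n, Integrable (fun ω => 15 * ((t : ℝ) + 1) ^ 3 *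
      Set.indicator {ω | 12 * (G * (t + 1)) ≤ N ω} (fun _ => (1 : ℝ)) ω) P := fun t _ =>
    ((integrable_const (1 : ℝ)).indicator (hms t)).const_mul _
  have hsum : Integrable (fun ω => ∑ t ∈ Finset.range n, 15 * ((t : ℝ) + 1) ^ 3 *
      Set.indicator {ω | 12 * (G * (t + 1)) ≤ N ω} (fun _ => (1 : ℝ)) ω) P :=
    integrable_finsetSum _ hint
  have hNint : Integrable (fun ω => (N ω : ℝ) ^ 4) P := by
    refine Integrable.of_bound (C := (n : ℝ) ^ 4) ?_ ?_
    · exact (((measurable_from_top (f := fun k : ℕ => (k : ℝ))).comp hNm).pow_const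
        4).aestronglyMeasurable
    · filter_upwards with ω
      rw [Real.norm_of_nonneg (by positivity)]
      gcongr
      exact hNn ω
  refine (integral_mono hNint (((integrable_const 1).add hsum).const_mul _) hpt).trans ?_
  simp only [Pi.add_apply]
  rw [integral_const_mul, integral_add (integrable_const _) hsum, integral_finsetSum _ hint]
  have hterm : ∀ t ∈ Finset.range n, ∫ ω, 15 * ((t : ℝ) + 1) ^ 3 *
      Set.indicator {ω | 12 * (G * (t + 1)) ≤ N ω} (fun _ => (1 : ℝ)) ω ∂P ≤
      30 * D * G * (1 / ((t : ℝ) + 1) ^ 4) := by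
    intro t _
    rw [integral_const_mul, integral_indicator_const _ (hms t), smul_eq_mul, mul_one]
    calc _ ≤ 15 * ((t : ℝ) + 1) ^ 3 * (2 * D * G / ((t : ℝ) + 1) ^ 7) := by
          gcongr
          exact tail t
      _ = _ := by field_simp; ring
  have h1 := Finset.sum_le_sum hterm
  rw [← Finset.mul_sum] at h1
  have h2 := sum_one_div_pow_four_le n
  simp only [integral_const, probReal_univ, one_smul]
  calc (12 * (G : ℝ)) ^ 4 * (1 + ∑ t ∈ Finset.range n, ∫ ω, 15 * ((t : ℝ) + 1) ^ 3 *
      Set.indicator {ω | 12 * (G * (t + 1)) ≤ N ω} (fun _ => (1 : ℝ)) ω ∂P)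
      ≤ (12 * (2 * g)) ^ 4 * (1 + 30 * D * (2 * g) * 2) := by
        have h3 : 30 * D * G * ∑ t ∈ Finset.range n, 1 / ((t : ℝ) + 1) ^ 4 ≤
            30 * D * (2 * g) * 2 := by gcongr
        refine mul_le_mul (by gcongr) (by linarith) ?_ (by positivity)
        refine add_nonneg zero_le_one (Finset.sum_nonneg fun t _ => integral_nonneg fun ω => ?_)
        exact mul_nonneg (by positivity) (Set.indicator_nonneg (fun _ _ => zero_le_one) _)
    _ ≤ (12 * (2 * g)) ^ 4 * (g + 30 * D * (2 * g) * 2) := by gcongr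
    _ = _ := by ring

/-- **Comparison.** Two regular polynomials whose difference has small variance have the same number
of roots in an interval, with high probability. -/
lemma IsStdGaussianSeq.measureReal_rootCount_ne_le (hζ : IsStdGaussianSeq ζ P) {n : ℕ}
    {d d' : ℕ → ℝ} {B p C D u g s : ℝ} (hB : 0 < B) (hC : 1 ≤ C) (hp : 0 ≤ p) (hu : 0 < u)
    (hD : 0 < D) (hCD : C ^ 2 * Real.exp (p + 24) ≤ D ^ 3) (hg : 1 ≤ g) (hs : 0 < s) (hs1 : s ≤ 1)
    (hd : RegularOn n d B p C (Set.Icc (1 - u) (1 - u * Real.exp (-g))))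
    (hd' : RegularOn n d' B p C (Set.Icc (1 - u) (1 - u * Real.exp (-g))))
    (herr : ∀ x ∈ Set.Icc (1 - u) (1 - u * Real.exp (-g)),
      derivVar n (fun i => d i - d' i) 0 x ≤ s ^ 18 * (B * (1 - x) ^ (-p))) :
    P.real {ω | rootCount (weightedPoly n d fun i => ζ i ω)
        (Set.Ioc (1 - u) (1 - u * Real.exp (-g))) ≠
      rootCount (weightedPoly n d' fun i => ζ i ω)
        (Set.Ioc (1 - u) (1 - u * Real.exp (-g)))} ≤ 16 * D * g * s := by
  -- in about `g / s ^ 3` cells of logarithmic length `s ^ 3`, two roots in the same cell have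
  -- probability of order `s ^ 4`, and different signs at an endpoint probability of order `s ^ 6`
  set m := ⌈g / s ^ 3⌉₊ with hm
  have hgs : 1 ≤ g / s ^ 3 := by
    rw [one_le_div (by positivity)]
    exact (pow_le_one₀ hs.le hs1).trans hg
  have hm1 : g / s ^ 3 ≤ m := Nat.le_ceil _
  have hm2 : (m : ℝ) ≤ 2 * (g / s ^ 3) := by
    have := Nat.ceil_lt_add_one (by linarith : 0 ≤ g / s ^ 3)
    linarith
  have hm0 : (0 : ℝ) < m := by linarith
  have hm1' : 1 ≤ m := by exact_mod_cast hm0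
  set h := g / m with hh
  have hh0 : 0 < h := by positivity
  have hhs : h ≤ s ^ 3 := by
    rw [hh, div_le_iff₀ hm0]
    rw [div_le_iff₀ (by positivity)] at hm1
    linarith
  have hh1 : h ≤ 1 := hhs.trans (pow_le_one₀ hs.le hs1)
  have hhm : h * m = g := by rw [hh]; field_simp
  have hcell : ∀ e : ℕ → ℝ, RegularOn n e B p C (Set.Icc (1 - u) (1 - u * Real.exp (-g))) →
      P.real {ω | ∃ l < m, 2 ≤ rootCount (weightedPoly n e fun i => ζ i ω)
        (Set.Ioc (geomPt u h l) (geomPt u h (l + 1)))} ≤ 4 * D * g * s := by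
    intro e he
    have := hζ.measureReal_exists_cell_le (k := 2) (μ := D * s ^ 4) hB (by linarith) hp hu hh0.le
      hh1 hhm (by norm_num) (by norm_num) he (by positivity) (by
        calc C ^ 2 * Real.exp (p + 2 * (2 : ℕ)) * h ^ (2 * 2)
            ≤ C ^ 2 * Real.exp (p + 24) * (s ^ 3) ^ (2 * 2) := by
              gcongr
              norm_num
          _ ≤ D ^ 3 * (s ^ 3) ^ (2 * 2) := by gcongr
          _ = _ := by ring)
    refine this.trans ?_
    calc (m : ℝ) * (2 * (D * s ^ 4)) ≤ 2 * (g / s ^ 3) * (2 * (D * s ^ 4)) := by gcongr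
      _ = 4 * D * g * s := by field_simp; ring
  have hpt : ∀ l ≤ m, P.real {ω | ¬ 0 < (weightedPoly n d fun i => ζ i ω).eval (geomPt u h l) *
      (weightedPoly n d' fun i => ζ i ω).eval (geomPt u h l)} ≤ 2 * (D * s ^ 6) := by
    intro l hl
    have hx : geomPt u h l ∈ Set.Icc (1 - u) (1 - u * Real.exp (-g)) := by
      rw [← geomPt_zero u h, ← hhm]
      exact ⟨geomPt_mono hu.le hh0.le (Nat.zero_le _), geomPt_mono hu.le hh0.le hl⟩
    set x := geomPt u h l with hxdef
    have hx0 : 0 < 1 - x := by rw [hxdef, one_sub_geomPt]; positivity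
    have hlow := hd.lower x hx
    have hBx : 0 < B * (1 - x) ^ (-p) := by positivity
    have hV : 0 < derivVar n d 0 x := by
      by_contra hcon
      have := derivVar_nonneg n d 0 x
      have : derivVar n d 0 x = 0 := by linarith
      rw [this] at hlow
      linarith
    refine hζ.measureReal_sign_ne n d d' hV (by positivity) ((herr x hx).trans ?_)
    have hCD' : C ≤ D ^ 3 := by
      refine le_trans ?_ hCD
      have : 1 ≤ Real.exp (p + 24) := Real.one_le_exp (by linarith)
      nlinarith
    calc s ^ 18 * (B * (1 - x) ^ (-p)) ≤ s ^ 18 * (C * derivVar n d 0 x) := by gcongr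
      _ ≤ s ^ 18 * (D ^ 3 * derivVar n d 0 x) := by gcongr
      _ = _ := by ring
  set E1 := {ω | ∃ l < m, 2 ≤ rootCount (weightedPoly n d fun i => ζ i ω)
        (Set.Ioc (geomPt u h l) (geomPt u h (l + 1)))} with hE1
  set E2 := {ω | ∃ l < m, 2 ≤ rootCount (weightedPoly n d' fun i => ζ i ω)
        (Set.Ioc (geomPt u h l) (geomPt u h (l + 1)))} with hE2
  set E3 := ⋃ l ∈ Finset.range (m + 1), {ω | ¬ 0 <
      (weightedPoly n d fun i => ζ i ω).eval (geomPt u h l) *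
      (weightedPoly n d' fun i => ζ i ω).eval (geomPt u h l)} with hE3
  have hP3 : P.real E3 ≤ 8 * D * g * s := by
    refine (measureReal_biUnion_finset_le _ _).trans ?_
    refine (Finset.sum_le_sum fun l hl =>
      hpt l (Nat.lt_succ_iff.1 (Finset.mem_range.1 hl))).trans ?_
    rw [Finset.sum_const, Finset.card_range, nsmul_eq_mul]
    have h1 : ((m + 1 : ℕ) : ℝ) ≤ 2 * (2 * (g / s ^ 3)) := by
      push_cast
      have : (1 : ℝ) ≤ m := by exact_mod_cast hm1'
      linarith
    calc ((m + 1 : ℕ) : ℝ) * (2 * (D * s ^ 6)) ≤ 2 * (2 * (g / s ^ 3)) * (2 * (D * s ^ 6)) := by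
          gcongr
      _ = 8 * D * g * s ^ 3 := by field_simp; ring
      _ ≤ 8 * D * g * s := by
          gcongr
          exact pow_le_of_le_one hs.le hs1 (by norm_num)
  have hsub : {ω | rootCount (weightedPoly n d fun i => ζ i ω)
        (Set.Ioc (1 - u) (1 - u * Real.exp (-g))) ≠
      rootCount (weightedPoly n d' fun i => ζ i ω)
        (Set.Ioc (1 - u) (1 - u * Real.exp (-g)))} ⊆ E1 ∪ E2 ∪ E3 := by
    intro ω hω
    by_contra hcon
    simp only [Set.mem_union, not_or] at hcon
    obtain ⟨⟨h1, h2⟩, h3⟩ := hcon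
    simp only [hE1, hE2, hE3, Set.mem_ofPred_eq, not_exists, not_and, not_le, Set.mem_iUnion,
      not_not, Finset.mem_range] at h1 h2 h3
    refine hω ?_
    have e1 := fun q : Polynomial ℝ => rootCount_Ioc_succ q (geomPt_mono hu.le hh0.le) m
    have e2 : geomPt u h m = 1 - u * Real.exp (-g) := by rw [geomPt, hhm]
    simp only [geomPt_zero, e2] at e1
    rw [e1, e1]
    refine Finset.sum_congr rfl fun l hl => ?_
    have hl' := Finset.mem_range.1 hl
    exact rootCount_eq_of_sign (geomPt_mono hu.le hh0.le (Nat.le_succ l))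
      (Nat.lt_succ_iff.1 (h1 l hl')) (Nat.lt_succ_iff.1 (h2 l hl')) (h3 l (by omega))
      (h3 (l + 1) (by omega))
  refine (measureReal_mono hsub).trans ((measureReal_union_le _ _).trans ?_)
  have h12 := measureReal_union_le (μ := P) E1 E2
  have h1 := hcell d hd
  have h2 := hcell d' hd'
  linarith

/-- **Domination.** A regular polynomial to which a much larger monomial is added has no root in an
interval, with high probability. -/
lemma IsStdGaussianSeq.measureReal_rootCount_ne_zero_le (hζ : IsStdGaussianSeq ζ P) {n : ℕ}
    {d : ℕ → ℝ} {j : ℕ} (hj : j ≤ n) {B p C D u g s M : ℝ} (hB : 0 < B) (hC : 1 ≤ C) (hp : 0 ≤ p)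
    (hu : 0 < u) (hD : 0 < D) (hCD : C ^ 2 * Real.exp (p + 24) ≤ D ^ 3) (hg : 1 ≤ g) (hs : 0 < s)
    (hs1 : s ≤ 1)
    (hd : RegularOn n (Function.update d j 0) B p C (Set.Icc (1 - u) (1 - u * Real.exp (-g))))
    (hM : 0 < M)
    (hdom : ∀ x ∈ Set.Icc (1 - u) (1 - u * Real.exp (-g)),
      M ≤ (d j * x ^ j) ^ 2 ∧ B * (1 - x) ^ (-p) ≤ s ^ 18 * M) :
    P.real {ω | rootCount (weightedPoly n d fun i => ζ i ω)
        (Set.Ioc (1 - u) (1 - u * Real.exp (-g))) ≠ 0} ≤ 8 * D * g * s := by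
  set m := ⌈g⌉₊ with hm
  have hm1 : g ≤ m := Nat.le_ceil _
  have hm2 : (m : ℝ) ≤ 2 * g := by
    have := Nat.ceil_lt_add_one (by linarith : 0 ≤ g)
    linarith
  have hm0 : (0 : ℝ) < m := by linarith
  set h := g / m with hh
  have hh0 : 0 < h := by positivity
  have hh1 : h ≤ 1 := by rw [hh, div_le_one hm0]; exact hm1
  have hhm : h * m = g := by rw [hh]; field_simp
  have hcell : ∀ l < m, P.real {ω | 1 ≤ rootCount (weightedPoly n d fun i => ζ i ω)
      (Set.Ioc (geomPt u h l) (geomPt u h (l + 1)))} ≤ 2 * (2 * D * s ^ 6) := by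
    intro l hl
    have hsub := cell_subset hu.le hh0.le hhm hl
    have hle : geomPt u h l ≤ geomPt u h (l + 1) := geomPt_mono hu.le hh0.le (Nat.le_succ l)
    have hv : 0 < 1 - geomPt u h l := by rw [one_sub_geomPt]; positivity
    have hx := Set.left_mem_Icc.2 hle
    have e : geomPt u h l = 1 - (1 - geomPt u h l) := by ring
    have hlen : geomPt u h (l + 1) - geomPt u h l ≤ (1 - geomPt u h l) * h := by
      have := cell_length_le (h := h) hv.le
      rw [geomPt_succ]
      linarith
    have hcellx : ∀ y ∈ Set.Icc (geomPt u h l) (geomPt u h (l + 1)),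
        y ∈ Set.Icc (1 - (1 - geomPt u h l)) (1 - (1 - geomPt u h l) * Real.exp (-h)) := by
      intro y hy
      rw [geomPt_succ] at hy
      rwa [← e]
    set v := 1 - geomPt u h l with hvdef
    set S := B * v ^ (-p) with hS
    have hS0 : 0 < S := by positivity
    have hder : ∀ k ≤ 12, ∀ y ∈ Set.Icc (geomPt u h l) (geomPt u h (l + 1)),
        derivVar n (Function.update d j 0) k y ≤ C * Real.exp (p + 2 * k) * S / v ^ (2 * k) :=
      fun k hk y hy => derivVar_cell_le hB (by linarith) hp hv hh1 (hcellx y hy)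
        (hd.upper y (hsub hy) k hk)
    refine hζ.measureReal_one_le_rootCount n d hj (μ := 2 * D * s ^ 6) hx (hder 1 (by norm_num))
      (hder 0 (by norm_num) _ hx) hM (fun y hy => (hdom y (hsub hy)).1) (by positivity) ?_
    have hSM : S ≤ s ^ 18 * M := (hdom _ (hsub hx)).2
    have hlen0 : 0 ≤ geomPt u h (l + 1) - geomPt u h l := by linarith
    have hCD' : C * Real.exp (p + 2) ≤ D ^ 3 := by
      refine le_trans ?_ hCD
      have : C ≤ C ^ 2 := by nlinarith
      gcongr
      norm_num
    have h1 : 2 * (C * Real.exp (p + 2 * (0 : ℕ)) * S / v ^ (2 * 0)) ≤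
        2 * (C * Real.exp (p + 2) * S) := by
      simp only [mul_zero, pow_zero, div_one]
      gcongr
      norm_num
    have h2 : 2 * (geomPt u h (l + 1) - geomPt u h l) ^ 2 *
        (C * Real.exp (p + 2 * (1 : ℕ)) * S / v ^ (2 * 1)) ≤
        2 * (C * Real.exp (p + 2) * S) := by
      calc _ ≤ 2 * (v * 1) ^ 2 * (C * Real.exp (p + 2 * (1 : ℕ)) * S / v ^ (2 * 1)) := by
            gcongr
            exact hlen.trans (by gcongr)
        _ = _ := by push_cast; field_simp
    calc _ ≤ 4 * (C * Real.exp (p + 2) * S) := by linarith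
      _ ≤ 4 * (D ^ 3 * (s ^ 18 * M)) := by gcongr
      _ ≤ 8 * (D ^ 3 * (s ^ 18 * M)) := by
          have : 0 < D ^ 3 * (s ^ 18 * M) := by positivity
          linarith
      _ = _ := by ring
  have hsub : {ω | rootCount (weightedPoly n d fun i => ζ i ω)
      (Set.Ioc (1 - u) (1 - u * Real.exp (-g))) ≠ 0} ⊆ ⋃ l ∈ Finset.range m,
      {ω | 1 ≤ rootCount (weightedPoly n d fun i => ζ i ω)
        (Set.Ioc (geomPt u h l) (geomPt u h (l + 1)))} := by
    intro ω hω
    by_contra hcon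
    simp only [Set.mem_iUnion, Set.mem_ofPred_eq, not_exists, Finset.mem_range, not_le] at hcon
    refine hω ?_
    have e1 := rootCount_Ioc_succ (weightedPoly n d fun i => ζ i ω) (geomPt_mono hu.le hh0.le) m
    have e2 : geomPt u h m = 1 - u * Real.exp (-g) := by rw [geomPt, hhm]
    rw [geomPt_zero, e2] at e1
    rw [e1]
    exact Finset.sum_eq_zero fun l hl => Nat.lt_one_iff.1 (hcon l (Finset.mem_range.1 hl))
  refine (measureReal_mono hsub (measure_ne_top _ _)).trans
    ((measureReal_biUnion_finset_le _ _).trans ?_)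
  refine (Finset.sum_le_sum fun l hl => hcell l (Finset.mem_range.1 hl)).trans ?_
  rw [Finset.sum_const, Finset.card_range, nsmul_eq_mul]
  calc (m : ℝ) * (2 * (2 * D * s ^ 6)) ≤ 2 * g * (2 * (2 * D * s)) := by
        gcongr
        exact pow_le_of_le_one hs.le hs1 (by norm_num)
    _ = 8 * D * g * s := by ring

end

end

/-! ### Power weights -/

lemma rpow_mul_exp_neg_le (s : ℝ) : ∃ K : ℝ, 1 ≤ K ∧ ∀ x : ℝ, 1 ≤ x →
    x ^ s * Real.exp (-(x / 2)) ≤ K := by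
  set N := ⌈|s|⌉₊ with hN
  refine ⟨(N.factorial : ℝ) * 2 ^ N, ?_, fun x hx => ?_⟩
  · have h1 : (1 : ℝ) ≤ N.factorial := by exact_mod_cast Nat.factorial_pos N
    have h2 : (1 : ℝ) ≤ 2 ^ N := one_le_pow₀ (by norm_num)
    nlinarith
  · have h1 : x ^ s ≤ x ^ N := by
      rw [← Real.rpow_natCast]
      exact Real.rpow_le_rpow_of_exponent_le hx ((le_abs_self s).trans (Nat.le_ceil _))
    have h2 := Real.pow_div_factorial_le_exp (x / 2) (by linarith) N
    rw [div_le_iff₀ (by positivity), div_pow, div_le_iff₀ (by positivity)] at h2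
    rw [Real.exp_neg, ← div_eq_mul_inv, div_le_iff₀ (Real.exp_pos _)]
    calc x ^ s ≤ x ^ N := h1
      _ ≤ _ := h2
      _ = _ := by ring

lemma mul_rpow_sub_one_le {p : ℝ} (hp : 0 < p) (hp1 : p ≤ 1) (i : ℕ) :
    p * ((i : ℝ) + 1) ^ (p - 1) ≤ ((i : ℝ) + 1) ^ p - (i : ℝ) ^ p := by
  have hi : (0 : ℝ) < (i : ℝ) + 1 := by positivity
  have h1 := rpow_one_add_le_one_add_mul_self (s := -1 / ((i : ℝ) + 1)) (p := p)
    (by rw [le_div_iff₀ hi]; linarith [(Nat.cast_nonneg i : (0 : ℝ) ≤ i)]) hp.le hp1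
  have h2 : (1 + -1 / ((i : ℝ) + 1)) = i / ((i : ℝ) + 1) := by field_simp; ring
  rw [h2, Real.div_rpow (Nat.cast_nonneg i) hi.le, div_le_iff₀ (Real.rpow_pos_of_pos hi p)] at h1
  have h3 : ((i : ℝ) + 1) ^ (p - 1) = ((i : ℝ) + 1) ^ p / ((i : ℝ) + 1) := by
    rw [Real.rpow_sub hi, Real.rpow_one]
  rw [h3]
  have h4 : (1 + p * (-1 / ((i : ℝ) + 1))) * ((i : ℝ) + 1) ^ p =
      ((i : ℝ) + 1) ^ p - p * (((i : ℝ) + 1) ^ p / ((i : ℝ) + 1)) := by ring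
  linarith

/-- Comparison of `∑ i ^ (p - 1)` with the integral of `x ^ (p - 1)`. -/
lemma sum_rpow_sub_one_le {p : ℝ} (hp : 0 < p) {s : Finset ℕ} {M : ℝ}
    (hs : ∀ i ∈ s, 1 ≤ i ∧ (i : ℝ) ≤ M) (hM : 0 ≤ M) :
    ∑ i ∈ s, (i : ℝ) ^ (p - 1) ≤ (1 + 1 / p) * M ^ p := by
  set m := ⌊M⌋₊ with hm
  have hmM : (m : ℝ) ≤ M := Nat.floor_le hM
  have hsub : s ⊆ Finset.Ico 1 (m + 1) := by
    intro i hi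
    rw [Finset.mem_Ico]
    exact ⟨(hs i hi).1, Nat.lt_succ_of_le (Nat.le_floor (hs i hi).2)⟩
  have h1 : ∑ i ∈ s, (i : ℝ) ^ (p - 1) ≤ ∑ i ∈ Finset.Ico 1 (m + 1), (i : ℝ) ^ (p - 1) :=
    Finset.sum_le_sum_of_subset_of_nonneg hsub fun i _ _ => by positivity
  have h2 : ∑ i ∈ Finset.Ico 1 (m + 1), (i : ℝ) ^ (p - 1) =
      ∑ i ∈ Finset.range m, ((i : ℝ) + 1) ^ (p - 1) := by
    rw [Finset.sum_Ico_eq_sum_range]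
    refine Finset.sum_congr (by simp) fun i _ => ?_
    push_cast
    rw [add_comm]
  have hMp : (m : ℝ) ^ p ≤ M ^ p := by gcongr
  have hMp0 : 0 ≤ M ^ p := by positivity
  rw [h2] at h1
  refine h1.trans ?_
  rcases le_total p 1 with hp1 | hp1
  · have h3 : ∑ i ∈ Finset.range m, ((i : ℝ) + 1) ^ (p - 1) ≤ (1 / p) * (m : ℝ) ^ p := by
      have h4 : ∑ i ∈ Finset.range m, (p * ((i : ℝ) + 1) ^ (p - 1)) ≤ (m : ℝ) ^ p := by
        calc _ ≤ ∑ i ∈ Finset.range m, (((i + 1 : ℕ) : ℝ) ^ p - (i : ℝ) ^ p) := by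
              refine Finset.sum_le_sum fun i _ => ?_
              push_cast
              exact mul_rpow_sub_one_le hp hp1 i
          _ = (m : ℝ) ^ p := by
              rw [Finset.sum_range_sub (fun i : ℕ => (i : ℝ) ^ p)]
              simp [Real.zero_rpow hp.ne']
      rw [← Finset.mul_sum] at h4
      rw [one_div, ← div_eq_inv_mul, le_div_iff₀ hp]
      linarith
    calc _ ≤ (1 / p) * (m : ℝ) ^ p := h3
      _ ≤ (1 / p) * M ^ p := by gcongr
      _ ≤ _ := by gcongr; linarith
  · have h3 : ∑ i ∈ Finset.range m, ((i : ℝ) + 1) ^ (p - 1) ≤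
        ∑ i ∈ Finset.range m, (m : ℝ) ^ (p - 1) := by
      refine Finset.sum_le_sum fun i hi => ?_
      have : (i : ℝ) + 1 ≤ m := by exact_mod_cast Finset.mem_range.1 hi
      exact Real.rpow_le_rpow (by positivity) this (by linarith)
    rw [Finset.sum_const, Finset.card_range, nsmul_eq_mul] at h3
    have h4 : (m : ℝ) * (m : ℝ) ^ (p - 1) = (m : ℝ) ^ p := by
      rcases Nat.eq_zero_or_pos m with h | h
      · rw [h]; simp [Real.zero_rpow hp.ne']
      · have : (0 : ℝ) < m := by exact_mod_cast h
        rw [Real.rpow_sub this, Real.rpow_one]; field_simp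
    rw [h4] at h3
    have : 0 < 1 / p := by positivity
    nlinarith

lemma sum_exp_neg_le {w : ℝ} (hw : 0 < w) (hw1 : w ≤ 1) (s : Finset ℕ) :
    ∑ i ∈ s, Real.exp (-(w * i / 2)) ≤ 4 / w := by
  set r := Real.exp (-(w / 2)) with hr
  have hr1 : r < 1 := Real.exp_lt_one_iff.2 (by linarith)
  have hr0 : 0 ≤ r := (Real.exp_pos _).le
  have h1 : ∀ i : ℕ, Real.exp (-(w * i / 2)) = r ^ i := fun i => by
    rw [hr, ← Real.exp_nat_mul]; ring_nf
  simp_rw [h1]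
  have h2 : ∑ i ∈ s, r ^ i ≤ (1 - r)⁻¹ := by
    rw [← tsum_geometric_of_lt_one hr0 hr1]
    exact (summable_geometric_of_lt_one hr0 hr1).sum_le_tsum _ fun i _ => by positivity
  refine h2.trans ?_
  have h3 : r ≤ 1 - w / 4 := by
    have h4 := Real.add_one_le_exp (w / 2)
    have h5 : r * Real.exp (w / 2) = 1 := by rw [hr, ← Real.exp_add]; simp
    nlinarith
  rw [inv_le_comm₀ (by linarith) (by positivity), inv_div]
  linarith

/-- `∑ i ^ (q - 1) e ^ (-w i)` is at most of order `w ^ (-q)`, the value of the integral. -/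
lemma exists_sum_rpow_mul_exp_le {q : ℝ} (hq : 0 < q) : ∃ K : ℝ, 1 ≤ K ∧
    ∀ w : ℝ, 0 < w → w ≤ 1 → ∀ s : Finset ℕ, (∀ i ∈ s, 1 ≤ i) →
    ∑ i ∈ s, (i : ℝ) ^ (q - 1) * Real.exp (-(w * i)) ≤ K * w ^ (-q) := by
  obtain ⟨K₁, hK₁, hb⟩ := rpow_mul_exp_neg_le (q - 1)
  refine ⟨(1 + 1 / q) + 4 * K₁, ?_, fun w hw hw1 s hs => ?_⟩
  · have : 0 < 1 / q := by positivity
    linarith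
  · rw [← Finset.sum_filter_add_sum_filter_not s (fun i : ℕ => (i : ℝ) ≤ 1 / w)]
    have h1 : ∑ i ∈ s.filter (fun i : ℕ => (i : ℝ) ≤ 1 / w),
        (i : ℝ) ^ (q - 1) * Real.exp (-(w * i)) ≤
        (1 + 1 / q) * w ^ (-q) := by
      calc _ ≤ ∑ i ∈ s.filter (fun i : ℕ => (i : ℝ) ≤ 1 / w), (i : ℝ) ^ (q - 1) := by
            refine Finset.sum_le_sum fun i _ => ?_
            refine mul_le_of_le_one_right (by positivity) (Real.exp_le_one_iff.2 ?_)
            have : 0 ≤ w * i := by positivity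
            linarith
        _ ≤ (1 + 1 / q) * (1 / w) ^ q := by
            refine sum_rpow_sub_one_le hq (fun i hi => ?_) (by positivity)
            rw [Finset.mem_filter] at hi
            exact ⟨hs i hi.1, hi.2⟩
        _ = _ := by rw [one_div w, Real.inv_rpow hw.le, ← Real.rpow_neg hw.le]
    have h2 : ∑ i ∈ s.filter (fun i : ℕ => ¬ (i : ℝ) ≤ 1 / w),
        (i : ℝ) ^ (q - 1) * Real.exp (-(w * i)) ≤
        4 * K₁ * w ^ (-q) := by
      calc _ ≤ ∑ i ∈ s.filter (fun i : ℕ => ¬ (i : ℝ) ≤ 1 / w),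
            K₁ * w ^ (1 - q) * Real.exp (-(w * i / 2)) := by
            refine Finset.sum_le_sum fun i hi => ?_
            rw [Finset.mem_filter, not_le, div_lt_iff₀ hw] at hi
            have hx : 1 ≤ w * i := by linarith [hi.2]
            have h3 := hb (w * i) hx
            rw [Real.mul_rpow hw.le (Nat.cast_nonneg i)] at h3
            have e : w ^ (1 - q) * w ^ (q - 1) = 1 := by
              rw [← Real.rpow_add hw]; simp
            have e2 : Real.exp (-(w * i)) = Real.exp (-(w * i / 2)) * Real.exp (-(w * i / 2)) := by
              rw [← Real.exp_add]; ring_nf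
            calc (i : ℝ) ^ (q - 1) * Real.exp (-(w * i))
                = w ^ (1 - q) * (w ^ (q - 1) * (i : ℝ) ^ (q - 1) * Real.exp (-(w * i / 2))) *
                    Real.exp (-(w * i / 2)) := by
                  rw [e2, ← mul_assoc, ← mul_assoc, ← mul_assoc, e]; ring
              _ ≤ w ^ (1 - q) * K₁ * Real.exp (-(w * i / 2)) := by gcongr
              _ = _ := by ring
        _ ≤ K₁ * w ^ (1 - q) * (4 / w) := by
            rw [← Finset.mul_sum]
            gcongr
            exact sum_exp_neg_le hw hw1 _
        _ = _ := by
            rw [show 1 - q = 1 + -q by ring, Real.rpow_add hw, Real.rpow_one]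
            field_simp
    linarith

/-- Weights whose squares are of order `B i ^ (p - 1)` for `N₀ ≤ i ≤ n / 2`, with crude bounds
for the other indices: constant below `N₀`, and polynomial in `n` of degree `E` beyond `n / 2`. -/
structure PowerWeights (n : ℕ) (d : ℕ → ℝ) (N₀ : ℕ) (B p C : ℝ) (E : ℕ) : Prop where
  small : ∀ i < N₀, i ≤ n → d i ^ 2 ≤ C * B
  lower : ∀ i, N₀ ≤ i → 2 * i ≤ n → B * (i : ℝ) ^ (p - 1) ≤ C * d i ^ 2
  upper : ∀ i, N₀ ≤ i → 2 * i ≤ n → d i ^ 2 ≤ C * B * (i : ℝ) ^ (p - 1)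
  tail : ∀ i ≤ n, n < 2 * i → d i ^ 2 ≤ C * B * (n : ℝ) ^ E

/-- A condition on `n` which makes every power `n ^ E` negligible compared with
`exp (log ^ 2 n / 2)`. -/
def LogLarge (E n : ℕ) : Prop := 2 * ((E : ℝ) + 2) ≤ Real.log n

lemma eventually_logLarge (E : ℕ) : ∀ᶠ n : ℕ in atTop, LogLarge E n :=
  (Real.tendsto_log_atTop.comp tendsto_natCast_atTop_atTop).eventually_ge_atTop _

lemma LogLarge.two_le {E n : ℕ} (h : LogLarge E n) : 2 ≤ n := by
  by_contra hcon
  have : n ≤ 1 := by omega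
  unfold LogLarge at h
  have h0 : Real.log n = 0 := by interval_cases n <;> simp
  rw [h0] at h
  have : (0 : ℝ) ≤ E := Nat.cast_nonneg E
  linarith

lemma LogLarge.pow_mul_exp_le {E n : ℕ} (h : LogLarge E n) {v : ℝ}
    (hv : Real.log n ^ 2 / n ≤ v) :
    ((n : ℝ) + 1) * (n : ℝ) ^ E * Real.exp (-(v * n / 2)) ≤ 1 := by
  have hn : (2 : ℝ) ≤ n := by exact_mod_cast h.two_le
  have hn0 : (0 : ℝ) < n := by linarith
  have h1 : (n : ℝ) + 1 ≤ (n : ℝ) ^ 2 := by nlinarith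
  have h2 : (n : ℝ) ^ (E + 2) = Real.exp (((E : ℝ) + 2) * Real.log n) := by
    rw [← Real.rpow_natCast, Real.rpow_def_of_pos hn0]
    push_cast
    ring_nf
  unfold LogLarge at h
  have hl : 0 ≤ Real.log n := Real.log_nonneg (by linarith)
  rw [div_le_iff₀ hn0] at hv
  calc ((n : ℝ) + 1) * (n : ℝ) ^ E * Real.exp (-(v * n / 2))
      ≤ (n : ℝ) ^ 2 * (n : ℝ) ^ E * Real.exp (-(v * n / 2)) := by gcongr
    _ = Real.exp (((E : ℝ) + 2) * Real.log n + -(v * n / 2)) := by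
        rw [Real.exp_add, ← h2]; ring
    _ ≤ 1 := by
        refine Real.exp_le_one_iff.2 ?_
        nlinarith

/-- The discounted sum of the squares of the weights. -/
lemma exists_sum_sq_mul_exp_le (N₀ : ℕ) (hN₀ : 0 < N₀) {p : ℝ} (hp : 0 < p) : ∃ K : ℝ, 1 ≤ K ∧
    ∀ (n E : ℕ) (d : ℕ → ℝ) (B C : ℝ), 0 < B → 0 < C → LogLarge E n → PowerWeights n d N₀ B p C E →
    ∀ v : ℝ, Real.log n ^ 2 / n ≤ v → 0 < v → v ≤ 1 →
    ∑ i ∈ Finset.range (n + 1), d i ^ 2 * Real.exp (-(v * i)) ≤ K * C * (B * v ^ (-p)) := by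
  obtain ⟨K, hK, hsum⟩ := exists_sum_rpow_mul_exp_le hp
  refine ⟨N₀ + K + 1, by have : (0 : ℝ) ≤ N₀ := Nat.cast_nonneg _; linarith, ?_⟩
  intro n E d B C hB hC hn hd v hv hv0 hv1
  have hvp : 1 ≤ v ^ (-p) := Real.one_le_rpow_of_pos_of_le_one_of_nonpos hv0 hv1 (by linarith)
  rw [← Finset.sum_filter_add_sum_filter_not _ (fun i : ℕ => i < N₀)]
  have h1 : ∑ i ∈ Finset.range (n + 1) with i < N₀, d i ^ 2 * Real.exp (-(v * i)) ≤
      N₀ * C * (B * v ^ (-p)) := by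
    calc _ ≤ ∑ i ∈ Finset.range (n + 1) with i < N₀, C * B := by
          refine Finset.sum_le_sum fun i hi => ?_
          rw [Finset.mem_filter, Finset.mem_range] at hi
          refine (mul_le_of_le_one_right (sq_nonneg _) (Real.exp_le_one_iff.2 ?_)).trans
            (hd.small i hi.2 (by omega))
          have : 0 ≤ v * i := by positivity
          linarith
      _ ≤ N₀ * (C * B) := by
          rw [Finset.sum_const, nsmul_eq_mul]
          gcongr
          calc _ ≤ (Finset.range N₀).card := Finset.card_le_card fun i hi => by
                rw [Finset.mem_filter] at hi
                exact Finset.mem_range.2 hi.2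
            _ = N₀ := Finset.card_range _
      _ ≤ N₀ * (C * (B * v ^ (-p))) := by
          gcongr
          exact le_mul_of_one_le_right hB.le hvp
      _ = _ := by ring
  rw [← Finset.sum_filter_add_sum_filter_not
    (Finset.filter (fun i => ¬ i < N₀) (Finset.range (n + 1))) (fun i : ℕ => 2 * i ≤ n)]
  have h2 : ∑ i ∈ Finset.filter (fun i => ¬ i < N₀) (Finset.range (n + 1)) with 2 * i ≤ n,
      d i ^ 2 * Real.exp (-(v * i)) ≤ K * C * (B * v ^ (-p)) := by
    calc _ ≤ ∑ i ∈ Finset.filter (fun i => ¬ i < N₀) (Finset.range (n + 1)) with 2 * i ≤ n,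
          C * B * ((i : ℝ) ^ (p - 1) * Real.exp (-(v * i))) := by
          refine Finset.sum_le_sum fun i hi => ?_
          simp only [Finset.mem_filter, Finset.mem_range, not_lt] at hi
          rw [← mul_assoc]
          gcongr
          exact hd.upper i hi.1.2 hi.2
      _ ≤ C * B * (K * v ^ (-p)) := by
          rw [← Finset.mul_sum]
          gcongr
          refine hsum v hv0 hv1 _ fun i hi => ?_
          simp only [Finset.mem_filter, Finset.mem_range, not_lt] at hi
          omega
      _ = _ := by ring
  have h3 : ∑ i ∈ Finset.filter (fun i => ¬ i < N₀) (Finset.range (n + 1)) with ¬ 2 * i ≤ n,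
      d i ^ 2 * Real.exp (-(v * i)) ≤ C * (B * v ^ (-p)) := by
    calc _ ≤ ∑ i ∈ Finset.filter (fun i => ¬ i < N₀) (Finset.range (n + 1)) with ¬ 2 * i ≤ n,
          C * B * (n : ℝ) ^ E * Real.exp (-(v * n / 2)) := by
          refine Finset.sum_le_sum fun i hi => ?_
          simp only [Finset.mem_filter, Finset.mem_range, not_lt, not_le] at hi
          have hi2 : (n : ℝ) ≤ 2 * i := by exact_mod_cast hi.2.le
          refine mul_le_mul (hd.tail i (by omega) hi.2) (Real.exp_le_exp.2 ?_)
            (Real.exp_pos _).le (by positivity)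
          nlinarith
      _ ≤ ((n : ℝ) + 1) * (C * B * (n : ℝ) ^ E * Real.exp (-(v * n / 2))) := by
          rw [Finset.sum_const, nsmul_eq_mul]
          gcongr
          have := (Finset.card_filter_le (Finset.filter (fun i => ¬ i < N₀) (Finset.range (n + 1)))
            (fun i => ¬ 2 * i ≤ n)).trans (Finset.card_filter_le _ _)
          rw [Finset.card_range] at this
          exact_mod_cast this
      _ = C * B * (((n : ℝ) + 1) * (n : ℝ) ^ E * Real.exp (-(v * n / 2))) := by ring
      _ ≤ C * B * 1 := by gcongr; exact hn.pow_mul_exp_le hv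
      _ ≤ C * (B * v ^ (-p)) := by
          rw [mul_one]
          gcongr
          exact le_mul_of_one_le_right hB.le hvp
  calc _ ≤ N₀ * C * (B * v ^ (-p)) + (K * C * (B * v ^ (-p)) + C * (B * v ^ (-p))) := by linarith
    _ = _ := by ring

lemma exp_neg_two_mul_le {v : ℝ} (h0 : 0 ≤ v) (h1 : v ≤ 1 / 2) : Real.exp (-(2 * v)) ≤ 1 - v := by
  have h2 := Real.add_one_le_exp (2 * v)
  have h3 : Real.exp (-(2 * v)) * Real.exp (2 * v) = 1 := by rw [← Real.exp_add]; simp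
  have h4 := Real.exp_pos (-(2 * v))
  have h5 : Real.exp (-(2 * v)) * (2 * v + 1) ≤ 1 :=
    (mul_le_mul_of_nonneg_left h2 h4.le).trans h3.le
  have h6 : 1 ≤ (1 - v) * (2 * v + 1) := by nlinarith
  by_contra hcon
  nlinarith [not_le.1 hcon]

lemma pow_le_exp_neg {x : ℝ} (hx : 0 ≤ x) (i : ℕ) : x ^ i ≤ Real.exp (-((1 - x) * i)) := by
  have : x ≤ Real.exp (-(1 - x)) := by
    have := Real.add_one_le_exp (-(1 - x)); linarith
  calc x ^ i ≤ Real.exp (-(1 - x)) ^ i := by gcongr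
    _ = _ := by rw [← Real.exp_nat_mul]; ring_nf

/-- The terms of the variances of all the derivatives are dominated by those of one sum. -/
lemma derivVar_mul_le {n : ℕ} {d : ℕ → ℝ} {x : ℝ} (hx : 1 / 2 ≤ x) (hx1 : x ≤ 1) {k : ℕ}
    (hk : k ≤ 12) : derivVar n d k x * (1 - x) ^ (2 * k) ≤
      4 ^ 12 * (Nat.factorial 24) *
        ∑ i ∈ Finset.range (n + 1), d i ^ 2 * Real.exp (-((1 - x) * i)) := by
  unfold derivVar
  rw [Finset.sum_mul, Finset.mul_sum]
  refine Finset.sum_le_sum fun i _ => ?_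
  set v := 1 - x with hv
  have hv0 : 0 ≤ v := by linarith
  rcases lt_or_ge i k with hik | hik
  · rw [Nat.descFactorial_eq_zero_iff_lt.2 hik]
    simp only [Nat.cast_zero, mul_zero, zero_mul, ne_eq, OfNat.ofNat_ne_zero, not_false_eq_true,
      zero_pow]
    positivity
  · have h1 : (i.descFactorial k : ℝ) ≤ (i : ℝ) ^ k := by
      exact_mod_cast Nat.descFactorial_le_pow i k
    have hx0 : 0 < x := by linarith
    have h2 : x ^ (i - k) ≤ 2 ^ k * x ^ i := by
      have h3 : x ^ i = x ^ (i - k) * x ^ k := by rw [← pow_add]; congr 1; omega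
      rw [h3]
      have h4 : 1 ≤ 2 ^ k * x ^ k := by
        rw [← mul_pow]; exact one_le_pow₀ (by linarith)
      calc x ^ (i - k) = x ^ (i - k) * 1 := by ring
        _ ≤ x ^ (i - k) * (2 ^ k * x ^ k) := by gcongr
        _ = _ := by ring
    have h5 := pow_le_exp_neg hx0.le i
    rw [← hv] at h5
    have h6 : (v * i) ^ (2 * k) * Real.exp (-(v * i)) ≤ Nat.factorial 24 := by
      have h7 := Real.pow_div_factorial_le_exp (v * i) (by positivity) (2 * k)
      rw [div_le_iff₀ (by positivity)] at h7
      rw [Real.exp_neg, ← div_eq_mul_inv, div_le_iff₀ (Real.exp_pos _)]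
      refine h7.trans ?_
      rw [mul_comm]
      gcongr
      omega
    have h8 : Real.exp (-(v * i)) ^ 2 = Real.exp (-(v * i)) * Real.exp (-(v * i)) := by ring
    calc (d i * (i.descFactorial k : ℝ) * x ^ (i - k)) ^ 2 * v ^ (2 * k)
        = d i ^ 2 * ((i.descFactorial k : ℝ) * x ^ (i - k)) ^ 2 * v ^ (2 * k) := by ring
      _ ≤ d i ^ 2 * ((i : ℝ) ^ k * (2 ^ k * Real.exp (-(v * i)))) ^ 2 * v ^ (2 * k) := by
          gcongr
          exact h2.trans (by gcongr)
      _ = d i ^ 2 * 4 ^ k * ((v * i) ^ (2 * k) * Real.exp (-(v * i))) * Real.exp (-(v * i)) := by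
          rw [show (4 : ℝ) ^ k = (2 ^ k) ^ 2 by rw [← pow_mul, mul_comm, pow_mul]; norm_num]
          rw [mul_pow v]
          ring
      _ ≤ d i ^ 2 * 4 ^ 12 * (Nat.factorial 24) * Real.exp (-(v * i)) := by
          gcongr
          norm_num
      _ = _ := by ring

lemma sum_filter_le_mul {n : ℕ} {q : ℕ → Prop} [DecidablePred q] {f : ℕ → ℝ} {c : ℝ} {m : ℕ}
    (hc : 0 ≤ c) (hf : ∀ i ≤ n, q i → f i ≤ c)
    (hm : (Finset.filter q (Finset.range (n + 1))).card ≤ m) :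
    ∑ i ∈ Finset.range (n + 1) with q i, f i ≤ m * c := by
  calc _ ≤ ∑ i ∈ Finset.range (n + 1) with q i, c := by
        refine Finset.sum_le_sum fun i hi => ?_
        rw [Finset.mem_filter, Finset.mem_range] at hi
        exact hf i (by omega) hi.2
    _ ≤ _ := by
        rw [Finset.sum_const, nsmul_eq_mul]
        gcongr

/-- The indices between `1 / v` and `2 / v` alone produce the full order of the variance at `1 -
v`. -/
lemma lower_variance_le {n N₀ E : ℕ} {d : ℕ → ℝ} {B p C v : ℝ} {W : Set ℕ} (hB : 0 < B)
    (hC : 0 < C) (hp : 0 < p) (hd : PowerWeights n d N₀ B p C E) (hv0 : 0 < v)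
    (hv : 4 * (N₀ : ℝ) * v ≤ 1) (hv2 : v ≤ 1 / 4) (hvn : 4 / v ≤ n)
    (hW : ∀ i : ℕ, 1 / v ≤ i → (i : ℝ) ≤ 2 / v → i ∈ W) :
    B * v ^ (-p) ≤ 4 * C * Real.exp 8 * derivVar n (W.indicator d) 0 (1 - v) := by
  set A := Finset.Icc ⌈1 / v⌉₊ ⌊2 / v⌋₊ with hA
  have hAmem : ∀ i ∈ A, 1 / v ≤ i ∧ (i : ℝ) ≤ 2 / v := fun i hi => by
    rw [hA, Finset.mem_Icc] at hi
    exact ⟨(Nat.le_ceil _).trans (by exact_mod_cast hi.1),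
      (by exact_mod_cast hi.2 : (i : ℝ) ≤ ⌊2 / v⌋₊).trans (Nat.floor_le (by positivity))⟩
  have hcard : 1 / (2 * v) ≤ A.card := by
    rw [hA, Nat.card_Icc]
    have h1 := Nat.lt_floor_add_one (2 / v)
    have h2 := Nat.ceil_lt_add_one (a := 1 / v) (by positivity)
    have h3 : (⌊2 / v⌋₊ : ℝ) + 1 - ⌈1 / v⌉₊ ≤ ((⌊2 / v⌋₊ + 1 - ⌈1 / v⌉₊ : ℕ) : ℝ) := by
      have : ⌊2 / v⌋₊ + 1 ≤ (⌊2 / v⌋₊ + 1 - ⌈1 / v⌉₊) + ⌈1 / v⌉₊ := by omega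
      have : ((⌊2 / v⌋₊ + 1 : ℕ) : ℝ) ≤ ((⌊2 / v⌋₊ + 1 - ⌈1 / v⌉₊ : ℕ) : ℝ) + ⌈1 / v⌉₊ := by
        exact_mod_cast this
      push_cast at this ⊢
      linarith
    have h4 : 1 ≤ 1 / (2 * v) := by rw [le_div_iff₀ (by positivity)]; linarith
    have h5 : 2 / v - 1 / v - 1 = 2 * (1 / (2 * v)) - 1 := by field_simp; ring
    linarith
  have hterm : ∀ i ∈ A, B * v ^ (1 - p) / (2 * C * Real.exp 8) ≤
      (W.indicator d i * ((i.descFactorial 0 : ℕ) : ℝ) * (1 - v) ^ (i - 0)) ^ 2 := by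
    intro i hi
    obtain ⟨h1, h2⟩ := hAmem i hi
    rw [Set.indicator_of_mem (hW i h1 h2)]
    simp only [Nat.descFactorial_zero, Nat.cast_one, mul_one, Nat.sub_zero]
    have hi0 : (0 : ℝ) < i := lt_of_lt_of_le (by positivity) h1
    have hiN : N₀ ≤ i := by
      have : (N₀ : ℝ) ≤ i := by
        refine le_trans ?_ h1
        rw [le_div_iff₀ hv0]
        have : (0 : ℝ) ≤ N₀ * v := by positivity
        linarith
      exact_mod_cast this
    have hin : 2 * i ≤ n := by
      have : (2 : ℝ) * i ≤ n := by
        refine le_trans ?_ hvn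
        calc 2 * (i : ℝ) ≤ 2 * (2 / v) := by gcongr
          _ = 4 / v := by ring
      exact_mod_cast this
    have h3 := hd.lower i hiN hin
    have h4 : v ^ (1 - p) / 2 ≤ (i : ℝ) ^ (p - 1) := by
      have e : v ^ (1 - p) = (1 / v) ^ (p - 1) := by
        rw [one_div, Real.inv_rpow hv0.le, ← Real.rpow_neg hv0.le]; ring_nf
      rw [e]
      rcases le_total 1 p with hp1 | hp1
      · have h5 : (1 / v) ^ (p - 1) ≤ (i : ℝ) ^ (p - 1) :=
          Real.rpow_le_rpow (by positivity) h1 (by linarith)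
        have : 0 < (1 / v) ^ (p - 1) := by positivity
        linarith
      · have h5 : (2 / v) ^ (p - 1) ≤ (i : ℝ) ^ (p - 1) :=
          Real.rpow_le_rpow_of_nonpos hi0 h2 (by linarith)
        refine le_trans ?_ h5
        rw [show 2 / v = 2 * (1 / v) by ring, Real.mul_rpow (by norm_num) (by positivity)]
        have h6 : (1 / 2 : ℝ) ≤ 2 ^ (p - 1) := by
          rw [show (1 / 2 : ℝ) = 2 ^ (-1 : ℝ) by rw [Real.rpow_neg_one]; norm_num]
          exact Real.rpow_le_rpow_of_exponent_le (by norm_num) (by linarith)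
        have : 0 < (1 / v) ^ (p - 1) := by positivity
        nlinarith
    have h7 : Real.exp (-8) ≤ ((1 - v) ^ i) ^ 2 := by
      have h8 := exp_neg_two_mul_le hv0.le (by linarith)
      calc Real.exp (-8) ≤ Real.exp (-(2 * v)) ^ (i * 2) := by
            rw [← Real.exp_nat_mul]
            refine Real.exp_le_exp.2 ?_
            rw [le_div_iff₀ hv0] at h2
            push_cast
            nlinarith
        _ ≤ (1 - v) ^ (i * 2) := by gcongr
        _ = _ := by rw [pow_mul]
    rw [div_le_iff₀ (by positivity), mul_pow]
    have h9 : Real.exp (-8) * Real.exp 8 = 1 := by rw [← Real.exp_add]; simp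
    calc B * v ^ (1 - p) = 2 * (B * (v ^ (1 - p) / 2)) := by ring
      _ ≤ 2 * (B * (i : ℝ) ^ (p - 1)) := by gcongr
      _ ≤ 2 * (C * d i ^ 2) * (Real.exp (-8) * Real.exp 8) := by rw [h9]; linarith
      _ ≤ 2 * (C * d i ^ 2) * (((1 - v) ^ i) ^ 2 * Real.exp 8) := by gcongr
      _ = _ := by ring
  have hsub : A ⊆ Finset.range (n + 1) := by
    intro i hi
    obtain ⟨h1, h2⟩ := hAmem i hi
    rw [Finset.mem_range, Nat.lt_succ_iff]
    have : (i : ℝ) ≤ n := by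
      refine h2.trans (le_trans ?_ hvn)
      gcongr
      norm_num
    exact_mod_cast this
  have hsum : (A.card : ℝ) * (B * v ^ (1 - p) / (2 * C * Real.exp 8)) ≤
      derivVar n (W.indicator d) 0 (1 - v) := by
    calc _ = ∑ i ∈ A, B * v ^ (1 - p) / (2 * C * Real.exp 8) := by
          rw [Finset.sum_const, nsmul_eq_mul]
      _ ≤ _ := Finset.sum_le_sum hterm
      _ ≤ _ := Finset.sum_le_sum_of_subset_of_nonneg hsub fun i _ _ => sq_nonneg _
  have h10 : 1 / (2 * v) * (B * v ^ (1 - p) / (2 * C * Real.exp 8)) ≤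
      derivVar n (W.indicator d) 0 (1 - v) := le_trans (by gcongr) hsum
  have h11 : 1 / (2 * v) * (B * v ^ (1 - p) / (2 * C * Real.exp 8)) =
      B * v ^ (-p) / (4 * C * Real.exp 8) := by
    rw [show 1 - p = 1 + -p by ring, Real.rpow_add hv0, Real.rpow_one]
    field_simp
    ring
  rw [h11, div_le_iff₀ (by positivity)] at h10
  linarith

/-- The terms outside the window come from four sources: the indices below `N₀`, those below `H`
(much smaller than the scale), those much larger than the scale, and those beyond `n / 2`. -/
lemma error_term_le {n N₀ E i : ℕ} {d : ℕ → ℝ} {B p C x a H : ℝ} (hC : 0 < C)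
    (hB : 0 < B) (hd : PowerWeights n d N₀ B p C E) (hx0 : 0 ≤ x) (hv : 0 ≤ 1 - x) (hin : i ≤ n)
    (hi : N₀ ≤ i → H < i → 2 * i ≤ n → a ≤ (1 - x) * i) :
    (d i * x ^ i) ^ 2 ≤
        (if i < N₀ then C * B else 0) +
        (if N₀ ≤ i ∧ (i : ℝ) ≤ H then C * B * (i : ℝ) ^ (p - 1) else 0) +
        Real.exp (-a) * (d i ^ 2 * Real.exp (-((1 - x) * i))) +
        (if n < 2 * i then C * B * (n : ℝ) ^ E * Real.exp (-((1 - x) * n / 2)) else 0) := by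
  set v := 1 - x with hvx
  have t1 : 0 ≤ (if i < N₀ then C * B else 0) := by split_ifs <;> positivity
  have t2 : 0 ≤ (if N₀ ≤ i ∧ (i : ℝ) ≤ H then C * B * (i : ℝ) ^ (p - 1) else 0) := by
    split_ifs <;> positivity
  have t3 : 0 ≤ Real.exp (-a) * (d i ^ 2 * Real.exp (-(v * i))) := by positivity
  have t4 : 0 ≤ (if n < 2 * i then C * B * (n : ℝ) ^ E * Real.exp (-(v * n / 2)) else 0) := by
    split_ifs <;> positivity
  have hxi : (x ^ i) ^ 2 ≤ Real.exp (-(v * i)) * Real.exp (-(v * i)) := by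
    have := pow_le_exp_neg hx0 i
    rw [sq]
    gcongr
  have hvi : Real.exp (-(v * i)) ≤ 1 := by
    refine Real.exp_le_one_iff.2 ?_
    have : 0 ≤ v * i := by positivity
    linarith
  have hxi1 : (x ^ i) ^ 2 ≤ Real.exp (-(v * i)) :=
    hxi.trans (mul_le_of_le_one_right (Real.exp_pos _).le hvi)
  have hxi2 : (x ^ i) ^ 2 ≤ 1 := hxi1.trans hvi
  rw [mul_pow]
  by_cases hiN : i < N₀
  · refine le_add_of_le_of_nonneg (le_add_of_le_of_nonneg (le_add_of_le_of_nonneg ?_ t2) t3) t4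
    rw [if_pos hiN]
    exact (mul_le_of_le_one_right (sq_nonneg _) hxi2).trans (hd.small i hiN hin)
  by_cases hi2 : n < 2 * i
  · refine le_add_of_nonneg_of_le (add_nonneg (add_nonneg t1 t2) t3) ?_
    rw [if_pos hi2]
    have h6 : Real.exp (-(v * i)) ≤ Real.exp (-(v * n / 2)) := by
      refine Real.exp_le_exp.2 ?_
      have : (n : ℝ) ≤ 2 * i := by exact_mod_cast hi2.le
      nlinarith
    exact mul_le_mul (hd.tail i hin hi2) (hxi1.trans h6) (sq_nonneg _) (by positivity)
  by_cases hiH : (i : ℝ) ≤ H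
  · refine le_add_of_le_of_nonneg (le_add_of_le_of_nonneg (le_add_of_nonneg_of_le t1 ?_) t3) t4
    rw [if_pos (show N₀ ≤ i ∧ (i : ℝ) ≤ H from ⟨not_lt.1 hiN, hiH⟩)]
    exact (mul_le_of_le_one_right (sq_nonneg _) hxi2).trans
      (hd.upper i (not_lt.1 hiN) (not_lt.1 hi2))
  · refine le_add_of_le_of_nonneg (le_add_of_nonneg_of_le (add_nonneg t1 t2) ?_) t4
    have h6 : Real.exp (-(v * i)) ≤ Real.exp (-a) :=
      Real.exp_le_exp.2 (neg_le_neg (hi (not_lt.1 hiN) (not_le.1 hiH) (not_lt.1 hi2)))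
    calc _ ≤ d i ^ 2 * (Real.exp (-a) * Real.exp (-(v * i))) := by
          gcongr
          exact hxi.trans (by gcongr)
      _ = _ := by ring

/-- Summation of `error_term_le` over the indices outside the window `W`. The scale of the variance
is `S`, and `A₁`, `A₂` measure the contributions of the small and of the large indices. -/
lemma error_variance_le {n N₀ E : ℕ} {d : ℕ → ℝ} {B p C x a H S A₁ A₂ : ℝ} {W : Set ℕ}
    (hN₀ : 0 < N₀) (hp : 0 < p) (hC : 0 < C)
    (hB : 0 < B) (hd : PowerWeights n d N₀ B p C E) (hn : LogLarge E n) (hx0 : 0 ≤ x)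
    (hv : 0 ≤ 1 - x) (hvn : Real.log n ^ 2 / n ≤ 1 - x) (hBS : B ≤ S) (hH : 0 ≤ H)
    (hHS : B * ((1 + 1 / p) * H ^ p) ≤ A₁ * S)
    (hA : Real.exp (-a) * ∑ i ∈ Finset.range (n + 1), d i ^ 2 * Real.exp (-((1 - x) * i)) ≤
      C * A₂ * S)
    (hW : ∀ i : ℕ, H < i → 2 * i ≤ n → i ∉ W → a ≤ (1 - x) * i) :
    derivVar n (fun i => d i - W.indicator d i) 0 x ≤ C * (N₀ + A₁ + A₂ + 1) * S := by
  classical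
  set v := 1 - x with hvx
  have hS0 : 0 ≤ S := hB.le.trans hBS
  have hterm : ∀ i ∈ Finset.range (n + 1),
      ((d i - W.indicator d i) * ((i.descFactorial 0 : ℕ) : ℝ) * x ^ (i - 0)) ^ 2 ≤
      (if i < N₀ then C * B else 0) +
      (if N₀ ≤ i ∧ (i : ℝ) ≤ H then C * B * (i : ℝ) ^ (p - 1) else 0) +
      Real.exp (-a) * (d i ^ 2 * Real.exp (-(v * i))) +
      (if n < 2 * i then C * B * (n : ℝ) ^ E * Real.exp (-(v * n / 2)) else 0) := by
    intro i hi
    have hin : i ≤ n := Nat.lt_succ_iff.1 (Finset.mem_range.1 hi)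
    simp only [Nat.descFactorial_zero, Nat.cast_one, mul_one, Nat.sub_zero]
    by_cases hiW : i ∈ W
    · rw [Set.indicator_of_mem hiW, sub_self, zero_mul, zero_pow two_ne_zero]
      refine add_nonneg (add_nonneg (add_nonneg ?_ ?_) (by positivity)) ?_ <;>
        split_ifs <;> positivity
    · rw [Set.indicator_of_notMem hiW, sub_zero]
      exact error_term_le hC hB hd hx0 hv hin fun _ h1 h2 => hW i h1 h2 hiW
  have hall := Finset.sum_le_sum hterm
  rw [Finset.sum_add_distrib, Finset.sum_add_distrib, Finset.sum_add_distrib,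
    ← Finset.sum_filter, ← Finset.sum_filter, ← Finset.sum_filter,
    ← Finset.mul_sum _ _ (Real.exp (-a))] at hall
  refine hall.trans ?_
  have b1 : ∑ i ∈ Finset.range (n + 1) with i < N₀, C * B ≤ C * N₀ * S := by
    refine (sum_filter_le_mul (m := N₀) (by positivity) (fun i _ _ => le_rfl) ?_).trans ?_
    · calc _ ≤ (Finset.range N₀).card := Finset.card_le_card fun i hi => by
            rw [Finset.mem_filter] at hi
            exact Finset.mem_range.2 hi.2
        _ = N₀ := Finset.card_range _
    · calc N₀ * (C * B) ≤ N₀ * (C * S) := by gcongr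
        _ = _ := by ring
  have b2 : ∑ i ∈ Finset.range (n + 1) with N₀ ≤ i ∧ (i : ℝ) ≤ H, C * B * (i : ℝ) ^ (p - 1) ≤
      C * A₁ * S := by
    rw [← Finset.mul_sum]
    have := sum_rpow_sub_one_le hp (M := H)
      (s := {i ∈ Finset.range (n + 1) | N₀ ≤ i ∧ (i : ℝ) ≤ H}) (fun i hi => by
        rw [Finset.mem_filter] at hi
        exact ⟨hN₀.trans_le hi.2.1, hi.2.2⟩) hH
    calc _ ≤ C * B * ((1 + 1 / p) * H ^ p) := by gcongr
      _ = C * (B * ((1 + 1 / p) * H ^ p)) := by ring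
      _ ≤ C * (A₁ * S) := by gcongr
      _ = _ := by ring
  have b4 : ∑ i ∈ Finset.range (n + 1) with n < 2 * i,
      C * B * (n : ℝ) ^ E * Real.exp (-(v * n / 2)) ≤ C * S := by
    refine (sum_filter_le_mul (m := n + 1) (by positivity) (fun i _ _ => le_rfl)
      ((Finset.card_filter_le _ _).trans (by simp))).trans ?_
    calc ((n + 1 : ℕ) : ℝ) * (C * B * (n : ℝ) ^ E * Real.exp (-(v * n / 2)))
        = C * B * (((n : ℝ) + 1) * (n : ℝ) ^ E * Real.exp (-(v * n / 2))) := by push_cast; ring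
      _ ≤ C * B * 1 := by gcongr; exact hn.pow_mul_exp_le hvn
      _ ≤ _ := by rw [mul_one]; gcongr
  calc _ ≤ C * N₀ * S + C * A₁ * S + C * A₂ * S + C * S :=
        add_le_add (add_le_add (add_le_add b1 b2) hA) b4
    _ = _ := by ring

/-- **Local behaviour of a polynomial with power weights.** On an interval of scales between `u e ^
(-g)` and `u`, the indices outside a window `W` reaching a factor `e ^ g` further on both sides
contribute a proportion of order `e ^ (-g p)` of the variance; truncated to `W`, the polynomial is
still regular. -/
lemma exists_regularOn (N₀ : ℕ) (hN₀ : 0 < N₀) {p C : ℝ} (hp : 0 < p) (hC : 1 ≤ C) :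
    ∃ C' : ℝ, 1 ≤ C' ∧ ∀ (n E : ℕ) (d : ℕ → ℝ) (B : ℝ), 0 < B → LogLarge E n →
    PowerWeights n d N₀ B p C E → ∀ (u g : ℝ) (W : Set ℕ), 1 ≤ g → 0 < u →
    Real.log n ^ 2 / n ≤ u * Real.exp (-g) → u ≤ Real.exp (-g) → 4 * (N₀ : ℝ) * u ≤ 1 →
    (∀ i : ℕ, Real.exp (-g) / u ≤ i → (i : ℝ) ≤ Real.exp g / (u * Real.exp (-g)) → 2 * i ≤ n →
      i ∈ W) →
    RegularOn n (W.indicator d) B p C' (Set.Icc (1 - u) (1 - u * Real.exp (-g))) ∧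
    ∀ x ∈ Set.Icc (1 - u) (1 - u * Real.exp (-g)),
      derivVar n (fun i => d i - W.indicator d i) 0 x ≤
        C' * Real.exp (-(g * p)) * (B * (1 - x) ^ (-p)) := by
  obtain ⟨K, hK, hsum⟩ := exists_sum_sq_mul_exp_le N₀ hN₀ hp
  obtain ⟨K₃, hK₃, hexp⟩ := rpow_mul_exp_neg_le p
  have hN₀' : (1 : ℝ) ≤ N₀ := by exact_mod_cast hN₀
  have hip : 0 < 1 / p := by positivity
  have he8 : 1 ≤ Real.exp 8 := Real.one_le_exp (by norm_num)
  set c₁ := 4 * C * Real.exp 8 with hc₁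
  set c₂ := 4 ^ 12 * (Nat.factorial 24 : ℝ) * (K * C) with hc₂
  set c₃ := C * (N₀ + (1 + 1 / p) + K * K₃ + 1) with hc₃
  have hc₁1 : 1 ≤ c₁ := by nlinarith
  have hc₂0 : 0 ≤ c₂ := by positivity
  have hc₃0 : 0 ≤ c₃ := by positivity
  refine ⟨c₁ + c₂ + c₃, by linarith, ?_⟩
  intro n E d B hB hn hd u g W hg hu hun hug hu4 hW
  have hn2 : (2 : ℝ) ≤ n := by exact_mod_cast hn.two_le
  have hn0 : (0 : ℝ) < n := by linarith
  have hlog : 4 ≤ Real.log n := by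
    have h1 : 2 * ((E : ℝ) + 2) ≤ Real.log n := hn
    linarith [(Nat.cast_nonneg E : (0 : ℝ) ≤ E)]
  have hu14 : u ≤ 1 / 4 := by nlinarith
  have hC0 : 0 < C := by linarith
  have hpt : ∀ x ∈ Set.Icc (1 - u) (1 - u * Real.exp (-g)),
      u * Real.exp (-g) ≤ 1 - x ∧ 1 - x ≤ u ∧ 0 < 1 - x ∧ Real.log n ^ 2 / n ≤ 1 - x := by
    intro x hx
    obtain ⟨h1, h2⟩ := mem_cell hx
    exact ⟨h1, h2, lt_of_lt_of_le (by positivity) h1, hun.trans h1⟩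
  have hind : ∀ i, (W.indicator d i) ^ 2 ≤ d i ^ 2 := fun i => by
    by_cases h : i ∈ W
    · rw [Set.indicator_of_mem h]
    · rw [Set.indicator_of_notMem h, zero_pow two_ne_zero]; positivity
  refine ⟨⟨fun x hx => ?_, fun x hx k hk => ?_⟩, fun x hx => ?_⟩
  · obtain ⟨h1, h2, h3, h4⟩ := hpt x hx
    set v := 1 - x with hv
    have hx' : x = 1 - v := by rw [hv]; ring
    have h5 : 4 / v ≤ n := by
      rw [div_le_iff₀ h3]
      rw [div_le_iff₀ hn0] at h4
      nlinarith
    have h6 := lower_variance_le (W := W) hB hC0 hp hd h3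
      ((mul_le_mul_of_nonneg_left h2 (by positivity : (0 : ℝ) ≤ 4 * N₀)).trans hu4)
      (h2.trans hu14) h5 (by
        intro i hi1 hi2
        refine hW i ?_ ?_ ?_
        · refine le_trans ?_ hi1
          have : Real.exp (-g) ≤ 1 := Real.exp_le_one_iff.2 (by linarith)
          gcongr
        · refine hi2.trans ?_
          have h7 : 2 ≤ Real.exp g := by
            have := Real.add_one_le_exp g; linarith
          gcongr
        · have : (2 : ℝ) * i ≤ n := by
            refine le_trans ?_ h5
            calc 2 * (i : ℝ) ≤ 2 * (2 / v) := by gcongr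
              _ = 4 / v := by ring
          exact_mod_cast this)
    rw [← hx'] at h6
    refine h6.trans ?_
    have := derivVar_nonneg n (W.indicator d) 0 x
    gcongr
    linarith
  · obtain ⟨h1, h2, h3, h4⟩ := hpt x hx
    have hBv : 0 ≤ B * (1 - x) ^ (-p) := by positivity
    calc derivVar n (W.indicator d) k x * (1 - x) ^ (2 * k)
        ≤ 4 ^ 12 * (Nat.factorial 24) * ∑ i ∈ Finset.range (n + 1),
            (W.indicator d i) ^ 2 * Real.exp (-((1 - x) * i)) :=
          derivVar_mul_le (by linarith) (by linarith) hk
      _ ≤ 4 ^ 12 * (Nat.factorial 24) * ∑ i ∈ Finset.range (n + 1),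
            d i ^ 2 * Real.exp (-((1 - x) * i)) := by
          refine mul_le_mul_of_nonneg_left (Finset.sum_le_sum fun i _ => ?_) (by positivity)
          exact mul_le_mul_of_nonneg_right (hind i) (Real.exp_pos _).le
      _ ≤ 4 ^ 12 * (Nat.factorial 24) * (K * C * (B * (1 - x) ^ (-p))) := by
          gcongr
          exact hsum n E d B C hB hC0 hn hd _ h4 h3 (by linarith)
      _ = c₂ * (B * (1 - x) ^ (-p)) := by rw [hc₂]; ring
      _ ≤ _ := by gcongr; linarith
  · obtain ⟨h1, h2, h3, h4⟩ := hpt x hx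
    have hx0 : 0 ≤ x := by linarith
    set v := 1 - x with hv
    set S := Real.exp (-(g * p)) * (B * v ^ (-p)) with hS
    set H := Real.exp (-g) / u with hH
    have hH0 : 0 < H := by positivity
    have hgp : Real.exp (-(g * p)) * Real.exp (g * p) = 1 := by rw [← Real.exp_add]; simp
    -- a constant is negligible, since the scales are smaller than `e ^ (-g)`
    have hBS : B ≤ S := by
      have h5 : Real.exp (g * p) ≤ v ^ (-p) := by
        calc Real.exp (g * p) = (Real.exp (-g)) ^ (-p) := by rw [← Real.exp_mul]; ring_nf
          _ ≤ v ^ (-p) := Real.rpow_le_rpow_of_nonpos h3 (h2.trans hug) (by linarith)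
      calc B = B * (Real.exp (-(g * p)) * Real.exp (g * p)) := by rw [hgp, mul_one]
        _ ≤ B * (Real.exp (-(g * p)) * v ^ (-p)) := by gcongr
        _ = S := by rw [hS]; ring
    have hHS : B * H ^ p ≤ S := by
      have h5 : H ^ p = Real.exp (-(g * p)) * u ^ (-p) := by
        rw [hH, Real.div_rpow (Real.exp_pos _).le hu.le, ← Real.exp_mul, Real.rpow_neg hu.le]
        ring_nf
      have h6 : u ^ (-p) ≤ v ^ (-p) := Real.rpow_le_rpow_of_nonpos h3 h2 (by linarith)
      rw [h5, hS]
      calc B * (Real.exp (-(g * p)) * u ^ (-p)) = Real.exp (-(g * p)) * (B * u ^ (-p)) := by ring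
        _ ≤ _ := by gcongr
    have hee : Real.exp (-Real.exp g) ≤ K₃ * Real.exp (-(g * p)) := by
      have h5 := hexp (Real.exp g) (Real.one_le_exp (by linarith))
      rw [← Real.exp_mul] at h5
      have h6 : Real.exp (-Real.exp g) ≤ Real.exp (-(Real.exp g / 2)) :=
        Real.exp_le_exp.2 (by linarith [Real.exp_pos g])
      calc Real.exp (-Real.exp g) ≤ Real.exp (-(Real.exp g / 2)) := h6
        _ = (Real.exp (g * p) * Real.exp (-(Real.exp g / 2))) * Real.exp (-(g * p)) := by
            rw [mul_comm (Real.exp (g * p)), mul_assoc, mul_comm (Real.exp (g * p)), hgp, mul_one]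
        _ ≤ _ := by gcongr
    have hS0 : 0 ≤ S := hB.le.trans hBS
    have herr := error_variance_le (W := W) (H := H) (S := S) (a := Real.exp g) (A₁ := 1 + 1 / p)
      (A₂ := K * K₃) hN₀ hp hC0 hB hd hn hx0 h3.le h4 hBS hH0.le ?_ ?_ ?_
    · refine herr.trans ?_
      calc _ = c₃ * S := by rw [hc₃]
        _ ≤ (c₁ + c₂ + c₃) * S := by gcongr; linarith
        _ = _ := by rw [hS]; ring
    · calc B * ((1 + 1 / p) * H ^ p) = (1 + 1 / p) * (B * H ^ p) := by ring
        _ ≤ _ := by gcongr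
    · calc _ ≤ (K₃ * Real.exp (-(g * p))) * (K * C * (B * v ^ (-p))) := by
            gcongr
            exact hsum n E d B C hB hC0 hn hd _ h4 h3 (by linarith)
        _ = _ := by rw [hS]; ring
    · intro i hiH hi2 hiW
      have hiT : Real.exp g / (u * Real.exp (-g)) < i := by
        by_contra hcon
        exact hiW (hW i hiH.le (not_lt.1 hcon) hi2)
      rw [div_lt_iff₀ (by positivity)] at hiT
      have : (i : ℝ) * (u * Real.exp (-g)) ≤ i * v := by gcongr
      linarith

/-! ### Local approximation by truncated polynomials -/

section Dividing

open Polynomial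

lemma rootCount_le_of_dvd {p q : ℝ[X]} (h : p ∣ q) (hq : q = 0 → p = 0) (S : Set ℝ) :
    rootCount p S ≤ rootCount q S := by
  classical
  rcases eq_or_ne q 0 with h0 | h0
  · rw [hq h0, h0]
  · exact Multiset.countP_le_of_le _ (Polynomial.roots.le_of_dvd h0 h)

lemma rootCount_le_rootCount_X_mul (p : ℝ[X]) (S : Set ℝ) : rootCount p S ≤ rootCount (X * p) S :=
  rootCount_le_of_dvd (dvd_mul_left _ _) (fun h => by simpa using h) S

lemma X_mul_derivative_weightedPoly (n : ℕ) (d x : ℕ → ℝ) :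
    X * derivative (weightedPoly n d x) = weightedPoly n (fun i => i * d i) x := by
  ext i
  rw [weightedPoly_coeff]
  cases i with
  | zero => simp
  | succ i =>
    rw [coeff_X_mul, coeff_derivative, weightedPoly_coeff]
    split_ifs
    · push_cast; ring
    · simp

/-- Passing to `X p'` removes the constant coefficient, at the cost of one root. -/
lemma rootCount_le_rootCount_index_mul (n : ℕ) (d x : ℕ → ℝ) {S : Set ℝ} (hS : S.OrdConnected) :
    rootCount (weightedPoly n d x) S ≤ rootCount (weightedPoly n (fun i => i * d i) x) S + 1 := by
  rw [← X_mul_derivative_weightedPoly]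
  exact (rootCount_le_rootCount_derivative _ hS).trans
    (Nat.add_le_add_right (rootCount_le_rootCount_X_mul _ _) 1)

lemma reflect_weightedPoly (n : ℕ) (d x : ℕ → ℝ) :
    reflect n (weightedPoly n d x) =
      weightedPoly n (fun i => d (revAt n i)) (fun i => x (revAt n i)) := by
  ext i
  rw [coeff_reflect, weightedPoly_coeff, weightedPoly_coeff]
  by_cases hi : i ≤ n
  · rw [revAt_le hi, if_pos (by omega), if_pos (by omega)]
  · rw [revAt_eq_self_of_lt (by omega)]

/-- The same device applied to the reversed polynomial removes the leading coefficient. -/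
lemma rootCount_le_rootCount_sub_index_mul (n : ℕ) (d x : ℕ → ℝ) {S : Set ℝ}
    (hS : S.OrdConnected) (h0 : S ⊆ Set.Ioi 0) :
    rootCount (weightedPoly n d x) S ≤
      rootCount (weightedPoly n (fun i => ((n : ℝ) - i) * d i) x) S + 1 := by
  have hS0 : (0 : ℝ) ∉ S⁻¹ := fun h => by
    have := h0 (Set.mem_inv.1 h)
    simp at this
  have hSi : S⁻¹.OrdConnected := by
    refine ⟨fun y hy z hz w hw => ?_⟩
    have hy' := h0 (Set.mem_inv.1 hy)
    have hz' := h0 (Set.mem_inv.1 hz)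
    rw [Set.mem_Ioi, inv_pos] at hy' hz'
    have hw' : 0 < w := hy'.trans_le hw.1
    exact Set.mem_inv.2 (hS.out (Set.mem_inv.1 hz) (Set.mem_inv.1 hy)
      ⟨inv_anti₀ hw' hw.2, inv_anti₀ hy' hw.1⟩)
  have h1 := rootCount_inv_set (natDegree_weightedPoly_le n d x) hS0
  have h2 := rootCount_inv_set
    (natDegree_weightedPoly_le n (fun i => ((n : ℝ) - i) * d i) x) hS0
  rw [inv_inv, reflect_weightedPoly] at h1 h2
  rw [h1, h2]
  refine (rootCount_le_rootCount_index_mul n _ _ hSi).trans (le_of_eq ?_)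
  congr 2
  unfold weightedPoly
  refine Finset.sum_congr rfl fun i hi => ?_
  have hi' : i ≤ n := Nat.lt_succ_iff.1 (Finset.mem_range.1 hi)
  simp only [revAt_le hi', Nat.cast_sub hi', sub_sub_cancel]

end Dividing

/-- The contribution of one coefficient to the variance. -/
lemma derivVar_update {n e : ℕ} (he : e ≤ n) (d : ℕ → ℝ) (k : ℕ) (x : ℝ) :
    derivVar n d k x = derivVar n (Function.update d e 0) k x +
      (d e * (e.descFactorial k : ℝ) * x ^ (e - k)) ^ 2 := by
  have hmem : e ∈ Finset.range (n + 1) := Finset.mem_range.2 (by omega)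
  unfold derivVar
  rw [← Finset.add_sum_erase _ _ hmem, ← Finset.add_sum_erase _ (fun i =>
    (Function.update d e 0 i * (i.descFactorial k : ℝ) * x ^ (i - k)) ^ 2) hmem]
  simp only [Function.update_self, zero_mul, ne_eq, OfNat.ofNat_ne_zero, not_false_eq_true,
    zero_pow, zero_add]
  rw [add_comm]
  congr 1
  refine Finset.sum_congr rfl fun i hi => ?_
  rw [Function.update_of_ne (Finset.ne_of_mem_erase hi)]

/-- The indices which matter for the roots at distance between `a e ^ (-h (j + 1))` and
`a e ^ (-h j)` from `1`, with a margin `e ^ h` on both sides. -/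
def pieceWindow (n : ℕ) (a h : ℝ) (j : ℕ) : Set ℕ :=
  {i | 2 * i ≤ n ∧ Real.exp (h * ((j : ℝ) - 1)) ≤ a * i ∧ a * i ≤ Real.exp (h * ((j : ℝ) + 2))}

/-- The `j`-th piece of the interval `(1 - a, 1 - a e ^ (-h K)]`. -/
def piece (a h : ℝ) (j : ℕ) : Set ℝ := Set.Ioc (geomPt a h j) (geomPt a h (j + 1))

/-- The polynomials with weights `d' j`, which involve only the indices in the window of the
`j`-th piece, have few roots in this piece, as has the polynomial with weights `d`, and with high
probability they have the same number, unless `j` is one of at most three exceptions. -/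
structure IsLocalApprox {Ω : Type*} [MeasurableSpace Ω] (P : Measure Ω) (n : ℕ) (d : ℕ → ℝ)
    (a h : ℝ) (K : ℕ) (D κ : ℝ) (d' : ℕ → ℕ → ℝ) (bad : Finset ℕ) : Prop where
  window : ∀ j i, d' j i ≠ 0 → i ∈ pieceWindow n a h j
  card : bad.card ≤ 3
  moment : ∀ ζ : ℕ → Ω → ℝ, IsStdGaussianSeq ζ P → ∀ j < K,
    ∫ ω, (rootCount (weightedPoly n d fun i => ζ i ω) (piece a h j) : ℝ) ^ 4 ∂P ≤ D * h ^ 5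
  moment' : ∀ ζ : ℕ → Ω → ℝ, IsStdGaussianSeq ζ P → ∀ j < K,
    ∫ ω, (rootCount (weightedPoly n (d' j) fun i => ζ i ω) (piece a h j) : ℝ) ^ 4 ∂P ≤ D * h ^ 5
  prob : ∀ ζ : ℕ → Ω → ℝ, IsStdGaussianSeq ζ P → ∀ j < K, j ∉ bad →
    P.real {ω | rootCount (weightedPoly n d fun i => ζ i ω) (piece a h j) ≠
      rootCount (weightedPoly n (d' j) fun i => ζ i ω) (piece a h j)} ≤ D * h * Real.exp (-(κ * h))

/-- The constraints on a partition of `(1 - a, 1 - a e ^ (-h K)]` into `K` pieces. -/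
structure Admissible (n N₀ : ℕ) (a h : ℝ) (K : ℕ) : Prop where
  one_le : 1 ≤ h
  pos : 0 < a
  le_end : Real.log n ^ 2 / n ≤ a * Real.exp (-(h * K))
  le_exp : a ≤ Real.exp (-h)
  small : 4 * (N₀ : ℝ) * a ≤ 1

namespace Admissible

variable {n N₀ K : ℕ} {a h : ℝ}

lemma scale_le (H : Admissible n N₀ a h K) (j : ℕ) : a * Real.exp (-(h * j)) ≤ a := by
  refine mul_le_of_le_one_right H.pos.le (Real.exp_le_one_iff.2 ?_)
  have := H.one_le
  have : 0 ≤ h * j := by positivity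
  linarith

lemma le_scale (H : Admissible n N₀ a h K) {j : ℕ} (hj : j < K) :
    Real.log n ^ 2 / n ≤ a * Real.exp (-(h * j)) * Real.exp (-h) := by
  refine H.le_end.trans ?_
  have := H.one_le
  have := H.pos
  rw [mul_assoc, ← Real.exp_add]
  gcongr
  have : (j : ℝ) + 1 ≤ K := by exact_mod_cast hj
  nlinarith

lemma mem_pieceWindow (H : Admissible n N₀ a h K) {i j : ℕ}
    (h1 : Real.exp (-h) / (a * Real.exp (-(h * j))) ≤ i)
    (h2 : (i : ℝ) ≤ Real.exp h / (a * Real.exp (-(h * j)) * Real.exp (-h))) (h3 : 2 * i ≤ n) :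
    i ∈ pieceWindow n a h j := by
  have ha := H.pos
  rw [div_le_iff₀ (by positivity)] at h1
  rw [le_div_iff₀ (by positivity)] at h2
  refine ⟨h3, ?_, ?_⟩
  · have : Real.exp (h * ((j : ℝ) - 1)) = Real.exp (-h) * Real.exp (h * j) := by
      rw [← Real.exp_add]; ring_nf
    rw [this]
    calc _ ≤ i * (a * Real.exp (-(h * j))) * Real.exp (h * j) := by gcongr
      _ = i * a * (Real.exp (-(h * j)) * Real.exp (h * j)) := by ring
      _ = a * i := by rw [← Real.exp_add]; simp [mul_comm]
  · have : Real.exp (h * ((j : ℝ) + 2)) = Real.exp h * (Real.exp (h * j) * Real.exp h) := by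
      rw [← Real.exp_add, ← Real.exp_add]; ring_nf
    rw [this]
    calc a * (i : ℝ) = i * a * (Real.exp (-(h * j) + -h + (h * j + h))) := by ring_nf; simp
      _ = i * (a * Real.exp (-(h * j)) * Real.exp (-h)) * (Real.exp (h * j) * Real.exp h) := by
        rw [Real.exp_add, Real.exp_add, Real.exp_add]; ring
      _ ≤ _ := by gcongr

lemma piece_eq (j : ℕ) : piece a h j = Set.Ioc (1 - a * Real.exp (-(h * j)))
    (1 - a * Real.exp (-(h * j)) * Real.exp (-h)) := by
  rw [piece, geomPt_succ, one_sub_geomPt, geomPt]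

end Admissible

/-! ### Pieces on which the truncation is local -/

/-- The coefficient `d e` is negligible on the cell `S`: it perturbs neither the variance of the
polynomial nor those of its derivatives. -/
def NegligibleOn (d : ℕ → ℝ) (e : ℕ) (B p C h : ℝ) (S : Set ℝ) : Prop :=
  ∀ x ∈ S, (d e * x ^ e) ^ 2 ≤ Real.exp (-(h * p)) * (B * (1 - x) ^ (-p)) ∧
    ∀ k ≤ 12, (d e * (e.descFactorial k : ℝ) * x ^ (e - k)) ^ 2 * (1 - x) ^ (2 * k) ≤
      C * (B * (1 - x) ^ (-p))

/-- The term with coefficient `d e` dominates the variance of all the others on the cell `S`. -/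
def DominantOn (d : ℕ → ℝ) (e : ℕ) (B p h : ℝ) (S : Set ℝ) : Prop :=
  ∃ M > 0, ∀ x ∈ S, M ≤ (d e * x ^ e) ^ 2 ∧ B * (1 - x) ^ (-p) ≤ Real.exp (-(h * p)) * M

lemma rootCount_weightedPoly_zero (n : ℕ) (x : ℕ → ℝ) (S : Set ℝ) :
    rootCount (weightedPoly n (fun _ => 0) x) S = 0 := by
  simp [weightedPoly, rootCount]

lemma RegularOn.mono_const {n : ℕ} {d : ℕ → ℝ} {B p C C' : ℝ} {S : Set ℝ} (hB : 0 ≤ B)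
    (hS : ∀ x ∈ S, x ≤ 1)
    (h : RegularOn n d B p C S) (hC : C ≤ C') : RegularOn n d B p C' S := by
  refine ⟨fun x hx => (h.lower x hx).trans ?_, fun x hx k hk => (h.upper x hx k hk).trans ?_⟩
  · exact mul_le_mul_of_nonneg_right hC (derivVar_nonneg _ _ _ _)
  · have : 0 ≤ 1 - x := by linarith [hS x hx]
    exact mul_le_mul_of_nonneg_right hC (by positivity)

lemma memLp_rootCount {Ω : Type*} [MeasurableSpace Ω] {P : Measure Ω} [IsProbabilityMeasure P]
    {ζ : ℕ → Ω → ℝ} (hζ : ∀ i, Measurable (ζ i)) (n : ℕ) (d : ℕ → ℝ)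
    {S : Set ℝ} (hS : IsSigmaCompact S) (q : ENNReal) :
    MemLp (fun ω => (rootCount (weightedPoly n d fun i => ζ i ω) S : ℝ)) q P := by
  have hm : Measurable fun ω => (rootCount (weightedPoly n d fun i => ζ i ω) S : ℝ) :=
    measurable_from_nat.comp (measurable_rootCount_weightedPoly hS n d fun i _ _ => hζ i)
  refine MemLp.of_bound hm.aestronglyMeasurable n (ae_of_all _ fun ω => ?_)
  rw [Real.norm_of_nonneg (Nat.cast_nonneg _)]
  exact_mod_cast (rootCount_le_natDegree _ _).trans (natDegree_weightedPoly_le n d _)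

section
variable {Ω : Type*} [MeasurableSpace Ω] {P : Measure Ω} [IsProbabilityMeasure P]

lemma integral_natCast_pow_four_le {M N : Ω → ℕ} (hMN : ∀ ω, M ω ≤ N ω + 1)
    (hN : Integrable (fun ω => (N ω : ℝ) ^ 4) P) :
    ∫ ω, (M ω : ℝ) ^ 4 ∂P ≤ 8 + 8 * ∫ ω, (N ω : ℝ) ^ 4 ∂P := by
  have h : ∀ ω, (M ω : ℝ) ^ 4 ≤ 8 + 8 * (N ω : ℝ) ^ 4 := fun ω => by
    have h1 : (M ω : ℝ) ≤ N ω + 1 := by exact_mod_cast hMN ω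
    calc (M ω : ℝ) ^ 4 ≤ (N ω + 1 : ℝ) ^ 4 := by gcongr
      _ ≤ 8 + 8 * (N ω : ℝ) ^ 4 := by
          have h2 : ((N ω : ℝ) + 1) ^ 2 ≤ 2 * (N ω : ℝ) ^ 2 + 2 := by
            nlinarith [sq_nonneg ((N ω : ℝ) - 1)]
          nlinarith [sq_nonneg ((N ω : ℝ) ^ 2 - 1), sq_nonneg ((N ω : ℝ) + 1)]
  calc ∫ ω, (M ω : ℝ) ^ 4 ∂P ≤ ∫ ω, (8 + 8 * (N ω : ℝ) ^ 4) ∂P :=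
        integral_mono_of_nonneg (ae_of_all _ fun ω => by positivity)
          ((integrable_const _).add (hN.const_mul _)) (ae_of_all _ h)
    _ = _ := by
        rw [integral_add (integrable_const _) (hN.const_mul _), integral_const_mul]
        simp

variable (P) in
/-- A polynomial whose weights are powers, one coefficient excepted, has a local approximation,
provided the exceptional coefficient is negligible or dominant on all but three pieces. -/
lemma exists_isLocalApprox (N₁ : ℕ) (hN₁ : 0 < N₁) {p pR C : ℝ} (hp : 0 < p) (hpR : 0 < pR)
    (hC : 1 ≤ C) : ∃ D : ℝ, 1 ≤ D ∧ ∀ (n E E' : ℕ) (d dR : ℕ → ℝ) (e : ℕ) (B BR : ℝ)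
    (bad : Finset ℕ) (a h : ℝ) (K : ℕ), 0 < B → 0 < BR → LogLarge E n → LogLarge E' n →
    PowerWeights n (Function.update d e 0) N₁ B p C E → PowerWeights n dR N₁ BR pR C E' →
    e ≤ n → (e = 0 ∨ e = n) →
    (∀ (x : ℕ → ℝ) (S : Set ℝ), S.OrdConnected → S ⊆ Set.Ioi 0 →
      rootCount (weightedPoly n d x) S ≤ rootCount (weightedPoly n dR x) S + 1) →
    Admissible n N₁ a h K → bad.card ≤ 3 →
    (∀ j < K, j ∉ bad →
      NegligibleOn d e B p C h (Set.Icc (geomPt a h j) (geomPt a h (j + 1))) ∨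
      DominantOn d e B p h (Set.Icc (geomPt a h j) (geomPt a h (j + 1)))) →
    ∃ d', IsLocalApprox P n d a h K D (p / 18) d' bad := by
  obtain ⟨C₁, hC₁, hreg⟩ := exists_regularOn N₁ hN₁ hp hC
  obtain ⟨C₂, hC₂, hregR⟩ := exists_regularOn N₁ hN₁ hpR hC
  set A := C₁ + C with hA
  set D₁ := A ^ 2 * Real.exp (p + 24) with hD₁
  set D₂ := C₂ ^ 2 * Real.exp (pR + 24) with hD₂
  set Q := (C₁ + 1) ^ (1 / 18 : ℝ) with hQ
  have hA1 : 1 ≤ A := by linarith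
  have hD₁1 : 1 ≤ D₁ := one_le_mul_of_one_le_of_one_le (one_le_pow₀ hA1)
    (Real.one_le_exp (by linarith))
  have hD₂1 : 1 ≤ D₂ := one_le_mul_of_one_le_of_one_le (one_le_pow₀ hC₂)
    (Real.one_le_exp (by linarith))
  have hQ1 : 1 ≤ Q := Real.one_le_rpow (by linarith) (by norm_num)
  have hself : ∀ x : ℝ, 1 ≤ x → x ≤ x ^ 3 := fun x hx => le_self_pow₀ hx (by norm_num)
  set D := 16 + 8 * (24 ^ 4 * (1 + 120 * D₂)) + 24 ^ 4 * (1 + 120 * D₁) + 16 * D₁ * Q with hD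
  have hD1 : 1 ≤ D := by
    have : 0 ≤ 8 * (24 ^ 4 * (1 + 120 * D₂)) := by positivity
    have : 0 ≤ 24 ^ 4 * (1 + 120 * D₁) := by positivity
    have : 0 ≤ 16 * D₁ * Q := by positivity
    linarith
  refine ⟨D, hD1, ?_⟩
  intro n E E' d dR e B BR bad a h K hB hBR hn hn' hd hdR he he0 hcount H hcard hdich
  have hh := H.one_le
  have ha := H.pos
  have hu0 : ∀ j : ℕ, 0 < a * Real.exp (-(h * j)) := fun j => by positivity
  have hn0 : 0 < n := lt_of_lt_of_le (by norm_num) hn.two_le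
  classical
  -- regularity on the `j`-th cell
  have hcell : ∀ j < K, ∀ W : Set ℕ, pieceWindow n a h j ⊆ W →
      RegularOn n (W.indicator (Function.update d e 0)) B p C₁
        (Set.Icc (1 - a * Real.exp (-(h * j))) (1 - a * Real.exp (-(h * j)) * Real.exp (-h))) ∧
      ∀ x ∈ Set.Icc (1 - a * Real.exp (-(h * j))) (1 - a * Real.exp (-(h * j)) * Real.exp (-h)),
        derivVar n (fun i => Function.update d e 0 i - W.indicator (Function.update d e 0) i) 0 x ≤
        C₁ * Real.exp (-(h * p)) * (B * (1 - x) ^ (-p)) := fun j hj W hW =>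
    hreg n E _ B hB hn hd _ h W hh (hu0 j) (H.le_scale hj) ((H.scale_le j).trans H.le_exp)
      ((mul_le_mul_of_nonneg_left (H.scale_le j) (by positivity)).trans H.small)
      fun i h1 h2 h3 => hW (H.mem_pieceWindow h1 h2 h3)
  have hcellR : ∀ j < K, RegularOn n dR BR pR C₂
      (Set.Icc (1 - a * Real.exp (-(h * j))) (1 - a * Real.exp (-(h * j)) * Real.exp (-h))) :=
    fun j hj => by
      have := (hregR n E' _ BR hBR hn' hdR _ h Set.univ hh (hu0 j) (H.le_scale hj)
        ((H.scale_le j).trans H.le_exp)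
        ((mul_le_mul_of_nonneg_left (H.scale_le j) (by positivity)).trans H.small)
        fun i _ _ _ => Set.mem_univ i).1
      rwa [Set.indicator_univ] at this
  have hcle : ∀ j, ∀ x ∈ Set.Icc (1 - a * Real.exp (-(h * j)))
      (1 - a * Real.exp (-(h * j)) * Real.exp (-h)), x ≤ 1 := fun j x hx => by
    have : 0 ≤ a * Real.exp (-(h * j)) * Real.exp (-h) := by positivity
    linarith [hx.2]
  have hIcc : ∀ j : ℕ, Set.Icc (geomPt a h j) (geomPt a h (j + 1)) =
      Set.Icc (1 - a * Real.exp (-(h * j))) (1 - a * Real.exp (-(h * j)) * Real.exp (-h)) :=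
    fun j => by rw [geomPt_succ, one_sub_geomPt, geomPt]
  have hew : ∀ j, e ∉ pieceWindow n a h j := by
    rintro j ⟨h1, h2, -⟩
    rcases he0 with rfl | rfl
    · simp only [Nat.cast_zero, mul_zero] at h2
      exact absurd (Real.exp_pos _) (not_lt.2 h2)
    · omega
  -- on the other cells the term with coefficient `d e` dominates, there are no roots, and the zero
  -- polynomial is an approximation
  let good : ℕ → Prop := fun j => j < K ∧ j ∉ bad ∧
    NegligibleOn d e B p C h (Set.Icc (geomPt a h j) (geomPt a h (j + 1)))
  refine ⟨fun j => if good j then (pieceWindow n a h j).indicator (Function.update d e 0)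
    else fun _ => 0, ?_, hcard, ?_, ?_, ?_⟩
  · intro j i hi
    by_contra hcon
    apply hi
    split_ifs
    · exact Set.indicator_of_notMem hcon _
    · rfl
  · -- moments come from a polynomial that has at most one root less and does not involve `d e`
    intro ζ hζ j hj
    have h1 := hζ.integral_rootCount_pow_four_le hBR (by linarith) hpR.le (hu0 j)
      (by linarith : 0 < D₂) (hself _ hD₂1) hh (hcellR j hj)
    rw [← Admissible.piece_eq] at h1
    have hpos : piece a h j ⊆ Set.Ioi 0 := by
      rw [Admissible.piece_eq]
      intro x hx
      have h2 := hx.1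
      have h3 := H.scale_le j
      have h4 := H.le_exp
      have h5 : Real.exp (-h) < 1 := Real.exp_zero ▸ Real.exp_lt_exp.2 (by linarith : -h < 0)
      rw [Set.mem_Ioi]
      linarith
    have h2 := integral_natCast_pow_four_le (P := P) (fun ω => hcount (fun i => ζ i ω) (piece a h j)
      Set.ordConnected_Ioc hpos)
      (integrable_pow_of_memLp_four
        (memLp_rootCount hζ.measurable n dR (isSigmaCompact_Ioc _ _) 4) le_rfl)
    have h5 : 1 ≤ h ^ 5 := one_le_pow₀ hh
    have : 0 ≤ 24 ^ 4 * (1 + 120 * D₁) := by positivity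
    have : 0 ≤ 16 * D₁ * Q := by positivity
    calc _ ≤ 8 + 8 * (24 ^ 4 * (1 + 120 * D₂) * h ^ 5) := h2.trans (by gcongr)
      _ ≤ 8 * h ^ 5 + 8 * (24 ^ 4 * (1 + 120 * D₂) * h ^ 5) := by linarith
      _ = (8 + 8 * (24 ^ 4 * (1 + 120 * D₂))) * h ^ 5 := by ring
      _ ≤ D * h ^ 5 := by
          gcongr
          linarith
  · intro ζ hζ j hj
    split_ifs with hgood
    · have h1 := hζ.integral_rootCount_pow_four_le hB (by linarith) hp.le (hu0 j)
        (by linarith : 0 < D₁) (hself _ hD₁1) hh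
        ((hcell j hj _ le_rfl).1.mono_const hB.le (hcle j) (by linarith : C₁ ≤ A))
      rw [← Admissible.piece_eq] at h1
      refine h1.trans ?_
      have : 0 ≤ 8 * (24 ^ 4 * (1 + 120 * D₂)) := by positivity
      have : 0 ≤ 16 * D₁ * Q := by positivity
      gcongr
      linarith
    · simp only [rootCount_weightedPoly_zero]
      simp
      positivity
  · intro ζ hζ j hj hjbad
    set s := Q * Real.exp (-(p / 18 * h)) with hs
    have hs0 : 0 < s := by positivity
    have hs18 : s ^ 18 = (C₁ + 1) * Real.exp (-(h * p)) := by
      rw [hs, mul_pow, hQ, ← Real.rpow_natCast, ← Real.rpow_mul (by linarith), ← Real.exp_nat_mul,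
        show (1 / 18 : ℝ) * ((18 : ℕ) : ℝ) = 1 by norm_num, Real.rpow_one,
        show ((18 : ℕ) : ℝ) * -(p / 18 * h) = -(h * p) by push_cast; ring]
    have hfin : 16 * D₁ * h * s ≤ D * h * Real.exp (-(p / 18 * h)) := by
      have : 0 ≤ 8 * (24 ^ 4 * (1 + 120 * D₂)) := by positivity
      have : 0 ≤ 24 ^ 4 * (1 + 120 * D₁) := by positivity
      calc 16 * D₁ * h * s = 16 * D₁ * Q * h * Real.exp (-(p / 18 * h)) := by rw [hs]; ring
        _ ≤ _ := by gcongr; linarith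
    rcases lt_or_ge 1 s with hs1 | hs1
    · refine measureReal_le_one.trans (le_trans ?_ hfin)
      have : 1 ≤ D₁ * h := one_le_mul_of_one_le_of_one_le hD₁1 hh
      nlinarith
    refine le_trans ?_ hfin
    rw [Admissible.piece_eq]
    have hup := (hcell j hj Set.univ (Set.subset_univ _)).1
    rw [Set.indicator_univ] at hup
    split_ifs with hgood
    · have hneg := hgood.2.2
      rw [hIcc] at hneg
      have htr := hcell j hj _ le_rfl
      refine hζ.measureReal_rootCount_ne_le hB hA1 hp.le (hu0 j) (by linarith : 0 < D₁)
        (hself _ hD₁1) hh hs0 hs1 ?_ (htr.1.mono_const hB.le (hcle j) (by linarith : C₁ ≤ A)) ?_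
      · refine ⟨fun x hx => ?_, fun x hx k hk => ?_⟩
        · refine (hup.lower x hx).trans ?_
          rw [derivVar_update he d]
          have := derivVar_nonneg n (Function.update d e 0) 0 x
          have : 0 ≤ (d e * (e.descFactorial 0 : ℝ) * x ^ (e - 0)) ^ 2 := sq_nonneg _
          gcongr
          · linarith
          · linarith
        · rw [derivVar_update he d, add_mul]
          refine (add_le_add (hup.upper x hx k hk) ((hneg x hx).2 k hk)).trans (le_of_eq ?_)
          rw [hA]; ring
      · intro x hx
        rw [derivVar_update he]
        have hupd : Function.update (fun i => d i -
            (pieceWindow n a h j).indicator (Function.update d e 0) i) e 0 =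
            fun i => Function.update d e 0 i -
              (pieceWindow n a h j).indicator (Function.update d e 0) i := by
          funext i
          by_cases hi : i = e
          · subst hi
            simp [Set.indicator_of_notMem (hew j)]
          · simp [Function.update_of_ne hi]
        rw [hupd, hs18, Set.indicator_of_notMem (hew j), sub_zero]
        refine (add_le_add (htr.2 x hx) ?_).trans (le_of_eq ?_) (b :=
          C₁ * Real.exp (-(h * p)) * (B * (1 - x) ^ (-p)) +
            Real.exp (-(h * p)) * (B * (1 - x) ^ (-p)))
        · simpa using (hneg x hx).1
        · ring
    · have hdom := (hdich j hj hjbad).resolve_left fun hneg => hgood ⟨hj, hjbad, hneg⟩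
      rw [hIcc] at hdom
      obtain ⟨M, hM, hdom⟩ := hdom
      simp only [rootCount_weightedPoly_zero]
      have h1 := hζ.measureReal_rootCount_ne_zero_le he hB hA1 hp.le (hu0 j) (by linarith : 0 < D₁)
        (hself _ hD₁1) hh hs0 hs1 (hup.mono_const hB.le (hcle j) (by linarith : C₁ ≤ A)) hM
        fun x hx => ⟨(hdom x hx).1, (hdom x hx).2.trans ?_⟩
      · refine h1.trans ?_
        gcongr
        norm_num
      · rw [hs18]
        gcongr
        have : 0 < Real.exp (-(h * p)) := Real.exp_pos _
        nlinarith
end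

/-! ### The two orientations -/

lemma Finset.card_le_of_gaps {S : Finset ℕ} {m : ℕ} (h : ∀ i ∈ S, ∀ j ∈ S, j < i + m) :
    S.card ≤ m := by
  rcases S.eq_empty_or_nonempty with rfl | hS
  · simp
  · have : S ⊆ Finset.Ico (S.min' hS) (S.min' hS + m) := fun j hj =>
      Finset.mem_Ico.2 ⟨S.min'_le j hj, h _ (S.min'_mem hS) j hj⟩
    simpa using Finset.card_le_card this

lemma PowerWeights.mono_const {n N₀ E : ℕ} {d : ℕ → ℝ} {B p C C' : ℝ} (hB : 0 ≤ B)
    (h : PowerWeights n d N₀ B p C E) (hC : C ≤ C') : PowerWeights n d N₀ B p C' E where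
  small i h1 h2 := (h.small i h1 h2).trans (by gcongr)
  lower i h1 h2 := (h.lower i h1 h2).trans (by gcongr)
  upper i h1 h2 := (h.upper i h1 h2).trans (by gcongr)
  tail i h1 h2 := (h.tail i h1 h2).trans (by gcongr)

lemma rpow_two_mul_le {x y ρ : ℝ} (hx : 0 < x) (hy : 0 < y) (hxy : x ≤ 2 * y) (hyx : y ≤ 2 * x) :
    x ^ (2 * ρ) ≤ 4 ^ |ρ| * y ^ (2 * ρ) := by
  have h4 : (4 : ℝ) ^ |ρ| = 2 ^ (2 * |ρ|) := by
    rw [show (4 : ℝ) = 2 ^ (2 : ℝ) by norm_num, ← Real.rpow_mul (by norm_num)]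
  rw [h4]
  rcases le_total 0 ρ with h | h
  · rw [abs_of_nonneg h, ← Real.mul_rpow (by norm_num) hy.le]
    exact Real.rpow_le_rpow hx.le hxy (by linarith)
  · rw [abs_of_nonpos h]
    have h1 : (2 * x) ^ (2 * ρ) ≤ y ^ (2 * ρ) := Real.rpow_le_rpow_of_nonpos hy hyx (by linarith)
    rw [Real.mul_rpow (by norm_num) hx.le] at h1
    calc x ^ (2 * ρ) = 2 ^ (2 * -ρ) * (2 ^ (2 * ρ) * x ^ (2 * ρ)) := by
          rw [← mul_assoc, ← Real.rpow_add (by norm_num)]; ring_nf; simp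
      _ ≤ _ := by gcongr

lemma rpow_le_pow_ceil {n m : ℕ} (hm : 1 ≤ m) (hmn : m ≤ n) {q : ℝ} {E : ℕ} (hq : |q| ≤ E) :
    (m : ℝ) ^ q ≤ (n : ℝ) ^ E := by
  have hm' : (1 : ℝ) ≤ m := by exact_mod_cast hm
  have hmn' : (m : ℝ) ≤ n := by exact_mod_cast hmn
  calc (m : ℝ) ^ q ≤ (m : ℝ) ^ (E : ℝ) :=
        Real.rpow_le_rpow_of_exponent_le hm' ((le_abs_self q).trans hq)
    _ = (m : ℝ) ^ E := Real.rpow_natCast _ _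
    _ ≤ _ := by gcongr

section Growth

variable {N₀ : ℕ} {τ₁ τ₂ ρ : ℝ} {coeff : ℕ → ℕ → ℝ}

lemma PolynomialGrowth.sq_le (h : PolynomialGrowth N₀ τ₁ τ₂ ρ coeff) {n i : ℕ} (h1 : i ≤ n)
    (h2 : i < N₀) : coeff n i ^ 2 ≤ τ₂ ^ 2 :=
  sq_le_sq' (abs_le.1 ((h n i).1 h1 h2)).1 (abs_le.1 ((h n i).1 h1 h2)).2

lemma PolynomialGrowth.le_sq (h : PolynomialGrowth N₀ τ₁ τ₂ ρ coeff) (hτ₁ : 0 < τ₁) {n i : ℕ}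
    (h1 : N₀ ≤ i) (h2 : i < n) : (i : ℝ) ^ (2 * ρ) ≤ (τ₁ ^ 2)⁻¹ * coeff n i ^ 2 := by
  rw [inv_mul_eq_div, le_div_iff₀ (by positivity), mul_comm]
  have h3 := ((h n i).2 h1 h2).1
  have e : (i : ℝ) ^ (2 * ρ) = ((i : ℝ) ^ ρ) ^ 2 := by
    rw [mul_comm, Real.rpow_mul (Nat.cast_nonneg _)]; norm_num
  rw [e, ← mul_pow, ← sq_abs (coeff n i)]
  gcongr

lemma PolynomialGrowth.sq_le' (h : PolynomialGrowth N₀ τ₁ τ₂ ρ coeff) {n i : ℕ}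
    (h1 : N₀ ≤ i) (h2 : i < n) : coeff n i ^ 2 ≤ τ₂ ^ 2 * (i : ℝ) ^ (2 * ρ) := by
  have h3 := ((h n i).2 h1 h2).2
  have e : (i : ℝ) ^ (2 * ρ) = ((i : ℝ) ^ ρ) ^ 2 := by
    rw [mul_comm, Real.rpow_mul (Nat.cast_nonneg _)]; norm_num
  rw [e, ← mul_pow, ← sq_abs (coeff n i)]
  gcongr

/-- Near `1` the weights are of order `i ^ ρ`, and the variance at `1 - v` is of order
`v ^ (-(2 ρ + 1))`. The leading coefficient, on which there is no constraint, is removed. -/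
lemma PolynomialGrowth.powerWeights (h : PolynomialGrowth N₀ τ₁ τ₂ ρ coeff) (hτ₁ : 0 < τ₁)
    (hN₀ : 0 < N₀) {E : ℕ} (hE : |2 * ρ| ≤ E) {n : ℕ} (hn : 0 < n) :
    PowerWeights n (Function.update (coeff n) n 0) N₀ 1 (2 * ρ + 1) (τ₂ ^ 2 + (τ₁ ^ 2)⁻¹) E := by
  have hn' : (1 : ℝ) ≤ n := by exact_mod_cast hn
  have hinv : 0 ≤ (τ₁ ^ 2)⁻¹ := by positivity
  refine ⟨fun i h1 h2 => ?_, fun i h1 h2 => ?_, fun i h1 h2 => ?_, fun i h1 h2 => ?_⟩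
  · by_cases hi : i = n
    · subst hi
      rw [Function.update_self, zero_pow two_ne_zero]
      positivity
    · rw [Function.update_of_ne hi]
      have := h.sq_le h2 h1
      linarith
  · rw [Function.update_of_ne (by omega), add_sub_cancel_right, one_mul]
    refine (h.le_sq hτ₁ h1 (by omega : i < n)).trans ?_
    gcongr
    linarith [sq_nonneg τ₂]
  · rw [Function.update_of_ne (by omega), add_sub_cancel_right, mul_one]
    refine (h.sq_le' h1 (by omega : i < n)).trans ?_
    gcongr
    linarith
  · by_cases hi : i = n
    · subst hi
      rw [Function.update_self, zero_pow two_ne_zero]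
      positivity
    · rw [Function.update_of_ne hi, mul_one]
      have hpow : (1 : ℝ) ≤ (n : ℝ) ^ E := one_le_pow₀ hn'
      rcases lt_or_ge i N₀ with h3 | h3
      · calc _ ≤ τ₂ ^ 2 * 1 := by rw [mul_one]; exact h.sq_le h1 h3
          _ ≤ _ := by gcongr; linarith
      · refine (h.sq_le' h3 (by omega : i < n)).trans ?_
        have := rpow_le_pow_ceil (by omega : 1 ≤ i) h1 hE
        gcongr
        linarith

/-- For `i ≤ n / 2` the factor `n - i` is of order `n`, which only changes the normalization, and it
vanishes at the unconstrained index `n`. -/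
lemma PowerWeights.sub_index_mul {n N₀ E : ℕ} {d : ℕ → ℝ} {p C : ℝ} (hC : 0 ≤ C)
    (hn : 0 < n) (hN₀ : 0 < N₀)
    (h : PowerWeights n (Function.update d n 0) N₀ 1 p C E) :
    PowerWeights n (fun i => ((n : ℝ) - i) * d i) N₀ ((n : ℝ) ^ 2) p (4 * C) E := by
  have hsq : ∀ i ≤ n, ((n : ℝ) - i) ^ 2 ≤ (n : ℝ) ^ 2 := fun i hi => by
    have : (i : ℝ) ≤ n := by exact_mod_cast hi
    have : (0 : ℝ) ≤ i := Nat.cast_nonneg i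
    exact sq_le_sq' (by linarith) (by linarith)
  have hlow : ∀ i, 2 * i ≤ n → (n : ℝ) ^ 2 ≤ 4 * ((n : ℝ) - i) ^ 2 := fun i hi => by
    have : 2 * (i : ℝ) ≤ n := by exact_mod_cast hi
    have : (0 : ℝ) ≤ i := Nat.cast_nonneg i
    nlinarith
  have key : ∀ i ≤ n, ∀ c : ℝ, 0 ≤ c → Function.update d n 0 i ^ 2 ≤ c →
      (((n : ℝ) - i) * d i) ^ 2 ≤ (n : ℝ) ^ 2 * c := fun i hi c hc hic => by
    by_cases hin : i = n
    · subst hin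
      rw [sub_self, zero_mul, zero_pow two_ne_zero]
      positivity
    · rw [Function.update_of_ne hin] at hic
      rw [mul_pow]
      exact mul_le_mul (hsq i hi) hic (sq_nonneg _) (by positivity)
  refine ⟨fun i h1 h2 => ?_, fun i h1 h2 => ?_, fun i h1 h2 => ?_, fun i h1 h2 => ?_⟩
  · refine (key i h2 _ (by positivity) (h.small i h1 h2)).trans ?_
    nlinarith [mul_nonneg hC (sq_nonneg (n : ℝ))]
  · have h3 := h.lower i h1 h2
    rw [Function.update_of_ne (by omega), one_mul] at h3
    calc (n : ℝ) ^ 2 * (i : ℝ) ^ (p - 1) ≤ (4 * ((n : ℝ) - i) ^ 2) * (C * d i ^ 2) :=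
          mul_le_mul (hlow i h2) h3 (by positivity) (by positivity)
      _ = _ := by ring
  · refine (key i (by omega) _ (by positivity) (h.upper i h1 h2)).trans ?_
    have : 0 ≤ (n : ℝ) ^ 2 * (C * 1 * (i : ℝ) ^ (p - 1)) := by positivity
    linarith
  · refine (key i h1 _ (by positivity) (h.tail i h1 h2)).trans ?_
    have : 0 ≤ (n : ℝ) ^ 2 * (C * 1 * (n : ℝ) ^ E) := by positivity
    linarith

open Polynomial in
/-- The last half of the coefficients is of order `n ^ ρ`. The reversed weights are thus of constant
order, which is the exponent `p = 1`; their constant coefficient is unconstrained and removed. -/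
lemma PolynomialGrowth.powerWeights_reversed (h : PolynomialGrowth N₀ τ₁ τ₂ ρ coeff)
    (hτ₁ : 0 < τ₁) (hN₀ : 0 < N₀) {E : ℕ} (hE : |2 * ρ| + |2 * ρ| ≤ E) {n : ℕ} (hn : 2 * N₀ ≤ n) :
    PowerWeights n (Function.update (fun i => coeff n (revAt n i)) 0 0) 1 ((n : ℝ) ^ (2 * ρ)) 1
      (4 ^ |ρ| * (τ₂ ^ 2 + (τ₁ ^ 2)⁻¹)) E := by
  have hn1 : 1 ≤ n := by omega
  have hn' : (1 : ℝ) ≤ n := by exact_mod_cast hn1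
  have hinv : 0 ≤ (τ₁ ^ 2)⁻¹ := by positivity
  have h4 : (1 : ℝ) ≤ 4 ^ |ρ| := Real.one_le_rpow (by norm_num) (abs_nonneg _)
  have hmid : ∀ i, 1 ≤ i → 2 * i ≤ n → revAt n i = n - i ∧ N₀ ≤ n - i ∧ n - i < n ∧
      (n : ℝ) ≤ 2 * ((n - i : ℕ) : ℝ) ∧ ((n - i : ℕ) : ℝ) ≤ 2 * n ∧ (0 : ℝ) < ((n - i : ℕ) : ℝ) :=
    fun i h1 h2 => ⟨revAt_le (by omega), by omega, by omega, by exact_mod_cast (by omega),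
      by exact_mod_cast (by omega), by exact_mod_cast (by omega)⟩
  refine ⟨fun i h1 h2 => ?_, fun i h1 h2 => ?_, fun i h1 h2 => ?_, fun i h1 h2 => ?_⟩
  · obtain rfl : i = 0 := by omega
    rw [Function.update_self, zero_pow two_ne_zero]
    positivity
  · obtain ⟨e1, e2, e3, e4, e5, e6⟩ := hmid i h1 h2
    rw [Function.update_of_ne (by omega), sub_self, Real.rpow_zero, mul_one, e1]
    calc (n : ℝ) ^ (2 * ρ) ≤ 4 ^ |ρ| * ((n - i : ℕ) : ℝ) ^ (2 * ρ) :=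
          rpow_two_mul_le (by linarith) e6 e4 e5
      _ ≤ 4 ^ |ρ| * ((τ₁ ^ 2)⁻¹ * coeff n (n - i) ^ 2) := by
          gcongr
          exact h.le_sq hτ₁ e2 e3
      _ ≤ 4 ^ |ρ| * ((τ₂ ^ 2 + (τ₁ ^ 2)⁻¹) * coeff n (n - i) ^ 2) := by
          gcongr
          linarith [sq_nonneg τ₂]
      _ = _ := by ring
  · obtain ⟨e1, e2, e3, e4, e5, e6⟩ := hmid i h1 h2
    rw [Function.update_of_ne (by omega), sub_self, Real.rpow_zero, mul_one, e1]
    calc coeff n (n - i) ^ 2 ≤ τ₂ ^ 2 * ((n - i : ℕ) : ℝ) ^ (2 * ρ) := h.sq_le' e2 e3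
      _ ≤ τ₂ ^ 2 * (4 ^ |ρ| * (n : ℝ) ^ (2 * ρ)) := by
          gcongr
          exact rpow_two_mul_le e6 (by linarith) e5 e4
      _ ≤ (τ₂ ^ 2 + (τ₁ ^ 2)⁻¹) * (4 ^ |ρ| * (n : ℝ) ^ (2 * ρ)) := by
          gcongr
          linarith
      _ = _ := by ring
  · rw [Function.update_of_ne (by omega), revAt_le h1]
    -- the factor `n ^ E` compensates for `n ^ (2 ρ)` if `ρ` is negative
    have hE' : ∀ m : ℕ, 1 ≤ m → m ≤ n → (m : ℝ) ^ (2 * ρ) ≤ (n : ℝ) ^ (2 * ρ) * (n : ℝ) ^ E := by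
      intro m hm hmn
      have hm' : (1 : ℝ) ≤ m := by exact_mod_cast hm
      have hmn' : (m : ℝ) ≤ n := by exact_mod_cast hmn
      rw [← Real.rpow_natCast, ← Real.rpow_add (by linarith)]
      calc (m : ℝ) ^ (2 * ρ) ≤ (m : ℝ) ^ |2 * ρ| :=
            Real.rpow_le_rpow_of_exponent_le hm' (le_abs_self _)
        _ ≤ (n : ℝ) ^ |2 * ρ| := Real.rpow_le_rpow (by linarith) hmn' (abs_nonneg _)
        _ ≤ _ := Real.rpow_le_rpow_of_exponent_le hn' (by linarith [neg_abs_le (2 * ρ)])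
    have h1E := hE' 1 le_rfl hn1
    rw [Nat.cast_one, Real.one_rpow] at h1E
    have hτ : τ₂ ^ 2 ≤ 4 ^ |ρ| * (τ₂ ^ 2 + (τ₁ ^ 2)⁻¹) := by
      calc τ₂ ^ 2 ≤ 1 * (τ₂ ^ 2 + (τ₁ ^ 2)⁻¹) := by linarith
        _ ≤ _ := by gcongr
    rw [mul_assoc _ ((n : ℝ) ^ (2 * ρ))]
    rcases lt_or_ge (n - i) N₀ with h3 | h3
    · calc _ ≤ τ₂ ^ 2 * 1 := by rw [mul_one]; exact h.sq_le (by omega) h3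
        _ ≤ _ := by gcongr
    · refine (h.sq_le' h3 (by omega : n - i < n)).trans ?_
      have := hE' (n - i) (by omega) (by omega)
      gcongr

/-- The factor `i`, which vanishes at the unconstrained index `0`, raises the exponent by two. -/
lemma PowerWeights.index_mul {n E : ℕ} {d : ℕ → ℝ} {B C : ℝ} (hC : 0 ≤ C) (hB : 0 ≤ B)
    (h : PowerWeights n (Function.update d 0 0) 1 B 1 C E) :
    PowerWeights n (fun i => (i : ℝ) * d i) 1 B 3 C (E + 2) := by
  have e : ∀ i : ℕ, (i : ℝ) ^ ((3 : ℝ) - 1) = (i : ℝ) ^ 2 := fun i => by norm_num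
  refine ⟨fun i h1 h2 => ?_, fun i h1 h2 => ?_, fun i h1 h2 => ?_, fun i h1 h2 => ?_⟩
  · obtain rfl : i = 0 := by omega
    simp only [Nat.cast_zero, zero_mul, ne_eq, OfNat.ofNat_ne_zero, not_false_eq_true, zero_pow]
    positivity
  · have h3 := h.lower i h1 h2
    rw [Function.update_of_ne (by omega), sub_self, Real.rpow_zero, mul_one] at h3
    rw [e]
    calc B * (i : ℝ) ^ 2 ≤ (C * d i ^ 2) * (i : ℝ) ^ 2 := by gcongr
      _ = _ := by ring
  · have h3 := h.upper i h1 h2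
    rw [Function.update_of_ne (by omega), sub_self, Real.rpow_zero, mul_one] at h3
    rw [e, mul_pow, mul_comm]
    gcongr
  · have h3 := h.tail i h1 h2
    rw [Function.update_of_ne (by omega)] at h3
    have : (i : ℝ) ≤ n := by exact_mod_cast h1
    calc ((i : ℝ) * d i) ^ 2 = d i ^ 2 * (i : ℝ) ^ 2 := by ring
      _ ≤ (C * B * (n : ℝ) ^ E) * (n : ℝ) ^ 2 := by gcongr
      _ = _ := by ring

end Growth

/-! ### The unconstrained coefficient -/

namespace Admissible

variable {n N₀ K : ℕ} {a h : ℝ}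

lemma mono (H : Admissible n N₀ a h K) {N₁ : ℕ} (hN : N₁ ≤ N₀) : Admissible n N₁ a h K := by
  refine ⟨H.one_le, H.pos, H.le_end, H.le_exp, le_trans ?_ H.small⟩
  have := H.pos
  have : (N₁ : ℝ) ≤ N₀ := by exact_mod_cast hN
  gcongr

lemma inv_le_scale (H : Admissible n N₀ a h K) {E : ℕ} (hn : LogLarge E n) {j : ℕ} (hj : j < K) :
    (n : ℝ)⁻¹ ≤ a * Real.exp (-(h * j)) * Real.exp (-h) := by
  refine le_trans ?_ (H.le_scale hj)
  have h1 : 2 * ((E : ℝ) + 2) ≤ Real.log n := hn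
  have h2 : (0 : ℝ) ≤ E := Nat.cast_nonneg E
  rw [inv_eq_one_div]
  gcongr
  nlinarith

lemma exp_le (H : Admissible n N₀ a h K) {E : ℕ} (hn : LogLarge E n) {j : ℕ} (hj : j < K) :
    Real.exp h ≤ n := by
  have h1 := H.inv_le_scale hn hj
  have hn0 : (0 : ℝ) < n := by exact_mod_cast lt_of_lt_of_le (by norm_num) hn.two_le
  have h2 : a * Real.exp (-(h * j)) * Real.exp (-h) ≤ Real.exp (-h) := by
    refine mul_le_of_le_one_left (Real.exp_pos _).le ((H.scale_le j).trans (H.le_exp.trans ?_))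
    exact Real.exp_le_one_iff.2 (by linarith [H.one_le])
  rw [Real.exp_neg h] at h1 h2
  exact (inv_le_inv₀ hn0 (Real.exp_pos _)).1 (h1.trans h2)

lemma mem_cell (H : Admissible n N₀ a h K) {j : ℕ} {x : ℝ}
    (hx : x ∈ Set.Icc (geomPt a h j) (geomPt a h (j + 1))) :
    a * Real.exp (-(h * j)) * Real.exp (-h) ≤ 1 - x ∧ 1 - x ≤ a * Real.exp (-(h * j)) ∧
      0 < 1 - x ∧ 1 / 2 ≤ x := by
  rw [geomPt_succ, one_sub_geomPt, geomPt] at hx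
  obtain ⟨h1, h2⟩ := _root_.mem_cell hx
  have ha := H.pos
  have h3 : Real.exp (-h) ≤ 1 / 2 := by
    have := Real.add_one_le_exp h
    have := H.one_le
    rw [Real.exp_neg, one_div]
    exact inv_anti₀ (by norm_num) (by linarith)
  refine ⟨h1, h2, lt_of_lt_of_le (by positivity) h1, ?_⟩
  linarith [H.scale_le j, H.le_exp]

/-- Each piece multiplies the `2 n`-th power by more than any fixed power of `n`. -/
lemma pow_mul_le (H : Admissible n N₀ a h K) {m j : ℕ} (hn : LogLarge (2 * m) n) (hj : j < K) :
    geomPt a h j ^ (2 * n) * (n : ℝ) ^ (2 * m) ≤ geomPt a h (j + 1) ^ (2 * n) := by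
  have hn0 : (0 : ℝ) < n := by exact_mod_cast lt_of_lt_of_le (by norm_num) hn.two_le
  have ha := H.pos
  set u := a * Real.exp (-(h * j)) with hu
  have hu0 : 0 < u := by positivity
  have hx : geomPt a h j = 1 - u := rfl
  have hx1 : geomPt a h (j + 1) = 1 - u * Real.exp (-h) := by rw [geomPt_succ, hx]; ring
  have he : Real.exp (-h) ≤ 1 / 2 := by
    have := Real.add_one_le_exp h
    have := H.one_le
    rw [Real.exp_neg, one_div]
    exact inv_anti₀ (by norm_num) (by linarith)
  have hu1 : u ≤ 1 / 2 := (H.scale_le j).trans (H.le_exp.trans he)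
  have hlu : Real.log n ^ 2 ≤ u * n := by
    have := (H.le_scale hj).trans (mul_le_of_le_one_right hu0.le (by linarith))
    rwa [div_le_iff₀ hn0] at this
  have h1 : geomPt a h j * Real.exp (u / 4) ≤ geomPt a h (j + 1) := by
    have h2 : Real.exp (u / 4) * (1 - u / 4) ≤ 1 := by
      have h3 : 1 - u / 4 ≤ Real.exp (-(u / 4)) := by linarith [Real.add_one_le_exp (-(u / 4))]
      calc _ ≤ Real.exp (u / 4) * Real.exp (-(u / 4)) := by gcongr
        _ = 1 := by rw [← Real.exp_add]; simp
    have h4 : 1 - u / 2 ≤ geomPt a h (j + 1) := by rw [hx1]; nlinarith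
    refine le_trans ?_ h4
    have h5 : 1 - u ≤ (1 - u / 4) * (1 - u / 2) := by nlinarith
    rw [hx]
    calc (1 - u) * Real.exp (u / 4) ≤ (1 - u / 4) * (1 - u / 2) * Real.exp (u / 4) := by gcongr
      _ = (Real.exp (u / 4) * (1 - u / 4)) * (1 - u / 2) := by ring
      _ ≤ 1 * (1 - u / 2) := by gcongr; linarith
      _ = _ := one_mul _
  have hlog : 2 * (((2 * m : ℕ) : ℝ) + 2) ≤ Real.log n := hn
  have h6 : (n : ℝ) ^ (2 * m) ≤ Real.exp (u / 4) ^ (2 * n) := by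
    rw [← Real.exp_nat_mul, ← Real.rpow_natCast, Real.rpow_def_of_pos hn0]
    refine Real.exp_le_exp.2 ?_
    push_cast at hlog ⊢
    have : (0 : ℝ) ≤ m := Nat.cast_nonneg m
    nlinarith
  calc _ ≤ geomPt a h j ^ (2 * n) * Real.exp (u / 4) ^ (2 * n) := by
        gcongr
        rw [hx]; exact pow_nonneg (by linarith) _
    _ = (geomPt a h j * Real.exp (u / 4)) ^ (2 * n) := by rw [mul_pow]
    _ ≤ _ := by
        gcongr
        rw [hx]
        exact mul_nonneg (by linarith) (Real.exp_pos _).le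

lemma rpow_le (H : Admissible n N₀ a h K) {E j : ℕ} (hn : LogLarge E n) (hj : j < K) {p : ℝ}
    (hp : 0 ≤ p) {x : ℝ} (hx : x ∈ Set.Icc (geomPt a h j) (geomPt a h (j + 1))) :
    (1 - x) ^ (-p) ≤ (n : ℝ) ^ p := by
  obtain ⟨h1, -, h3, -⟩ := H.mem_cell hx
  have hn0 : (0 : ℝ) < n := by exact_mod_cast lt_of_lt_of_le (by norm_num) hn.two_le
  calc (1 - x) ^ (-p) ≤ ((n : ℝ)⁻¹) ^ (-p) :=
        Real.rpow_le_rpow_of_nonpos (by positivity) ((H.inv_le_scale hn hj).trans h1) (by linarith)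
    _ = _ := by rw [Real.inv_rpow hn0.le, Real.rpow_neg hn0.le, inv_inv]

lemma exp_mul_le (H : Admissible n N₀ a h K) {E j : ℕ} (hn : LogLarge E n) (hj : j < K) {p : ℝ}
    (hp : 0 ≤ p) : Real.exp (h * p) ≤ (n : ℝ) ^ p := by
  rw [Real.exp_mul]
  exact Real.rpow_le_rpow (Real.exp_pos _).le (H.exp_le hn hj) hp

/-- The leading coefficient is negligible before, and dominant after, at most three exceptional
pieces. -/
lemma exists_bad_leading (H : Admissible n N₀ a h K) {m : ℕ} (hn : LogLarge (2 * m) n)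
    {p C : ℝ} (hp : 0 ≤ p) (hm : 24 + 2 * p ≤ m) (hC : 4 ^ 12 ≤ C) (d : ℕ → ℝ) :
    ∃ bad : Finset ℕ, bad.card ≤ 3 ∧ ∀ j < K, j ∉ bad →
      NegligibleOn d n 1 p C h (Set.Icc (geomPt a h j) (geomPt a h (j + 1))) ∨
      DominantOn d n 1 p h (Set.Icc (geomPt a h j) (geomPt a h (j + 1))) := by
  classical
  have hn2 : (2 : ℝ) ≤ n := by exact_mod_cast hn.two_le
  have hn0 : (0 : ℝ) < n := by linarith
  have hn1 : (1 : ℝ) ≤ n := by linarith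
  have ha := H.pos
  have hgp : ∀ j, 0 < geomPt a h j := fun j => by
    have h1 : Real.exp (-h) < 1 :=
      Real.exp_zero ▸ Real.exp_lt_exp.2 (by linarith [H.one_le] : -h < 0)
    have := H.scale_le j
    have := H.le_exp
    unfold geomPt
    linarith
  have hpm : (n : ℝ) ^ p * (n : ℝ) ^ p ≤ (n : ℝ) ^ m := by
    rw [← Real.rpow_add hn0, ← Real.rpow_natCast]
    exact Real.rpow_le_rpow_of_exponent_le hn1 (by linarith)
  have h24 : (n : ℝ) ^ 24 ≤ (n : ℝ) ^ m :=
    pow_le_pow_right₀ hn1 (by exact_mod_cast (by linarith : (24 : ℝ) ≤ m))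
  have hpm1 : (n : ℝ) ^ p ≤ (n : ℝ) ^ m := by
    rw [← Real.rpow_natCast]
    exact Real.rpow_le_rpow_of_exponent_le hn1 (by linarith)
  refine ⟨{j ∈ Finset.range K | 1 < d n ^ 2 * geomPt a h (j + 1) ^ (2 * n) * (n : ℝ) ^ m ∧
    d n ^ 2 * geomPt a h j ^ (2 * n) < (n : ℝ) ^ m}, Finset.card_le_of_gaps ?_, ?_⟩
  · -- an intermediate piece between two exceptional ones would multiply `x ^ (2 n)` by `n ^ (2 m)`
    intro i hi j hj
    rw [Finset.mem_filter, Finset.mem_range] at hi hj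
    by_contra hcon
    have hij : i + 2 ≤ j := by omega
    have h1 := H.pow_mul_le hn (by omega : i + 1 < K)
    have h2 : geomPt a h (i + 1 + 1) ≤ geomPt a h j :=
      geomPt_mono ha.le (by linarith [H.one_le]) (by omega)
    have h3 : geomPt a h (i + 1 + 1) ^ (2 * n) ≤ geomPt a h j ^ (2 * n) :=
      pow_le_pow_left₀ (hgp _).le h2 _
    have h4 := (mul_le_mul_of_nonneg_left (h1.trans h3) (sq_nonneg (d n))).trans_lt hj.2.2
    have h5 : (n : ℝ) ^ (2 * m) = (n : ℝ) ^ m * (n : ℝ) ^ m := by rw [two_mul, pow_add]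
    rw [h5] at h4
    have h6 : 0 < (n : ℝ) ^ m := by positivity
    have h7 : (n : ℝ) ^ m ≤ d n ^ 2 * geomPt a h (i + 1) ^ (2 * n) * (n : ℝ) ^ m * (n : ℝ) ^ m :=
      le_mul_of_one_le_left h6.le hi.2.1.le
    linarith
  · intro j hj hbad
    rw [Finset.mem_filter, Finset.mem_range, not_and, not_and_or, not_lt, not_lt] at hbad
    rcases hbad hj with h1 | h1
    · left
      intro x hx
      obtain ⟨h2, h3, h4, h5⟩ := H.mem_cell hx
      have hx0 : 0 < x := by linarith
      have hv1 : 1 ≤ (1 - x) ^ (-p) :=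
        Real.one_le_rpow_of_pos_of_le_one_of_nonpos h4 (by linarith) (by linarith)
      have h6 : (d n * x ^ n) ^ 2 * (n : ℝ) ^ m ≤ 1 := by
        refine le_trans ?_ h1
        rw [mul_pow, ← pow_mul, mul_comm n 2]
        have := hx.2
        gcongr
      refine ⟨?_, fun k hk => ?_⟩
      · rw [one_mul]
        calc (d n * x ^ n) ^ 2 = (d n * x ^ n) ^ 2 * Real.exp (h * p) * Real.exp (-(h * p)) := by
              rw [mul_assoc, ← Real.exp_add]; simp
          _ ≤ (d n * x ^ n) ^ 2 * (n : ℝ) ^ m * Real.exp (-(h * p)) := by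
              gcongr
              exact (H.exp_mul_le hn hj hp).trans hpm1
          _ ≤ 1 * Real.exp (-(h * p)) := by gcongr
          _ ≤ Real.exp (-(h * p)) * (1 - x) ^ (-p) := by
              rw [one_mul]; exact le_mul_of_one_le_right (Real.exp_pos _).le hv1
      · rw [one_mul]
        have hC1 : C * 1 ≤ C * (1 - x) ^ (-p) := by
          have : 0 ≤ C := le_trans (by norm_num) hC
          gcongr
        refine le_trans ?_ hC1
        rw [mul_one]
        rcases lt_or_ge n k with hnk | hnk
        · rw [Nat.descFactorial_eq_zero_iff_lt.2 hnk]
          simp only [Nat.cast_zero, mul_zero, zero_mul, ne_eq, OfNat.ofNat_ne_zero,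
            not_false_eq_true, zero_pow]
          exact le_trans (by norm_num) hC
        · have e1 : (n.descFactorial k : ℝ) ≤ (n : ℝ) ^ k := by
            exact_mod_cast Nat.descFactorial_le_pow n k
          have e2 : x ^ (n - k) ≤ 2 ^ k * x ^ n := by
            have e3 : x ^ n = x ^ (n - k) * x ^ k := by rw [← pow_add]; congr 1; omega
            have e4 : 1 ≤ 2 ^ k * x ^ k := by
              rw [← mul_pow]; exact one_le_pow₀ (by linarith)
            rw [e3]
            calc x ^ (n - k) = x ^ (n - k) * 1 := by ring
              _ ≤ x ^ (n - k) * (2 ^ k * x ^ k) := by gcongr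
              _ = _ := by ring
          have e5 : (1 - x) ^ (2 * k) ≤ 1 := pow_le_one₀ h4.le (by linarith)
          have e6 : (n : ℝ) ^ (2 * k) ≤ (n : ℝ) ^ m :=
            (pow_le_pow_right₀ hn1 (by omega)).trans h24
          have e7 : (2 : ℝ) ^ (2 * k) ≤ 4 ^ 12 := by
            rw [pow_mul]
            norm_num
            exact (pow_le_pow_right₀ (by norm_num) hk).trans (by norm_num)
          calc (d n * (n.descFactorial k : ℝ) * x ^ (n - k)) ^ 2 * (1 - x) ^ (2 * k)
              ≤ (d n * (n.descFactorial k : ℝ) * x ^ (n - k)) ^ 2 * 1 := by gcongr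
            _ = d n ^ 2 * (n.descFactorial k : ℝ) ^ 2 * (x ^ (n - k)) ^ 2 := by ring
            _ ≤ d n ^ 2 * ((n : ℝ) ^ k) ^ 2 * (2 ^ k * x ^ n) ^ 2 := by gcongr
            _ = (d n * x ^ n) ^ 2 * (n : ℝ) ^ (2 * k) * 2 ^ (2 * k) := by ring
            _ ≤ (d n * x ^ n) ^ 2 * (n : ℝ) ^ m * 4 ^ 12 := by gcongr
            _ ≤ 1 * 4 ^ 12 := by gcongr
            _ ≤ C := by linarith
    · right
      refine ⟨d n ^ 2 * geomPt a h j ^ (2 * n), lt_of_lt_of_le (by positivity) h1, fun x hx => ?_⟩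
      constructor
      · rw [mul_pow, ← pow_mul, mul_comm n 2]
        have := hx.1
        have := (hgp j).le
        gcongr
      · rw [one_mul]
        calc (1 - x) ^ (-p) ≤ (n : ℝ) ^ p := H.rpow_le hn hj hp hx
          _ = Real.exp (-(h * p)) * (Real.exp (h * p) * (n : ℝ) ^ p) := by
              rw [← mul_assoc, ← Real.exp_add]; simp
          _ ≤ Real.exp (-(h * p)) * ((n : ℝ) ^ p * (n : ℝ) ^ p) := by
              gcongr
              exact H.exp_mul_le hn hj hp
          _ ≤ _ := mul_le_mul_of_nonneg_left (hpm.trans h1) (Real.exp_pos _).le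

/-- The constant coefficient is dominant before, and negligible after, at most three
exceptional pieces. -/
lemma exists_bad_constant (H : Admissible n N₀ a h K) {B C : ℝ} (hB : 0 < B) (hC : 1 ≤ C)
    (d : ℕ → ℝ) : ∃ bad : Finset ℕ, bad.card ≤ 3 ∧ ∀ j < K, j ∉ bad →
      NegligibleOn d 0 B 1 C h (Set.Icc (geomPt a h j) (geomPt a h (j + 1))) ∨
      DominantOn d 0 B 1 h (Set.Icc (geomPt a h j) (geomPt a h (j + 1))) := by
  classical
  have ha := H.pos
  have hh := H.one_le
  set u : ℕ → ℝ := fun j => a * Real.exp (-(h * j)) with hu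
  have hu0 : ∀ j, 0 < u j := fun j => by positivity
  refine ⟨{j ∈ Finset.range K | Real.exp (-h) * B < d 0 ^ 2 * u j ∧
    d 0 ^ 2 * u j * Real.exp (-h) < Real.exp h * B}, Finset.card_le_of_gaps ?_, ?_⟩
  · -- three pieces further the scale has decreased by the factor `e ^ (-3 h)`
    intro i hi j hj
    rw [Finset.mem_filter, Finset.mem_range] at hi hj
    by_contra hcon
    have hij : ((i : ℝ) + 3) ≤ j := by exact_mod_cast not_lt.1 hcon
    have h1 : u j ≤ u i * Real.exp (-(3 * h)) := by
      simp only [hu]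
      rw [mul_assoc, ← Real.exp_add]
      gcongr
      nlinarith
    have h2 : Real.exp (-h) * B < d 0 ^ 2 * (u i * Real.exp (-(3 * h))) :=
      hj.2.1.trans_le (by gcongr)
    have h3 : d 0 ^ 2 * (u i * Real.exp (-(3 * h))) =
        (d 0 ^ 2 * u i * Real.exp (-h)) * Real.exp (-(2 * h)) := by
      rw [show -(3 * h) = -h + -(2 * h) by ring, Real.exp_add]; ring
    have h4 : (d 0 ^ 2 * u i * Real.exp (-h)) * Real.exp (-(2 * h)) ≤
        Real.exp h * B * Real.exp (-(2 * h)) :=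
      mul_le_mul_of_nonneg_right hi.2.2.le (Real.exp_pos _).le
    have h5 : Real.exp h * B * Real.exp (-(2 * h)) = Real.exp (-h) * B := by
      rw [mul_right_comm, ← Real.exp_add]; ring_nf
    linarith
  · intro j hj hbad
    rw [Finset.mem_filter, Finset.mem_range, not_and, not_and_or, not_lt, not_lt] at hbad
    have hrp : ∀ v : ℝ, v ^ (-(1 : ℝ)) = v⁻¹ := fun v => Real.rpow_neg_one v
    rcases hbad hj with h1 | h1
    · left
      intro x hx
      obtain ⟨h2, h3, h4, h5⟩ := H.mem_cell hx
      have h6 : d 0 ^ 2 ≤ Real.exp (-h) * (B * (1 - x)⁻¹) := by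
        calc d 0 ^ 2 = d 0 ^ 2 * (1 - x) * (1 - x)⁻¹ := by
              rw [mul_assoc, mul_inv_cancel₀ h4.ne', mul_one]
          _ ≤ d 0 ^ 2 * u j * (1 - x)⁻¹ := by gcongr
          _ ≤ Real.exp (-h) * B * (1 - x)⁻¹ := by gcongr
          _ = _ := by ring
      rw [hrp]
      refine ⟨by simpa using h6, fun k _ => ?_⟩
      rcases Nat.eq_zero_or_pos k with rfl | hk
      · simp only [Nat.descFactorial_zero, Nat.cast_one, mul_one, Nat.sub_zero, pow_zero, mul_zero]
        refine h6.trans ?_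
        have : Real.exp (-h) ≤ 1 := Real.exp_le_one_iff.2 (by linarith)
        gcongr
        linarith
      · rw [Nat.descFactorial_eq_zero_iff_lt.2 hk]
        simp only [Nat.cast_zero, mul_zero, zero_mul, ne_eq, OfNat.ofNat_ne_zero,
          not_false_eq_true, zero_pow]
        positivity
    · right
      have hpos : 0 < d 0 ^ 2 := by
        refine lt_of_le_of_ne (sq_nonneg _) fun h0 => ?_
        rw [← h0, zero_mul, zero_mul] at h1
        exact absurd h1 (not_le.2 (by positivity))
      refine ⟨d 0 ^ 2, hpos, fun x hx => ⟨by simp, ?_⟩⟩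
      obtain ⟨h2, h3, h4, h5⟩ := H.mem_cell hx
      rw [hrp, mul_one, ← div_eq_mul_inv, div_le_iff₀ h4]
      calc B = Real.exp (-h) * (Real.exp h * B) := by rw [← mul_assoc, ← Real.exp_add]; simp
        _ ≤ Real.exp (-h) * (d 0 ^ 2 * u j * Real.exp (-h)) := by gcongr
        _ = Real.exp (-h) * d 0 ^ 2 * (u j * Real.exp (-h)) := by ring
        _ ≤ _ := by gcongr

end Admissible

section

variable {Ω : Type*} [MeasurableSpace Ω] (P : Measure Ω) [IsProbabilityMeasure P]
  {N₀ : ℕ} {τ₁ τ₂ ρ : ℝ} {coeff : ℕ → ℕ → ℝ}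

lemma PolynomialGrowth.exists_isLocalApprox (hcoeff : PolynomialGrowth N₀ τ₁ τ₂ ρ coeff)
    (hτ₁ : 0 < τ₁) (hN₀ : 0 < N₀) (hρ : -(1 / 2 : ℝ) < ρ) :
    ∃ D : ℝ, 1 ≤ D ∧ ∃ κ : ℝ, 0 < κ ∧ ∀ᶠ n : ℕ in atTop, ∀ (a h : ℝ) (K : ℕ),
      Admissible n N₀ a h K → ∃ d' bad, IsLocalApprox P n (coeff n) a h K D κ d' bad := by
  have hp : 0 < 2 * ρ + 1 := by linarith
  set C₀ := τ₂ ^ 2 + (τ₁ ^ 2)⁻¹ with hC₀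
  have hC₀0 : 0 ≤ C₀ := by positivity
  set C := 4 * C₀ + 4 ^ 12 with hC
  have hC1 : 1 ≤ C := by rw [hC]; norm_num; linarith
  obtain ⟨D, hD, happ⟩ := _root_.exists_isLocalApprox P N₀ hN₀ hp hp hC1
  refine ⟨D, hD, (2 * ρ + 1) / 18, by positivity, ?_⟩
  set E := ⌈|2 * ρ|⌉₊ with hE
  set m := ⌈24 + 2 * (2 * ρ + 1)⌉₊ with hm
  filter_upwards [eventually_logLarge E, eventually_logLarge (2 * m)] with n hn hn'
  intro a h K H
  have hn0 : 0 < n := lt_of_lt_of_le (by norm_num) hn.two_le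
  obtain ⟨bad, hcard, hbad⟩ := H.exists_bad_leading hn' hp.le (Nat.le_ceil _)
    (by linarith : 4 ^ 12 ≤ C) (coeff n)
  have hw := hcoeff.powerWeights hτ₁ hN₀ (Nat.le_ceil _) hn0
  obtain ⟨d', hd'⟩ := happ n E E (coeff n) _ n 1 _ bad a h K one_pos (by positivity) hn hn
    (hw.mono_const zero_le_one (by linarith [show (0:ℝ) ≤ 4 ^ 12 by norm_num]))
    ((hw.sub_index_mul hC₀0 hn0 hN₀).mono_const (by positivity)
      (by linarith [show (0:ℝ) ≤ 4 ^ 12 by norm_num])) le_rfl (Or.inr rfl)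
    (fun x S => rootCount_le_rootCount_sub_index_mul n (coeff n) x) H hcard hbad
  exact ⟨d', bad, hd'⟩

open Polynomial in
lemma PolynomialGrowth.exists_isLocalApprox_reversed (hcoeff : PolynomialGrowth N₀ τ₁ τ₂ ρ coeff)
    (hτ₁ : 0 < τ₁) (hN₀ : 0 < N₀) :
    ∃ D : ℝ, 1 ≤ D ∧ ∃ κ : ℝ, 0 < κ ∧ ∀ᶠ n : ℕ in atTop, ∀ (a h : ℝ) (K : ℕ),
      Admissible n N₀ a h K →
      ∃ d' bad, IsLocalApprox P n (fun i => coeff n (revAt n i)) a h K D κ d' bad := by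
  set C₀ := 4 ^ |ρ| * (τ₂ ^ 2 + (τ₁ ^ 2)⁻¹) with hC₀
  have hC₀0 : 0 ≤ C₀ := by positivity
  have hC1 : 1 ≤ C₀ + 1 := by linarith
  obtain ⟨D, hD, happ⟩ := _root_.exists_isLocalApprox P 1 one_pos one_pos
    (by norm_num : (0 : ℝ) < 3) hC1
  refine ⟨D, hD, 1 / 18, by positivity, ?_⟩
  set E := ⌈|2 * ρ| + |2 * ρ|⌉₊ with hE
  filter_upwards [eventually_logLarge E, eventually_logLarge (E + 2), eventually_ge_atTop (2 * N₀)]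
    with n hn hn' hnN
  intro a h K H
  have hn0 : 0 < n := lt_of_lt_of_le (by norm_num) hn.two_le
  have hB : (0 : ℝ) < (n : ℝ) ^ (2 * ρ) := by positivity
  have H1 := H.mono (N₁ := 1) hN₀
  obtain ⟨bad, hcard, hbad⟩ := H1.exists_bad_constant hB hC1 (fun i => coeff n (revAt n i))
  have hw := hcoeff.powerWeights_reversed hτ₁ hN₀ (Nat.le_ceil _) hnN
  obtain ⟨d', hd'⟩ := happ n E (E + 2) _ _ 0 _ _ bad a h K hB hB hn hn'
    (hw.mono_const hB.le (by linarith))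
    ((hw.index_mul hC₀0 hB.le).mono_const hB.le (by linarith)) (Nat.zero_le _) (Or.inl rfl)
    (fun x S hS _ => rootCount_le_rootCount_index_mul n _ x hS) H1 hcard hbad
  exact ⟨d', bad, hd'⟩

end

/-! ### Independence of functions of disjoint groups of variables -/

/-- Grouping an independent family of `σ`-algebras along the fibres of a map keeps it
independent. -/
lemma iIndep_iSup_fiber {Ω ι κ : Type*} {m0 : MeasurableSpace Ω} {P : Measure Ω}
    [IsProbabilityMeasure P] {m : ι → MeasurableSpace Ω} (hm : ∀ i, m i ≤ m0) (hi : iIndep m P)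
    (β : ι → κ) : iIndep (fun k => ⨆ i ∈ β ⁻¹' {k}, m i) P := by
  classical
  rw [iIndep_iff]
  intro s f
  induction s using Finset.induction_on with
  | empty => simp
  | insert a s ha ih =>
    intro hf
    rw [Finset.set_biInter_insert, Finset.prod_insert ha,
      ← ih fun k hk => hf k (Finset.mem_insert_of_mem hk)]
    have hdisj : Disjoint (β ⁻¹' {a}) (β ⁻¹' (s : Set κ)) := by
      rw [Set.disjoint_left]
      rintro i hi1 hi2
      exact ha (by simpa [Set.mem_singleton_iff.1 hi1] using hi2)
    refine (Indep_iff _ _ _).1 (indep_iSup_of_disjoint hm hi hdisj) _ _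
      (hf a (Finset.mem_insert_self a s)) ?_
    refine Finset.measurableSet_biInter s fun k hk => ?_
    have hle : (⨆ i ∈ β ⁻¹' {k}, m i) ≤ ⨆ i ∈ β ⁻¹' (s : Set κ), m i :=
      biSup_mono fun i hi => by
        rw [Set.mem_preimage, Set.mem_singleton_iff.1 hi]
        exact hk
    exact hle _ (hf k (Finset.mem_insert_of_mem hk))

/-! ### The four orientations -/

open Polynomial in
/-- Reversal of the order of the coefficients of a polynomial of degree at most `n`, or not. -/
def orient (n : ℕ) (r : Bool) (i : ℕ) : ℕ := if r then revAt n i else i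

lemma orient_injective (n : ℕ) (r : Bool) : Function.Injective (orient n r) := by
  cases r
  · exact fun i j h => h
  · exact fun i j h => (Polynomial.revAt n).injective h

/-- Weights of the polynomial `p (-x)`, or `p x`. -/
def signed (s : Bool) (c : ℕ → ℕ → ℝ) (n i : ℕ) : ℝ := if s then (-1) ^ i * c n i else c n i

lemma PolynomialGrowth.signed {N₀ : ℕ} {τ₁ τ₂ ρ : ℝ} {c : ℕ → ℕ → ℝ}
    (h : PolynomialGrowth N₀ τ₁ τ₂ ρ c) (s : Bool) :
    PolynomialGrowth N₀ τ₁ τ₂ ρ (_root_.signed s c) := by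
  have : ∀ n i, |_root_.signed s c n i| = |c n i| := fun n i => by
    unfold _root_.signed
    split_ifs <;> simp [abs_mul]
  intro n i
  rw [this]
  exact h n i

/-- Weights of the four polynomials `p x`, `p (-x)`, `x ^ n p (1 / x)` and `x ^ n p (-1 / x)`. -/
def orientedCoeff (τ : Bool × Bool) (c : ℕ → ℕ → ℝ) (n i : ℕ) : ℝ :=
  signed τ.1 c n (orient n τ.2 i)

open Polynomial in
lemma weightedPoly_comp_neg (n : ℕ) (c : ℕ → ℕ → ℝ) (x : ℕ → ℝ) :
    (weightedPoly n (c n) x).comp (-X) = weightedPoly n (signed true c n) x := by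
  unfold weightedPoly
  rw [Polynomial.sum_comp]
  refine Finset.sum_congr rfl fun i _ => ?_
  simp only [signed, if_true, mul_comp, C_comp, pow_comp, X_comp, neg_pow (X : ℝ[X]) i,
    C_mul, C_pow, C_neg,
    C_1]
  ring

/-- The four parts of the core are brought to `(1 - a, 1 - b)` by `x ↦ -x` and `x ↦ 1 / x`; the new
polynomials are driven by the same variables, possibly in reverse order. -/
lemma rootCount_core (n : ℕ) (c : ℕ → ℕ → ℝ) (x : ℕ → ℝ) {a b : ℝ} (ha : a ≤ 1) (hb : 0 ≤ b) :
    rootCount (weightedPoly n (c n) x) (core a b) =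
      ∑ τ : Bool × Bool, rootCount (weightedPoly n (orientedCoeff τ c n)
        (fun i => x (orient n τ.2 i))) (Set.Ioo (1 - a) (1 - b)) := by
  set I := Set.Ioo (1 - a) (1 - b) with hI
  have hI0 : ∀ y ∈ I, 0 < y ∧ y < 1 := fun y hy => ⟨by linarith [hy.1], by linarith [hy.2]⟩
  have hII : ∀ y ∈ I⁻¹, 1 < y := fun y hy => by
    obtain ⟨h1, h2⟩ := hI0 _ (Set.mem_inv.1 hy)
    rw [inv_pos] at h1
    exact (inv_lt_one₀ h1).1 h2
  have h0 : (0 : ℝ) ∉ I := fun h => lt_irrefl _ (hI0 _ h).1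
  have d1 : Disjoint (-I) I := Set.disjoint_left.2 fun y h1 h2 => by
    linarith [(hI0 _ h1).1, (hI0 _ h2).1]
  have d2 : Disjoint (-I⁻¹) I⁻¹ := Set.disjoint_left.2 fun y h1 h2 => by
    linarith [hII _ h1, hII _ h2]
  have d3 : Disjoint (-I ∪ I) (-I⁻¹ ∪ I⁻¹) := Set.disjoint_left.2 fun y h1 h2 => by
    rcases h1 with h1 | h1 <;> rcases h2 with h2 | h2 <;>
      linarith [(hI0 _ h1).1, (hI0 _ h1).2, hII _ h2]
  have hc : core a b = (-I ∪ I) ∪ (-I⁻¹ ∪ I⁻¹) := rfl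
  have e1 := rootCount_inv_set (natDegree_weightedPoly_le n (c n) x) h0
  have e2 := rootCount_inv_set (natDegree_weightedPoly_le n (signed true c n) x) h0
  rw [reflect_weightedPoly] at e1 e2
  rw [hc, rootCount_union _ d3, rootCount_union _ d1, rootCount_union _ d2, rootCount_neg_set,
    rootCount_neg_set, weightedPoly_comp_neg, e1, e2, Fintype.sum_prod_type]
  have h1 : ∀ τ, orientedCoeff τ c n = fun i => signed τ.1 c n (orient n τ.2 i) := fun _ => rfl
  have h2 : ∀ i, signed false c n i = c n i := fun _ => rfl
  have h3 : ∀ i, orient n true i = Polynomial.revAt n i := fun _ => rfl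
  have h4 : ∀ i, orient n false i = i := fun _ => rfl
  simp only [Fintype.sum_bool, h1, h2, h3, h4]
  ring

/-! ### Truncated counts -/

lemma IsLocalApprox.mono {Ω : Type*} [MeasurableSpace Ω] {P : Measure Ω} {n K : ℕ}
    {d : ℕ → ℝ} {a h D κ D' κ' : ℝ} {d' : ℕ → ℕ → ℝ} {bad : Finset ℕ}
    (H : IsLocalApprox P n d a h K D κ d' bad) (hh : 0 ≤ h) (h0 : 0 ≤ D)
    (hD : D ≤ D') (hκ : κ' ≤ κ) : IsLocalApprox P n d a h K D' κ' d' bad where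
  window := H.window
  card := H.card
  moment ζ hζ j hj := (H.moment ζ hζ j hj).trans (by gcongr)
  moment' ζ hζ j hj := (H.moment' ζ hζ j hj).trans (by gcongr)
  prob ζ hζ j hj hb := (H.prob ζ hζ j hj hb).trans (by
    have : 0 ≤ D' := h0.trans hD
    gcongr)

section

variable {Ω : Type*} [MeasurableSpace Ω] {P : Measure Ω} [IsProbabilityMeasure P]

variable (P) in
lemma PolynomialGrowth.exists_isLocalApprox_oriented {N₀ : ℕ} {τ₁ τ₂ ρ : ℝ} {coeff : ℕ → ℕ → ℝ}
    (hcoeff : PolynomialGrowth N₀ τ₁ τ₂ ρ coeff) (hτ₁ : 0 < τ₁) (hN₀ : 0 < N₀)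
    (hρ : -(1 / 2 : ℝ) < ρ) :
    ∃ D : ℝ, 1 ≤ D ∧ ∃ κ : ℝ, 0 < κ ∧ ∀ᶠ n : ℕ in atTop, ∀ (a h : ℝ) (K : ℕ),
      Admissible n N₀ a h K → ∃ (d' : Bool × Bool → ℕ → ℕ → ℝ) (bad : Bool × Bool → Finset ℕ),
        ∀ τ, IsLocalApprox P n (orientedCoeff τ coeff n) a h K D κ (d' τ) (bad τ) := by
  have h1 : ∀ τ : Bool × Bool, ∃ D : ℝ, 1 ≤ D ∧ ∃ κ : ℝ, 0 < κ ∧ ∀ᶠ n : ℕ in atTop,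
      ∀ (a h : ℝ) (K : ℕ), Admissible n N₀ a h K → ∃ d' bad,
        IsLocalApprox P n (orientedCoeff τ coeff n) a h K D κ d' bad := by
    rintro ⟨s, r⟩
    cases r
    · exact (hcoeff.signed s).exists_isLocalApprox P hτ₁ hN₀ hρ
    · exact (hcoeff.signed s).exists_isLocalApprox_reversed P hτ₁ hN₀
  choose D hD κ hκ hev using h1
  refine ⟨∑ τ, D τ, (hD (true, true)).trans (Finset.single_le_sum (f := D)
    (fun τ _ => zero_le_one.trans (hD τ)) (Finset.mem_univ _)),
    Finset.univ.inf' Finset.univ_nonempty κ, (Finset.lt_inf'_iff _).2 fun τ _ => hκ τ, ?_⟩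
  filter_upwards [eventually_all.2 hev] with n hn
  intro a h K H
  choose d' bad hd' using fun τ => hn τ a h K H
  refine ⟨d', bad, fun τ => (hd' τ).mono (by linarith [H.one_le]) (by linarith [hD τ])
    (Finset.single_le_sum (f := D) (fun τ _ => zero_le_one.trans (hD τ)) (Finset.mem_univ _))
    (Finset.inf'_le _ (Finset.mem_univ _))⟩

/-- The number of roots of the four truncated polynomials in the `j`-th piece. -/
noncomputable def truncatedCount {Ω : Type*} (n : ℕ) (a h : ℝ) (d' : Bool × Bool → ℕ → ℕ → ℝ)
    (ξ : ℕ → Ω → ℝ) (j : ℕ) (ω : Ω) : ℝ :=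
  ∑ τ : Bool × Bool, (rootCount (weightedPoly n (d' τ j) fun i => ξ (orient n τ.2 i) ω)
    (piece a h j) : ℝ)

/-- The group of scales to which an index belongs: the logarithm of its distance to the nearer end
of `[0, n]`, in units of `h`, so that it is the same for both orders of the coefficients. -/
noncomputable def scaleIndex (n : ℕ) (a h : ℝ) (i : ℕ) : ℤ := ⌊Real.log (a * min i (n - i)) / h⌋

/-- The window of a piece meets at most four groups of scales. -/
lemma scaleIndex_mem {n i j : ℕ} {a h : ℝ} (hh : 0 < h) (r : Bool)
    (hi : i ∈ pieceWindow n a h j) :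
    (j : ℤ) - 1 ≤ scaleIndex n a h (orient n r i) ∧
      scaleIndex n a h (orient n r i) ≤ (j : ℤ) + 2 := by
  obtain ⟨h1, h2, h3⟩ := hi
  have hmin : min (orient n r i) (n - orient n r i) = i := by
    unfold orient
    split_ifs
    · rw [Polynomial.revAt_le (by omega)]
      omega
    · omega
  have hpos : 0 < a * i := (Real.exp_pos _).trans_le h2
  have l1 := Real.log_le_log (Real.exp_pos _) h2
  have l2 := Real.log_le_log hpos h3
  rw [Real.log_exp] at l1 l2
  unfold scaleIndex
  rw [hmin]
  constructor
  · rw [Int.le_floor, le_div_iff₀ hh]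
    push_cast
    linarith
  · have : (⌊Real.log (a * i) / h⌋ : ℝ) ≤ (j : ℝ) + 2 :=
      (Int.floor_le _).trans (by rw [div_le_iff₀ hh]; linarith)
    exact_mod_cast this

/-- The `j`-th truncated count depends only on the variables in the groups `j - 1, …, j + 2`. -/
lemma measurable_truncatedCount {Ω : Type*} [MeasurableSpace Ω] {n : ℕ} {a h : ℝ} (hh : 0 < h)
    {d' : Bool × Bool → ℕ → ℕ → ℝ} {j : ℕ} (H : ∀ τ i, d' τ j i ≠ 0 → i ∈ pieceWindow n a h j)
    {ξ : ℕ → Ω → ℝ} (hm : ∀ i, (j : ℤ) - 1 ≤ scaleIndex n a h i →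
      scaleIndex n a h i ≤ (j : ℤ) + 2 → Measurable (ξ i)) :
    Measurable (truncatedCount n a h d' ξ j) := by
  unfold truncatedCount
  refine Finset.measurable_fun_sum _ fun τ _ => measurable_from_nat.comp ?_
  refine measurable_rootCount_weightedPoly (ζ := fun i => ξ (orient n τ.2 i))
    (isSigmaCompact_Ioc _ _) n _ fun i _ hi => ?_
  obtain ⟨h1, h2⟩ := scaleIndex_mem hh τ.2 (H τ i hi)
  exact hm _ h1 h2

end

/-! ### Second moment of the truncation error -/

section

variable {Ω : Type*} [MeasurableSpace Ω] {P : Measure Ω} [IsProbabilityMeasure P]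

/-- A root at a fixed point other than `0` has probability zero. -/
lemma IsStdGaussianSeq.ae_rootCount_Ioo_eq {ζ : ℕ → Ω → ℝ} (hζ : IsStdGaussianSeq ζ P) {n i : ℕ}
    {d : ℕ → ℝ} (hi : i ≤ n) (hdi : d i ≠ 0) {α x : ℝ} (hαx : α < x) (hx : x ≠ 0) :
    ∀ᵐ ω ∂P, rootCount (weightedPoly n d fun i => ζ i ω) (Set.Ioo α x) =
      rootCount (weightedPoly n d fun i => ζ i ω) (Set.Ioc α x) := by
  have hpos : 0 < ∑ i ∈ Finset.range (n + 1), (d i * x ^ i) ^ 2 := by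
    refine Finset.sum_pos' (fun _ _ => sq_nonneg _) ⟨i, Finset.mem_range.2 (by omega), ?_⟩
    have : d i * x ^ i ≠ 0 := mul_ne_zero hdi (pow_ne_zero _ hx)
    positivity
  have h0 := hζ.measure_abs_sum_le (Finset.range (n + 1)) (fun i => d i * x ^ i) hpos 0
  rw [zero_div, ENNReal.ofReal_zero, nonpos_iff_eq_zero] at h0
  have h1 : ∀ᵐ ω ∂P, ¬ |∑ i ∈ Finset.range (n + 1), d i * x ^ i * ζ i ω| ≤ 0 :=
    measure_eq_zero_iff_ae_notMem.1 h0
  filter_upwards [h1] with ω hω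
  rw [← eval_weightedPoly, abs_nonpos_iff] at hω
  rw [← Set.Ioo_union_right hαx, rootCount_union _ (by simp)]
  have : rootCount (weightedPoly n d fun i => ζ i ω) {x} = 0 := by
    by_contra hcon
    obtain ⟨-, y, hy, hy0⟩ := rootCount_pos_iff.1 (Nat.pos_of_ne_zero hcon)
    rw [Set.mem_singleton_iff.1 hy] at hy0
    exact hω hy0
  omega

lemma PolynomialGrowth.orientedCoeff_ne_zero {N₀ : ℕ} {τ₁ τ₂ ρ : ℝ} {coeff : ℕ → ℕ → ℝ}
    (hcoeff : PolynomialGrowth N₀ τ₁ τ₂ ρ coeff) (hτ₁ : 0 < τ₁) (hN₀ : 0 < N₀) {n : ℕ}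
    (hn : N₀ < n) (τ : Bool × Bool) : ∃ i ≤ n, orientedCoeff τ coeff n i ≠ 0 := by
  have h0 : (0 : ℝ) < N₀ := by exact_mod_cast hN₀
  have h1 := (((hcoeff.signed τ.1) n N₀).2 le_rfl hn).1
  have h2 : _root_.signed τ.1 coeff n N₀ ≠ 0 := by
    rw [← abs_pos]
    exact lt_of_lt_of_le (by positivity) h1
  refine ⟨orient n τ.2 N₀, ?_, ?_⟩
  · unfold orient
    split_ifs
    · rw [Polynomial.revAt_le hn.le]; omega
    · exact hn.le
  · have : orient n τ.2 (orient n τ.2 N₀) = N₀ := by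
      unfold orient
      split_ifs
      · exact Polynomial.revAt_invol
      · rfl
    unfold orientedCoeff
    rwa [this]

/-- Almost surely, the roots in the core are the roots of the four oriented polynomials in the
pieces. -/
lemma ae_rootCount_core_eq {ξ : ℕ → Ω → ℝ} (hξ : IsStdGaussianSeq ξ P) {N₀ n K : ℕ} {a h : ℝ}
    (H : Admissible n N₀ a h K) (hK : 0 < K) {coeff : ℕ → ℕ → ℝ}
    (h0 : ∀ τ, ∃ i ≤ n, orientedCoeff τ coeff n i ≠ 0) :
    ∀ᵐ ω ∂P, (rootCount (weightedPoly n (coeff n) fun i => ξ i ω)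
        (core a (a * Real.exp (-(h * K)))) : ℝ) =
      ∑ τ : Bool × Bool, ∑ j ∈ Finset.range K, (rootCount (weightedPoly n (orientedCoeff τ coeff n)
        fun i => ξ (orient n τ.2 i) ω) (piece a h j) : ℝ) := by
  have ha := H.pos
  have hh := H.one_le
  have he : Real.exp (-h) < 1 := Real.exp_zero ▸ Real.exp_lt_exp.2 (by linarith : -h < 0)
  have ha1 : a < 1 := H.le_exp.trans_lt he
  have hK1 : (1 : ℝ) ≤ K := by exact_mod_cast hK
  have hba : a * Real.exp (-(h * K)) < a := by
    refine mul_lt_of_lt_one_right ha ?_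
    refine lt_of_le_of_lt (Real.exp_le_exp.2 ?_) he
    nlinarith
  have hall : ∀ τ : Bool × Bool, ∀ᵐ ω ∂P, rootCount (weightedPoly n (orientedCoeff τ coeff n)
      fun i => ξ (orient n τ.2 i) ω) (Set.Ioo (1 - a) (1 - a * Real.exp (-(h * K)))) =
      rootCount (weightedPoly n (orientedCoeff τ coeff n)
      fun i => ξ (orient n τ.2 i) ω) (Set.Ioc (1 - a) (1 - a * Real.exp (-(h * K)))) := fun τ => by
    obtain ⟨i, hi, hi0⟩ := h0 τ
    exact (hξ.comp_injective (orient_injective n τ.2)).ae_rootCount_Ioo_eq hi hi0 (by linarith)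
      (by linarith)
  filter_upwards [ae_all_iff.2 hall] with ω hω
  rw [rootCount_core n coeff _ ha1.le (by positivity), Nat.cast_sum]
  refine Finset.sum_congr rfl fun τ _ => ?_
  rw [hω τ]
  have := rootCount_Ioc_succ (weightedPoly n (orientedCoeff τ coeff n)
    fun i => ξ (orient n τ.2 i) ω) (geomPt_mono ha.le (by linarith : 0 ≤ h)) K
  rw [geomPt_zero, geomPt] at this
  rw [this, Nat.cast_sum]
  rfl

/-- The integral is carried by `{M ≠ N}`, where `y² ≤ l / 2 + y⁴ / (2 l)` is applied to `M` and
`N`. -/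
lemma integral_sq_sub_le {M N : Ω → ℕ} (hM : MemLp (fun ω => (M ω : ℝ)) 4 P)
    (hN : MemLp (fun ω => (N ω : ℝ)) 4 P) (hMm : Measurable M) (hNm : Measurable N)
    {A π l : ℝ} (hMA : ∫ ω, (M ω : ℝ) ^ 4 ∂P ≤ A) (hNA : ∫ ω, (N ω : ℝ) ^ 4 ∂P ≤ A)
    (hl : 0 < l) (hπ : P.real {ω | M ω ≠ N ω} ≤ π) :
    ∫ ω, ((M ω : ℝ) - N ω) ^ 2 ∂P ≤ l * π + A / l := by
  set S := {ω | M ω ≠ N ω} with hS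
  have hSm : MeasurableSet S := (measurableSet_eq_fun hMm hNm).compl
  have i1 : Integrable (fun ω => (M ω : ℝ) ^ 4) P := integrable_pow_of_memLp_four hM le_rfl
  have i2 : Integrable (fun ω => (N ω : ℝ) ^ 4) P := integrable_pow_of_memLp_four hN le_rfl
  have i3 : Integrable (S.indicator fun _ => l) P := (integrable_const l).indicator hSm
  have hsq : ∀ y : ℝ, y ^ 2 ≤ l / 2 + y ^ 4 / (2 * l) := fun y => by
    rw [div_add_div _ _ (by norm_num) (by positivity), le_div_iff₀ (by positivity)]
    nlinarith [sq_nonneg (y ^ 2 - l)]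
  have hpt : ∀ ω, ((M ω : ℝ) - N ω) ^ 2 ≤
      S.indicator (fun _ => l) ω + ((M ω : ℝ) ^ 4 + (N ω : ℝ) ^ 4) / (2 * l) := fun ω => by
    by_cases hω : ω ∈ S
    · rw [Set.indicator_of_mem hω]
      have h1 : ((M ω : ℝ) - N ω) ^ 2 ≤ (M ω : ℝ) ^ 2 + (N ω : ℝ) ^ 2 := by
        have : (0 : ℝ) ≤ M ω * N ω := by positivity
        nlinarith
      have h2 := hsq (M ω)
      have h3 := hsq (N ω)
      rw [add_div]
      linarith
    · rw [Set.indicator_of_notMem hω]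
      have : M ω = N ω := by simpa [hS] using hω
      rw [this, sub_self, zero_pow two_ne_zero]
      positivity
  calc ∫ ω, ((M ω : ℝ) - N ω) ^ 2 ∂P
      ≤ ∫ ω, (S.indicator (fun _ => l) ω + ((M ω : ℝ) ^ 4 + (N ω : ℝ) ^ 4) / (2 * l)) ∂P :=
        integral_mono_of_nonneg (ae_of_all _ fun _ => sq_nonneg _)
          (i3.add ((i1.add i2).div_const _)) (ae_of_all _ hpt)
    _ = l * P.real S + (∫ ω, (M ω : ℝ) ^ 4 ∂P + ∫ ω, (N ω : ℝ) ^ 4 ∂P) / (2 * l) := by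
        have i4 : Integrable (fun ω => ((M ω : ℝ) ^ 4 + (N ω : ℝ) ^ 4) / (2 * l)) P :=
          (i1.add i2).div_const _
        rw [integral_add i3 i4, integral_div, integral_add i1 i2,
          integral_indicator_const _ hSm, smul_eq_mul, mul_comm l]
    _ ≤ l * π + (A + A) / (2 * l) := by gcongr
    _ = _ := by field_simp; ring

/-- Cauchy-Schwarz, separately on the exceptional pieces and on the others. -/
lemma sum_sq_le_filter {ι : Type*} (s : Finset ι) (q : ι → Prop) [DecidablePred q] (f : ι → ℝ) :
    (∑ i ∈ s, f i) ^ 2 ≤ 2 * (((s.filter q).card : ℝ) * ∑ i ∈ s.filter q, f i ^ 2) +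
      2 * (((s.filter fun i => ¬ q i).card : ℝ) * ∑ i ∈ s.filter fun i => ¬ q i, f i ^ 2) := by
  rw [← Finset.sum_filter_add_sum_filter_not s q f]
  have h1 := sq_sum_le_card_mul_sum_sq (s := s.filter q) (f := f)
  have h2 := sq_sum_le_card_mul_sum_sq (s := s.filter fun i => ¬ q i) (f := f)
  nlinarith [sq_nonneg (∑ i ∈ s.filter q, f i - ∑ i ∈ s.filter fun i => ¬ q i, f i)]

/-- The number of roots in the core and the sum of the truncated counts differ by little. -/
lemma integral_sq_sub_truncatedCount_le {ξ : ℕ → Ω → ℝ} (hξ : IsStdGaussianSeq ξ P)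
    {N₀ n K : ℕ} {a h D κ : ℝ}
    (H : Admissible n N₀ a h K) (hK : 0 < K) {coeff : ℕ → ℕ → ℝ} (hD : 1 ≤ D)
    (h0 : ∀ τ, ∃ i ≤ n, orientedCoeff τ coeff n i ≠ 0)
    {d' : Bool × Bool → ℕ → ℕ → ℝ} {bad : Bool × Bool → Finset ℕ}
    (happ : ∀ τ, IsLocalApprox P n (orientedCoeff τ coeff n) a h K D κ (d' τ) (bad τ)) :
    ∫ ω, ((rootCount (weightedPoly n (coeff n) fun i => ξ i ω)
        (core a (a * Real.exp (-(h * K)))) : ℝ) -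
        ∑ j ∈ Finset.range K, truncatedCount n a h d' ξ j ω) ^ 2 ∂P ≤
      576 * D * h ^ 5 + 64 * D * K ^ 2 * h ^ 5 * Real.exp (-(κ / 2 * h)) := by
  classical
  have hh := H.one_le
  have hDh : 1 ≤ D * h ^ 5 := one_le_mul_of_one_le_of_one_le hD (one_le_pow₀ hh)
  have hζ : ∀ τ : Bool × Bool, IsStdGaussianSeq (fun i => ξ (orient n τ.2 i)) P := fun τ =>
    hξ.comp_injective (orient_injective n τ.2)
  let M : (Bool × Bool) × ℕ → Ω → ℕ := fun t ω =>
    rootCount (weightedPoly n (orientedCoeff t.1 coeff n) fun i => ξ (orient n t.1.2 i) ω)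
      (piece a h t.2)
  let N : (Bool × Bool) × ℕ → Ω → ℕ := fun t ω =>
    rootCount (weightedPoly n (d' t.1 t.2) fun i => ξ (orient n t.1.2 i) ω) (piece a h t.2)
  have hM : ∀ t, MemLp (fun ω => (M t ω : ℝ)) 4 P := fun t =>
    memLp_rootCount (hζ t.1).measurable n _ (isSigmaCompact_Ioc _ _) 4
  have hN : ∀ t, MemLp (fun ω => (N t ω : ℝ)) 4 P := fun t =>
    memLp_rootCount (hζ t.1).measurable n _ (isSigmaCompact_Ioc _ _) 4
  have hMm : ∀ t, Measurable (M t) := fun t =>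
    measurable_rootCount_weightedPoly (isSigmaCompact_Ioc _ _) n _ fun i _ _ =>
      (hζ t.1).measurable i
  have hNm : ∀ t, Measurable (N t) := fun t =>
    measurable_rootCount_weightedPoly (isSigmaCompact_Ioc _ _) n _ fun i _ _ =>
      (hζ t.1).measurable i
  have hint : ∀ t, Integrable (fun ω => ((M t ω : ℝ) - N t ω) ^ 2) P := fun t =>
    integrable_pow_of_memLp_four ((hM t).sub (hN t)) (by norm_num)
  set T := (Finset.univ : Finset (Bool × Bool)) ×ˢ Finset.range K with hT
  let q : (Bool × Bool) × ℕ → Prop := fun t => t.2 ∈ bad t.1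
  -- on the exceptional pieces only the moments are known
  have hbad : ∀ t ∈ T, ∫ ω, ((M t ω : ℝ) - N t ω) ^ 2 ∂P ≤ 2 * (D * h ^ 5) := fun t ht => by
    rw [hT, Finset.mem_product, Finset.mem_range] at ht
    have := integral_sq_sub_le (hM t) (hN t) (hMm t) (hNm t)
      ((happ t.1).moment _ (hζ t.1) t.2 ht.2) ((happ t.1).moment' _ (hζ t.1) t.2 ht.2) one_pos
      (measureReal_le_one (μ := P))
    refine this.trans ?_
    rw [div_one]
    linarith
  -- on the others the choice `l = e ^ (κ h / 2)` balances the two terms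
  have hgood : ∀ t ∈ T, ¬ q t → ∫ ω, ((M t ω : ℝ) - N t ω) ^ 2 ∂P ≤
      2 * (D * h ^ 5) * Real.exp (-(κ / 2 * h)) := fun t ht hq => by
    rw [hT, Finset.mem_product, Finset.mem_range] at ht
    have := integral_sq_sub_le (hM t) (hN t) (hMm t) (hNm t)
      ((happ t.1).moment _ (hζ t.1) t.2 ht.2) ((happ t.1).moment' _ (hζ t.1) t.2 ht.2)
      (Real.exp_pos (κ / 2 * h)) ((happ t.1).prob _ (hζ t.1) t.2 ht.2 hq)
    refine this.trans ?_
    have e1 : Real.exp (κ / 2 * h) * (D * h * Real.exp (-(κ * h))) =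
        D * h * Real.exp (-(κ / 2 * h)) := by
      rw [mul_left_comm, ← Real.exp_add]
      ring_nf
    have e2 : h ≤ h ^ 5 := le_self_pow₀ hh (by norm_num)
    rw [e1, div_eq_mul_inv _ (Real.exp _), ← Real.exp_neg]
    calc D * h * Real.exp (-(κ / 2 * h)) + D * h ^ 5 * Real.exp (-(κ / 2 * h))
        ≤ D * h ^ 5 * Real.exp (-(κ / 2 * h)) + D * h ^ 5 * Real.exp (-(κ / 2 * h)) := by gcongr
      _ = _ := by ring
  have hc1 : ((T.filter q).card : ℝ) ≤ 12 := by
    have : (T.filter q).card ≤ 12 := by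
      calc (T.filter q).card ≤ (Finset.univ.sigma bad).card :=
            Finset.card_le_card_of_injOn (fun t => ⟨t.1, t.2⟩)
              (fun t ht => by
                have := (Finset.mem_filter.1 ht).2
                simpa using this)
              (fun t _ t' _ htt => by
                obtain ⟨t1, t2⟩ := t
                obtain ⟨t1', t2'⟩ := t'
                simp only [Sigma.mk.injEq, heq_eq_eq] at htt
                exact Prod.ext htt.1 htt.2)
        _ = ∑ τ, (bad τ).card := Finset.card_sigma _ _
        _ ≤ ∑ τ : Bool × Bool, 3 := Finset.sum_le_sum fun τ _ => (happ τ).card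
        _ = 12 := by simp
    exact_mod_cast this
  have hc2 : ((T.filter fun t => ¬ q t).card : ℝ) ≤ 4 * K := by
    have : (T.filter fun t => ¬ q t).card ≤ 4 * K :=
      (Finset.card_filter_le _ _).trans (by simp [hT])
    exact_mod_cast this
  have hae : ∀ᵐ ω ∂P, ((rootCount (weightedPoly n (coeff n) fun i => ξ i ω)
        (core a (a * Real.exp (-(h * K)))) : ℝ) -
        ∑ j ∈ Finset.range K, truncatedCount n a h d' ξ j ω) ^ 2 =
      (∑ t ∈ T, ((M t ω : ℝ) - N t ω)) ^ 2 := by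
    filter_upwards [ae_rootCount_core_eq hξ H hK h0] with ω hω
    rw [hω]
    unfold truncatedCount
    rw [Finset.sum_comm (s := Finset.range K), ← Finset.sum_sub_distrib, hT, Finset.sum_product]
    congr 1
    refine Finset.sum_congr rfl fun τ _ => ?_
    rw [← Finset.sum_sub_distrib]
  rw [integral_congr_ae hae]
  calc ∫ ω, (∑ t ∈ T, ((M t ω : ℝ) - N t ω)) ^ 2 ∂P
      ≤ ∫ ω, (2 * (((T.filter q).card : ℝ) * ∑ t ∈ T.filter q, ((M t ω : ℝ) - N t ω) ^ 2) +
        2 * (((T.filter fun t => ¬ q t).card : ℝ) *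
          ∑ t ∈ T.filter fun t => ¬ q t, ((M t ω : ℝ) - N t ω) ^ 2)) ∂P := by
        refine integral_mono_of_nonneg (ae_of_all _ fun _ => sq_nonneg _) ?_
          (ae_of_all _ fun ω => sum_sq_le_filter T q _)
        exact (((integrable_finsetSum _ fun t _ => hint t).const_mul _).const_mul _).add
          (((integrable_finsetSum _ fun t _ => hint t).const_mul _).const_mul _)
    _ = 2 * (((T.filter q).card : ℝ) * ∑ t ∈ T.filter q, ∫ ω, ((M t ω : ℝ) - N t ω) ^ 2 ∂P) +
        2 * (((T.filter fun t => ¬ q t).card : ℝ) *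
          ∑ t ∈ T.filter fun t => ¬ q t, ∫ ω, ((M t ω : ℝ) - N t ω) ^ 2 ∂P) := by
        rw [integral_add (((integrable_finsetSum _ fun t _ => hint t).const_mul _).const_mul _)
          (((integrable_finsetSum _ fun t _ => hint t).const_mul _).const_mul _),
          integral_const_mul, integral_const_mul, integral_const_mul, integral_const_mul,
          integral_finsetSum _ fun t _ => hint t, integral_finsetSum _ fun t _ => hint t]
    _ ≤ 2 * (((T.filter q).card : ℝ) * ∑ t ∈ T.filter q, 2 * (D * h ^ 5)) +
        2 * (((T.filter fun t => ¬ q t).card : ℝ) *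
          ∑ t ∈ T.filter fun t => ¬ q t, 2 * (D * h ^ 5) * Real.exp (-(κ / 2 * h))) := by
        refine add_le_add ?_ ?_
        · refine mul_le_mul_of_nonneg_left (mul_le_mul_of_nonneg_left ?_ (Nat.cast_nonneg _))
            zero_le_two
          exact Finset.sum_le_sum fun t ht => hbad t (Finset.mem_filter.1 ht).1
        · refine mul_le_mul_of_nonneg_left (mul_le_mul_of_nonneg_left ?_ (Nat.cast_nonneg _))
            zero_le_two
          exact Finset.sum_le_sum fun t ht =>
            hgood t (Finset.mem_filter.1 ht).1 (Finset.mem_filter.1 ht).2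
    _ = 2 * (((T.filter q).card : ℝ) * (((T.filter q).card : ℝ) * (2 * (D * h ^ 5)))) +
        2 * (((T.filter fun t => ¬ q t).card : ℝ) * (((T.filter fun t => ¬ q t).card : ℝ) *
          (2 * (D * h ^ 5) * Real.exp (-(κ / 2 * h))))) := by
        rw [Finset.sum_const, Finset.sum_const, nsmul_eq_mul, nsmul_eq_mul]
    _ ≤ 2 * (12 * (12 * (2 * (D * h ^ 5)))) +
        2 * ((4 * K) * ((4 * K) * (2 * (D * h ^ 5) * Real.exp (-(κ / 2 * h))))) := by
        gcongr
    _ = _ := by ring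

end

/-! ### Blocks of pieces -/

/-- The sum of the `Z j`, `j < K`, with quotient `m` by `q` and a remainder satisfying `r`. -/
def blockSum {Ω : Type*} (Z : ℕ → Ω → ℝ) (K q : ℕ) (r : ℕ → Prop) [DecidablePred r] (m : ℕ)
    (ω : Ω) : ℝ :=
  ∑ j ∈ Finset.range K with j / q = m ∧ r (j % q), Z j ω

section

variable {Ω : Type*} (Z : ℕ → Ω → ℝ) (K q : ℕ) (r : ℕ → Prop) [DecidablePred r]

lemma sum_blockSum_eq (f : ℕ → ℝ) :
    ∑ m ∈ Finset.range K, ∑ j ∈ Finset.range K with j / q = m ∧ r (j % q), f j =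
      ∑ j ∈ Finset.range K with r (j % q), f j := by
  have h := Finset.sum_fiberwise_of_maps_to (s := (Finset.range K).filter fun j => r (j % q))
    (t := Finset.range K) (g := fun j => j / q) (fun j hj => by
      rw [Finset.mem_filter, Finset.mem_range] at hj
      exact Finset.mem_range.2 ((Nat.div_le_self j q).trans_lt hj.1)) f
  rw [← h]
  refine Finset.sum_congr rfl fun m _ => ?_
  rw [Finset.filter_filter]
  refine Finset.sum_congr ?_ fun _ _ => rfl
  ext j
  simp only [Finset.mem_filter]
  tauto

lemma sum_blockSum_add_sum_blockSum (ω : Ω) :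
    ∑ m ∈ Finset.range K, blockSum Z K q (4 ≤ ·) m ω +
      ∑ m ∈ Finset.range K, blockSum Z K q (· < 4) m ω = ∑ j ∈ Finset.range K, Z j ω := by
  unfold blockSum
  rw [sum_blockSum_eq K q (4 ≤ ·) fun j => Z j ω, sum_blockSum_eq K q (· < 4) fun j => Z j ω,
    ← Finset.sum_filter_add_sum_filter_not (Finset.range K) (fun j => 4 ≤ j % q)]
  congr 1
  refine Finset.sum_congr (Finset.filter_congr fun j _ => ?_) fun _ _ => rfl
  exact not_le.symm

variable {q} in
lemma card_block_le (hq : 0 < q) (m : ℕ) :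
    ((Finset.range K).filter fun j => j / q = m ∧ r (j % q)).card ≤ q := by
  calc _ ≤ (Finset.Ico (q * m) (q * m + q)).card := Finset.card_le_card fun j hj => by
        rw [Finset.mem_filter] at hj
        rw [Finset.mem_Ico, ← hj.2.1]
        have h1 := Nat.div_add_mod j q
        have h2 := Nat.mod_lt j hq
        omega
    _ = q := by simp

lemma card_gap_le (m : ℕ) :
    ((Finset.range K).filter fun j => j / q = m ∧ j % q < 4).card ≤ 4 := by
  calc _ ≤ (Finset.Ico (q * m) (q * m + 4)).card := Finset.card_le_card fun j hj => by
        rw [Finset.mem_filter] at hj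
        rw [Finset.mem_Ico, ← hj.2.1]
        have h1 := Nat.div_add_mod j q
        omega
    _ = 4 := by simp

lemma card_filter_mod_lt_le :
    ((Finset.range K).filter fun j => j % q < 4).card ≤ 4 * (K / q + 1) := by
  calc _ ≤ (Finset.range 4 ×ˢ Finset.range (K / q + 1)).card := by
        refine Finset.card_le_card_of_injOn (fun j => (j % q, j / q)) (fun j hj => ?_)
          fun j _ j' _ hjj => ?_
        · have hj' := Finset.mem_filter.1 hj
          rw [Finset.mem_range] at hj'
          have : j / q ≤ K / q := Nat.div_le_div_right hj'.1.le
          simp only [Finset.coe_product, Finset.coe_range, Set.mem_prod, Set.mem_Iio]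
          omega
        · simp only [Prod.mk.injEq] at hjj
          rw [← Nat.div_add_mod j q, ← Nat.div_add_mod j' q, hjj.1, hjj.2]
    _ = _ := by simp

end

lemma measurable_blockSum {Ω : Type*} [MeasurableSpace Ω] {Z : ℕ → Ω → ℝ} {K q m : ℕ} {r : ℕ → Prop}
    [DecidablePred r] (hZ : ∀ j, j / q = m → r (j % q) → Measurable (Z j)) :
    Measurable (blockSum Z K q r m) := by
  unfold blockSum
  refine Finset.measurable_fun_sum _ fun j hj => ?_
  rw [Finset.mem_filter] at hj
  exact hZ j hj.2.1 hj.2.2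

lemma memLp_blockSum {Ω : Type*} [MeasurableSpace Ω] {P : Measure Ω} {Z : ℕ → Ω → ℝ} {K q : ℕ}
    (hZ : ∀ j, MemLp (Z j) 4 P) (r : ℕ → Prop) [DecidablePred r] (m : ℕ) :
    MemLp (blockSum Z K q r m) 4 P := by
  unfold blockSum
  exact memLp_finsetSum _ fun j _ => hZ j

lemma truncatedCount_nonneg {Ω : Type*} (n : ℕ) (a h : ℝ) (d' : Bool × Bool → ℕ → ℕ → ℝ)
    (ξ : ℕ → Ω → ℝ) (j : ℕ) (ω : Ω) : 0 ≤ truncatedCount n a h d' ξ j ω :=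
  Finset.sum_nonneg fun _ _ => Nat.cast_nonneg _

section

variable {Ω : Type*} [MeasurableSpace Ω] {P : Measure Ω} [IsProbabilityMeasure P]
  {Z : ℕ → Ω → ℝ} {K q : ℕ}

/-- Hölder's inequality in each block of at most `q` pieces. -/
lemma sum_integral_blockSum_pow_four_le (hq : 0 < q) (hZ : ∀ j, MemLp (Z j) 4 P)
    (h0 : ∀ j ω, 0 ≤ Z j ω) {A : ℝ} (hA : ∀ j < K, ∫ ω, Z j ω ^ 4 ∂P ≤ A) (hA0 : 0 ≤ A) :
    ∑ m ∈ Finset.range K, ∫ ω, blockSum Z K q (4 ≤ ·) m ω ^ 4 ∂P ≤ (q : ℝ) ^ 3 * (K * A) := by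
  have hint : ∀ j, Integrable (fun ω => Z j ω ^ 4) P := fun j =>
    integrable_pow_of_memLp_four (hZ j) le_rfl
  have h1 : ∀ m, ∫ ω, blockSum Z K q (4 ≤ ·) m ω ^ 4 ∂P ≤
      ∑ j ∈ Finset.range K with j / q = m ∧ 4 ≤ j % q, (q : ℝ) ^ 3 * ∫ ω, Z j ω ^ 4 ∂P := by
    intro m
    rw [← Finset.mul_sum, ← integral_finsetSum _ fun j _ => hint j, ← integral_const_mul]
    refine integral_mono_of_nonneg (ae_of_all _ fun ω => by positivity)
      ((integrable_finsetSum _ fun j _ => hint j).const_mul _) (ae_of_all _ fun ω => ?_)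
    set s := (Finset.range K).filter fun j => j / q = m ∧ 4 ≤ j % q with hs
    have h2 := pow_sum_div_card_le_sum_pow (s := s) (f := fun j => Z j ω) (fun j _ => h0 j ω) 3
    rcases s.eq_empty_or_nonempty with he | hne
    · simp only [blockSum, ← hs]
      rw [he]
      simp
    · have hc : (0 : ℝ) < s.card := by exact_mod_cast hne.card_pos
      rw [div_le_iff₀' (by positivity)] at h2
      refine h2.trans ?_
      have h3 : (s.card : ℝ) ≤ q := by exact_mod_cast card_block_le K (4 ≤ ·) hq m
      have h4 : 0 ≤ ∑ j ∈ s, Z j ω ^ (3 + 1) := Finset.sum_nonneg fun j _ => pow_nonneg (h0 j ω) _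
      show _ ≤ (q : ℝ) ^ 3 * ∑ j ∈ s, Z j ω ^ (3 + 1)
      gcongr
  calc _ ≤ ∑ m ∈ Finset.range K, ∑ j ∈ Finset.range K with j / q = m ∧ 4 ≤ j % q,
        (q : ℝ) ^ 3 * ∫ ω, Z j ω ^ 4 ∂P := Finset.sum_le_sum fun m _ => h1 m
    _ = ∑ j ∈ Finset.range K with 4 ≤ j % q, (q : ℝ) ^ 3 * ∫ ω, Z j ω ^ 4 ∂P :=
        sum_blockSum_eq K q (4 ≤ ·) _
    _ ≤ ∑ j ∈ Finset.range K with 4 ≤ j % q, (q : ℝ) ^ 3 * A := by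
        refine Finset.sum_le_sum fun j hj => ?_
        rw [Finset.mem_filter, Finset.mem_range] at hj
        have := hA j hj.1
        gcongr
    _ ≤ K * ((q : ℝ) ^ 3 * A) := by
        rw [Finset.sum_const, nsmul_eq_mul]
        have : (((Finset.range K).filter fun j => 4 ≤ j % q).card : ℝ) ≤ K := by
          exact_mod_cast (Finset.card_filter_le _ _).trans (by simp)
        gcongr
    _ = _ := by ring

/-- Each gap consists of at most four pieces, and there are about `K / q` gaps. -/
lemma sum_integral_gapSum_sq_le (hZ : ∀ j, MemLp (Z j) 4 P) {A : ℝ}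
    (hA : ∀ j < K, ∫ ω, Z j ω ^ 4 ∂P ≤ A) (hA0 : 0 ≤ A) :
    ∑ m ∈ Finset.range K, ∫ ω, blockSum Z K q (· < 4) m ω ^ 2 ∂P ≤
      16 * ((K : ℝ) / q + 1) * (1 + A) := by
  have hint : ∀ j, Integrable (fun ω => Z j ω ^ 2) P := fun j =>
    integrable_pow_of_memLp_four (hZ j) (by norm_num)
  have hint4 : ∀ j, Integrable (fun ω => Z j ω ^ 4) P := fun j =>
    integrable_pow_of_memLp_four (hZ j) le_rfl
  have hA2 : ∀ j < K, ∫ ω, Z j ω ^ 2 ∂P ≤ 1 + A := fun j hj => by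
    calc ∫ ω, Z j ω ^ 2 ∂P ≤ ∫ ω, (1 + Z j ω ^ 4) ∂P :=
          integral_mono (hint j) ((integrable_const 1).add (hint4 j)) fun ω => by
            show Z j ω ^ 2 ≤ 1 + Z j ω ^ 4
            nlinarith [sq_nonneg (Z j ω ^ 2 - 1)]
      _ = 1 + ∫ ω, Z j ω ^ 4 ∂P := by
          rw [integral_add (integrable_const 1) (hint4 j)]; simp
      _ ≤ 1 + A := by linarith [hA j hj]
  have h1 : ∀ m, ∫ ω, blockSum Z K q (· < 4) m ω ^ 2 ∂P ≤
      ∑ j ∈ Finset.range K with j / q = m ∧ j % q < 4, 4 * ∫ ω, Z j ω ^ 2 ∂P := by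
    intro m
    rw [← Finset.mul_sum, ← integral_finsetSum _ fun j _ => hint j, ← integral_const_mul]
    refine integral_mono_of_nonneg (ae_of_all _ fun ω => sq_nonneg _)
      ((integrable_finsetSum _ fun j _ => hint j).const_mul _) (ae_of_all _ fun ω => ?_)
    refine (sq_sum_le_card_mul_sum_sq (f := fun j => Z j ω)).trans ?_
    have h3 : (((Finset.range K).filter fun j => j / q = m ∧ j % q < 4).card : ℝ) ≤ 4 := by
      exact_mod_cast card_gap_le K q m
    exact mul_le_mul_of_nonneg_right h3 (Finset.sum_nonneg fun j _ => sq_nonneg _)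
  have hcard : (((Finset.range K).filter fun j => j % q < 4).card : ℝ) ≤ 4 * ((K : ℝ) / q + 1) := by
    calc _ ≤ ((4 * (K / q + 1) : ℕ) : ℝ) := by exact_mod_cast card_filter_mod_lt_le K q
      _ = 4 * (((K / q : ℕ) : ℝ) + 1) := by push_cast; ring
      _ ≤ _ := by gcongr; exact Nat.cast_div_le
  calc _ ≤ ∑ m ∈ Finset.range K, ∑ j ∈ Finset.range K with j / q = m ∧ j % q < 4,
        4 * ∫ ω, Z j ω ^ 2 ∂P := Finset.sum_le_sum fun m _ => h1 m
    _ = ∑ j ∈ Finset.range K with j % q < 4, 4 * ∫ ω, Z j ω ^ 2 ∂P :=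
        sum_blockSum_eq K q (· < 4) _
    _ ≤ ∑ j ∈ Finset.range K with j % q < 4, 4 * (1 + A) := by
        refine Finset.sum_le_sum fun j hj => ?_
        rw [Finset.mem_filter, Finset.mem_range] at hj
        have := hA2 j hj.1
        gcongr
    _ ≤ 4 * ((K : ℝ) / q + 1) * (4 * (1 + A)) := by
        rw [Finset.sum_const, nsmul_eq_mul]
        gcongr
    _ = _ := by ring

lemma memLp_truncatedCount {ξ : ℕ → Ω → ℝ} (hξ : IsStdGaussianSeq ξ P) (n : ℕ) (a h : ℝ)
    (d' : Bool × Bool → ℕ → ℕ → ℝ) (j : ℕ) : MemLp (truncatedCount n a h d' ξ j) 4 P := by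
  unfold truncatedCount
  exact memLp_finsetSum _ fun τ _ => memLp_rootCount (fun i => hξ.measurable _) n _
    (isSigmaCompact_Ioc _ _) 4

lemma integral_truncatedCount_pow_four_le {ξ : ℕ → Ω → ℝ} (hξ : IsStdGaussianSeq ξ P)
    {n : ℕ} {a h D κ : ℝ} {d : Bool × Bool → ℕ → ℝ}
    {d' : Bool × Bool → ℕ → ℕ → ℝ} {bad : Bool × Bool → Finset ℕ}
    (happ : ∀ τ, IsLocalApprox P n (d τ) a h K D κ (d' τ) (bad τ)) {j : ℕ} (hj : j < K) :
    ∫ ω, truncatedCount n a h d' ξ j ω ^ 4 ∂P ≤ 256 * (D * h ^ 5) := by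
  have hint : ∀ τ : Bool × Bool, Integrable (fun ω => (rootCount (weightedPoly n (d' τ j)
      fun i => ξ (orient n τ.2 i) ω) (piece a h j) : ℝ) ^ 4) P := fun τ =>
    integrable_pow_of_memLp_four (memLp_rootCount (fun i => hξ.measurable _) n _
      (isSigmaCompact_Ioc _ _) 4) le_rfl
  calc _ ≤ ∫ ω, 4 ^ 3 * ∑ τ : Bool × Bool, (rootCount (weightedPoly n (d' τ j)
          fun i => ξ (orient n τ.2 i) ω) (piece a h j) : ℝ) ^ 4 ∂P := by
        refine integral_mono_of_nonneg (ae_of_all _ fun ω => by positivity)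
          ((integrable_finsetSum _ fun τ _ => hint τ).const_mul _) (ae_of_all _ fun ω => ?_)
        have h2 := pow_sum_div_card_le_sum_pow (s := (Finset.univ : Finset (Bool × Bool)))
          (f := fun τ => (rootCount (weightedPoly n (d' τ j)
            fun i => ξ (orient n τ.2 i) ω) (piece a h j) : ℝ)) (fun τ _ => Nat.cast_nonneg _) 3
        rw [div_le_iff₀' (by simp)] at h2
        have h3 : ((Finset.univ : Finset (Bool × Bool)).card : ℝ) = 4 := by simp
        rw [h3] at h2
        exact h2
    _ = 4 ^ 3 * ∑ τ : Bool × Bool, ∫ ω, (rootCount (weightedPoly n (d' τ j)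
          fun i => ξ (orient n τ.2 i) ω) (piece a h j) : ℝ) ^ 4 ∂P := by
        rw [integral_const_mul, integral_finsetSum _ fun τ _ => hint τ]
    _ ≤ 4 ^ 3 * ∑ τ : Bool × Bool, D * h ^ 5 := by
        gcongr with τ _
        exact (happ τ).moment' _ (hξ.comp_injective (orient_injective n τ.2)) j hj
    _ = _ := by simp; ring

/-- Blocks separated by four pieces involve disjoint sets of coefficients. -/
lemma iIndepFun_blockSum {ξ : ℕ → Ω → ℝ} (hξ : IsStdGaussianSeq ξ P) {n : ℕ} {a h : ℝ} (hh : 0 < h)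
    (hq : 7 ≤ q) {d' : Bool × Bool → ℕ → ℕ → ℝ}
    (hw : ∀ τ j i, d' τ j i ≠ 0 → i ∈ pieceWindow n a h j) :
    iIndepFun (blockSum (truncatedCount n a h d' ξ) K q (4 ≤ ·)) P ∧
      iIndepFun (blockSum (truncatedCount n a h d' ξ) K q (· < 4)) P := by
  have hq0 : (0 : ℤ) < q := by exact_mod_cast (by omega : 0 < q)
  -- all the coefficients used by block number `m` are in the fibre over `m` of `β`
  have key : ∀ (r : ℕ → Prop) [DecidablePred r] (s : ℤ), (∀ j : ℕ, r (j % q) →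
      ∀ l : ℤ, (j : ℤ) - 1 ≤ l → l ≤ (j : ℤ) + 2 → (l + s) / q = ((j / q : ℕ) : ℤ)) →
      iIndepFun (blockSum (truncatedCount n a h d' ξ) K q r) P := by
    intro r _ s hr
    let β : ℕ → ℤ := fun i => (scaleIndex n a h i + s) / q
    have h2 := iIndep_iSup_fiber (fun i => (hξ.measurable i).comap_le) hξ.indep.iIndep β
    have h3 := h2.precomp (g := fun m : ℕ => (m : ℤ)) Nat.cast_injective
    rw [iIndepFun_iff_iIndep]
    refine iIndep_of_iIndep_of_le h3 fun m => Measurable.comap_le ?_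
    refine @measurable_blockSum Ω (⨆ i ∈ β ⁻¹' {(m : ℤ)},
      MeasurableSpace.comap (ξ i) inferInstance) _ K q m r _ fun j hj hrj => ?_
    refine @measurable_truncatedCount Ω (⨆ i ∈ β ⁻¹' {(m : ℤ)},
      MeasurableSpace.comap (ξ i) inferInstance) n a h hh d' j (fun τ i => hw τ j i) ξ
      fun i hi1 hi2 => ?_
    have h4 : i ∈ β ⁻¹' {(m : ℤ)} := by
      rw [Set.mem_preimage, Set.mem_singleton_iff, ← hj]
      exact hr j hrj _ hi1 hi2
    exact Measurable.mono (comap_measurable (ξ i))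
      (le_biSup (fun i => MeasurableSpace.comap (ξ i) inferInstance) h4) le_rfl
  have hdiv : ∀ (l : ℤ) (m : ℕ), (q : ℤ) * m ≤ l → l < q * m + q → l / q = m := fun l m h1 h2 => by
    rw [Int.ediv_eq_iff_of_pos hq0]
    constructor <;> linarith
  -- block `m` uses the groups of scales from `q m + 3` to `q m + q + 1`, and gap `m` those from
  -- `q m - 1` to `q m + 5`; the shifts move both into `[q m, q m + q)`
  refine ⟨key _ (-3) fun j hj l h1 h2 => hdiv _ _ ?_ ?_, key _ 1 fun j hj l h1 h2 => hdiv _ _ ?_ ?_⟩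
  all_goals
    have e1 := Nat.div_add_mod j q
    have e2 := Nat.mod_lt j (by omega : 0 < q)
    have e3 := Nat.zero_le (j % q)
    zify at e1 e2 e3 hj hq
    push_cast
    linarith
end

/-! ### Asymptotics -/

/-- A partition of `(1 - a, 1 - b]` into pieces of logarithmic length between `g` and `2 g`. -/
lemma exists_admissible {n N₀ : ℕ} {a b g : ℝ} (hg : 1 ≤ g) (hb : 0 < b)
    (hbn : Real.log n ^ 2 / n ≤ b) (hba : b < a) (hgl : g ≤ Real.log (a / b))
    (hag : a ≤ Real.exp (-(2 * g))) (hsmall : 4 * (N₀ : ℝ) * a ≤ 1) :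
    ∃ (h : ℝ) (K : ℕ), Admissible n N₀ a h K ∧ 0 < K ∧ a * Real.exp (-(h * K)) = b ∧
      h ≤ 2 * g ∧ K * g ≤ Real.log (a / b) := by
  have ha : 0 < a := hb.trans hba
  set l := Real.log (a / b) with hl
  have hg0 : 0 < g := by linarith
  have hlg : 1 ≤ l / g := by rwa [one_le_div hg0]
  set K := ⌊l / g⌋₊ with hK
  have hK1 : 1 ≤ K := Nat.one_le_floor_iff _ |>.2 hlg
  have hK1' : (1 : ℝ) ≤ K := by exact_mod_cast hK1
  have hKle : K * g ≤ l := by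
    have := Nat.floor_le (by linarith : 0 ≤ l / g)
    rwa [le_div_iff₀ hg0] at this
  have hKge : l ≤ 2 * g * K := by
    have := Nat.lt_floor_add_one (l / g)
    rw [div_lt_iff₀ hg0] at this
    nlinarith
  have hh2 : l / K ≤ 2 * g := by rwa [div_le_iff₀ (by linarith)]
  have hend : a * Real.exp (-(l / K * K)) = b := by
    rw [div_mul_cancel₀ _ (by linarith), hl, Real.exp_neg, Real.exp_log (by positivity)]
    field_simp
  refine ⟨l / K, K, ⟨?_, ha, hend ▸ hbn, ?_, hsmall⟩, hK1, hend, hh2, hKle⟩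
  · rw [one_le_div (by linarith)]
    nlinarith
  · exact hag.trans (Real.exp_le_exp.2 (by linarith))

lemma tendsto_log_natCast_atTop : Tendsto (fun n : ℕ => Real.log n) atTop atTop :=
  Real.tendsto_log_atTop.comp tendsto_natCast_atTop_atTop

lemma tendsto_rpow_div_self {r : ℝ} (hr : r < 1) :
    Tendsto (fun x : ℝ => x ^ r / x) atTop (𝓝 0) := by
  refine (tendsto_rpow_neg_atTop (by linarith : 0 < 1 - r)).congr' ?_
  filter_upwards [eventually_gt_atTop 0] with x hx
  rw [neg_sub, Real.rpow_sub_one hx.ne']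

lemma eventually_mul_rpow_le {r s : ℝ} (hrs : r < s) (C : ℝ) {ε : ℝ} (hε : 0 < ε) :
    ∀ᶠ x : ℝ in atTop, C * x ^ r ≤ ε * x ^ s := by
  filter_upwards [(tendsto_rpow_atTop (sub_pos.2 hrs)).eventually_ge_atTop (C / ε),
    eventually_gt_atTop 0] with x hx hx0
  rw [div_le_iff₀ hε] at hx
  calc C * x ^ r ≤ x ^ (s - r) * ε * x ^ r := by gcongr
    _ = ε * (x ^ (s - r) * x ^ r) := by ring
    _ = ε * x ^ s := by rw [← Real.rpow_add hx0, sub_add_cancel]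

/-- The second and fourth moments of the truncation error, the gaps and the blocks for a partition
into pieces of logarithmic length of order `g`, when the number of pieces is at most `L / g` and the
variance is of order `L`. -/
lemma block_moments_le {Ω : Type*} [MeasurableSpace Ω] {P : Measure Ω} [IsProbabilityMeasure P]
    {ξ : ℕ → Ω → ℝ} (hξ : IsStdGaussianSeq ξ P) {N₀ n K : ℕ} {a b h g L D κ : ℝ}
    (H : Admissible n N₀ a h K) (hK : 0 < K) (hb : a * Real.exp (-(h * K)) = b) (hg : 1 ≤ g)
    (hgh : g ≤ h)
    (hhg : h ≤ 2 * g) (hKg : K * g ≤ L) (hκ : 0 < κ) {coeff : ℕ → ℕ → ℝ} (hD : 1 ≤ D)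
    (h0 : ∀ τ, ∃ i ≤ n, orientedCoeff τ coeff n i ≠ 0)
    {d' : Bool × Bool → ℕ → ℕ → ℝ} {bad : Bool × Bool → Finset ℕ}
    (happ : ∀ τ, IsLocalApprox P n (orientedCoeff τ coeff n) a h K D κ (d' τ) (bad τ))
    {q : ℕ} (hq : g ^ 5 ≤ q) (hq' : (q : ℝ) ≤ 9 * g ^ 5) :
    ∑ m ∈ Finset.range K, ∫ ω, blockSum (truncatedCount n a h d' ξ) K q (4 ≤ ·) m ω ^ 4 ∂P ≤
        10 ^ 7 * D * (g ^ 20 * L) ∧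
      ∑ m ∈ Finset.range K, ∫ ω, blockSum (truncatedCount n a h d' ξ) K q (· < 4) m ω ^ 2 ∂P ≤
        10 ^ 6 * D * (L / g + g ^ 5) ∧
      ∫ ω, ((rootCount (weightedPoly n (coeff n) fun i => ξ i ω) (core a b) : ℝ) -
          ∑ m ∈ Finset.range K, blockSum (truncatedCount n a h d' ξ) K q (4 ≤ ·) m ω -
          ∑ m ∈ Finset.range K, blockSum (truncatedCount n a h d' ξ) K q (· < 4) m ω) ^ 2 ∂P ≤
        10 ^ 5 * D * (g ^ 5 + L ^ 2 * g ^ 5 * Real.exp (-(κ / 2 * g))) := by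
  have hg0 : 0 < g := by linarith
  have hg5 : 1 ≤ g ^ 5 := one_le_pow₀ hg
  have hq0 : 0 < q := by
    have : (0 : ℝ) < q := by linarith
    exact_mod_cast this
  have hh5 : h ^ 5 ≤ 32 * g ^ 5 := by
    calc h ^ 5 ≤ (2 * g) ^ 5 := by gcongr; linarith
      _ = _ := by ring
  have hKL : (K : ℝ) ≤ L := (le_mul_of_one_le_right (Nat.cast_nonneg _) hg).trans hKg
  have hL0 : 0 ≤ L := (Nat.cast_nonneg _).trans hKL
  have hh0 : 0 ≤ h ^ 5 := by have := H.one_le; positivity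
  have hA : ∀ j < K, ∫ ω, truncatedCount n a h d' ξ j ω ^ 4 ∂P ≤ 256 * (D * (32 * g ^ 5)) :=
    fun j hj => (integral_truncatedCount_pow_four_le hξ happ hj).trans (by gcongr)
  refine ⟨?_, ?_, ?_⟩
  · refine (sum_integral_blockSum_pow_four_le hq0 (memLp_truncatedCount hξ n a h d')
      (truncatedCount_nonneg n a h d' ξ) hA (by positivity)).trans ?_
    calc (q : ℝ) ^ 3 * (K * (256 * (D * (32 * g ^ 5))))
        ≤ (9 * g ^ 5) ^ 3 * (L * (256 * (D * (32 * g ^ 5)))) := by gcongr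
      _ = 5971968 * D * (g ^ 20 * L) := by ring
      _ ≤ _ := by gcongr; norm_num
  · refine (sum_integral_gapSum_sq_le (memLp_truncatedCount hξ n a h d') hA
      (by positivity)).trans ?_
    have h1 : (K : ℝ) / q ≤ L / g / g ^ 5 := by
      have : (K : ℝ) ≤ L / g := by rwa [le_div_iff₀ hg0]
      gcongr
    have h2 : 1 + 256 * (D * (32 * g ^ 5)) ≤ 8193 * D * g ^ 5 := by
      have : 1 ≤ D * g ^ 5 := one_le_mul_of_one_le_of_one_le hD hg5
      linarith
    calc 16 * ((K : ℝ) / q + 1) * (1 + 256 * (D * (32 * g ^ 5)))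
        ≤ 16 * (L / g / g ^ 5 + 1) * (8193 * D * g ^ 5) := by gcongr
      _ = 131088 * D * (L / g + g ^ 5) := by field_simp; norm_num
      _ ≤ _ := by gcongr; norm_num
  · have h1 : ∀ ω, (rootCount (weightedPoly n (coeff n) fun i => ξ i ω) (core a b) : ℝ) -
          ∑ m ∈ Finset.range K, blockSum (truncatedCount n a h d' ξ) K q (4 ≤ ·) m ω -
          ∑ m ∈ Finset.range K, blockSum (truncatedCount n a h d' ξ) K q (· < 4) m ω =
        (rootCount (weightedPoly n (coeff n) fun i => ξ i ω) (core a b) : ℝ) -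
          ∑ j ∈ Finset.range K, truncatedCount n a h d' ξ j ω := fun ω => by
      rw [← sum_blockSum_add_sum_blockSum (truncatedCount n a h d' ξ) K q ω, sub_sub]
    simp_rw [h1, ← hb]
    refine (integral_sq_sub_truncatedCount_le hξ H hK hD h0 happ).trans ?_
    have h2 : Real.exp (-(κ / 2 * h)) ≤ Real.exp (-(κ / 2 * g)) := by gcongr
    calc 576 * D * h ^ 5 + 64 * D * K ^ 2 * h ^ 5 * Real.exp (-(κ / 2 * h))
        ≤ 576 * D * (32 * g ^ 5) + 64 * D * L ^ 2 * (32 * g ^ 5) * Real.exp (-(κ / 2 * g)) := by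
          gcongr
      _ = 18432 * D * g ^ 5 + 2048 * D * (L ^ 2 * g ^ 5 * Real.exp (-(κ / 2 * g))) := by ring
      _ ≤ 10 ^ 5 * D * g ^ 5 + 10 ^ 5 * D * (L ^ 2 * g ^ 5 * Real.exp (-(κ / 2 * g))) := by
          gcongr <;> norm_num
      _ = _ := by ring

/-- The central limit theorem, for Gaussian variables that are measurable rather than almost
everywhere measurable. -/
theorem IsStdGaussianSeq.tendstoInDistribution_coreRoots {Ω : Type*} [MeasurableSpace Ω]
    {P : Measure Ω} [IsProbabilityMeasure P] {ξ : ℕ → Ω → ℝ} (hξ : IsStdGaussianSeq ξ P)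
    {N₀ : ℕ} (hN₀ : 0 < N₀) {τ₁ τ₂ ρ : ℝ} (hτ₁ : 0 < τ₁) (hρ : -(1 / 2 : ℝ) < ρ)
    {coeff : ℕ → ℕ → ℝ} (hcoeff : PolynomialGrowth N₀ τ₁ τ₂ ρ coeff)
    {c : ℝ} (hc : 0 < c) (hc1 : c < 1) {a b : ℕ → ℝ}
    (hab : ∀ᶠ n : ℕ in atTop, Real.log n ^ 2 / n ≤ b n ∧ b n < a n ∧
      a n ≤ Real.exp (-(Real.log n) ^ c))
    (hlog : (fun n : ℕ => Real.log n) =O[atTop] (fun n : ℕ => Real.log (a n / b n)))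
    (hvar : (fun n : ℕ => Real.log n) =O[atTop]
      (fun n : ℕ => Var[coreRoots coeff ξ a b n; P])) :
    TendstoInDistribution
      (fun (n : ℕ) (ω : Ω) =>
        (coreRoots coeff ξ a b n ω - ∫ ω', coreRoots coeff ξ a b n ω' ∂P) /
          √(Var[coreRoots coeff ξ a b n; P]))
      atTop (id : ℝ → ℝ) (fun _ => P) (gaussianReal 0 1) := by
  obtain ⟨D, hD, κ, hκ, happ⟩ := hcoeff.exists_isLocalApprox_oriented P hτ₁ hN₀ hρ
  -- pieces of logarithmic length of order `g = L ^ θ`, with a small power `θ`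
  set θ := c / 100 with hθ
  have hθ0 : 0 < θ := by positivity
  set L : ℕ → ℝ := fun n => Real.log n with hL
  set g : ℕ → ℝ := fun n => L n ^ θ with hgdef
  set q : ℕ → ℕ := fun n => ⌈g n ^ 5⌉₊ + 7 with hqdef
  have hLtop : Tendsto L atTop atTop := tendsto_log_natCast_atTop
  have hL0 : ∀ᶠ n in atTop, 0 < L n := hLtop.eventually_gt_atTop 0
  have hgtop : Tendsto g atTop atTop := (tendsto_rpow_atTop hθ0).comp hLtop
  have hg1 : ∀ᶠ n in atTop, 1 ≤ g n := hgtop.eventually_ge_atTop 1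
  have hq : ∀ᶠ n in atTop, g n ^ 5 ≤ q n ∧ (q n : ℝ) ≤ 9 * g n ^ 5 := by
    filter_upwards [hg1] with n hn
    have h5 : 1 ≤ g n ^ 5 := one_le_pow₀ hn
    have h1 := Nat.le_ceil (g n ^ 5)
    have h2 := Nat.ceil_lt_add_one (by positivity : 0 ≤ g n ^ 5)
    simp only [hqdef]
    push_cast
    constructor <;> linarith
  -- the partition and the truncated weights
  obtain ⟨C₁, hC₁, hlogC⟩ := hlog.exists_pos
  have hgood : ∀ᶠ n : ℕ in atTop, ∃ t : ℝ × ℕ × (Bool × Bool → ℕ → ℕ → ℝ),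
      Admissible n N₀ (a n) t.1 t.2.1 ∧ 0 < t.2.1 ∧ a n * Real.exp (-(t.1 * t.2.1)) = b n ∧
      g n ≤ t.1 ∧ t.1 ≤ 2 * g n ∧ t.2.1 * g n ≤ L n ∧
      ∃ bad : Bool × Bool → Finset ℕ, ∀ τ,
        IsLocalApprox P n (orientedCoeff τ coeff n) (a n) t.1 t.2.1 D κ (t.2.2 τ) (bad τ) := by
    have e1 : ∀ᶠ n in atTop, C₁ * L n ^ θ ≤ 1 * L n ^ (1 : ℝ) :=
      hLtop.eventually (eventually_mul_rpow_le (by linarith) C₁ one_pos)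
    have e2 : ∀ᶠ n in atTop, 2 * L n ^ θ ≤ 1 * L n ^ c :=
      hLtop.eventually (eventually_mul_rpow_le (by linarith) 2 one_pos)
    have e3 : Tendsto (fun n => 4 * (N₀ : ℝ) * Real.exp (-L n ^ c)) atTop (𝓝 0) := by
      have := (Real.tendsto_exp_neg_atTop_nhds_zero.comp
        ((tendsto_rpow_atTop hc).comp hLtop)).const_mul (4 * (N₀ : ℝ))
      rw [mul_zero] at this
      exact this
    filter_upwards [hab, hlogC.bound, e1, e2, e3.eventually_le_const one_pos, happ, hg1,
      eventually_logLarge 0] with n hn hln h1 h2 h3 happn hgn hnl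
    obtain ⟨hbn, hba, hae⟩ := hn
    have hn2 : (2 : ℝ) ≤ n := by exact_mod_cast hnl.two_le
    have hL1 : 1 ≤ L n := by
      have : 2 * (((0 : ℕ) : ℝ) + 2) ≤ Real.log n := hnl
      push_cast at this
      simp only [hL]
      linarith
    have hnb : (n : ℝ)⁻¹ ≤ b n := by
      refine le_trans ?_ hbn
      rw [inv_eq_one_div]
      gcongr
      exact one_le_pow₀ hL1
    have hb0 : 0 < b n := lt_of_lt_of_le (by positivity) hnb
    have ha0 : 0 < a n := hb0.trans hba
    have hlpos : 0 < Real.log (a n / b n) := Real.log_pos (by rwa [one_lt_div hb0])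
    have hgl : g n ≤ Real.log (a n / b n) := by
      rw [Real.norm_of_nonneg (by linarith : (0 : ℝ) ≤ Real.log n),
        Real.norm_of_nonneg hlpos.le] at hln
      rw [one_mul, Real.rpow_one] at h1
      exact le_of_mul_le_mul_left (h1.trans hln) hC₁
    have ha1 : a n ≤ 1 := hae.trans (Real.exp_le_one_iff.2 (by
      have : 0 ≤ L n ^ c := by positivity
      simpa [hL] using this))
    have hlL : Real.log (a n / b n) ≤ L n := by
      refine Real.log_le_log (by positivity) ?_
      rw [div_le_iff₀ hb0]
      have : 1 ≤ n * b n := by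
        rw [inv_eq_one_div, div_le_iff₀ (by linarith)] at hnb
        linarith
      linarith
    obtain ⟨h, K, H, hK, hend, hh, hKg⟩ := exists_admissible (N₀ := N₀) hgn hb0 hbn hba hgl
      (hae.trans (Real.exp_le_exp.2 (by
        rw [one_mul] at h2
        exact neg_le_neg h2)))
      (le_trans (by gcongr) h3)
    obtain ⟨d', bad, hd'⟩ := happn _ _ _ H
    refine ⟨(h, K, d'), H, hK, hend, ?_, hh, hKg.trans hlL, bad, hd'⟩
    -- `h K = log (a / b)` and `K g ≤ log (a / b)`
    have hhK : h * K = Real.log (a n / b n) := by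
      rw [← hend, ← div_div, div_self ha0.ne', one_div, Real.exp_neg, inv_inv, Real.log_exp]
    rw [← hhK, mul_comm h] at hKg
    exact le_of_mul_le_mul_left hKg (by exact_mod_cast hK)
  obtain ⟨t, ht⟩ := hgood.choice
  set h : ℕ → ℝ := fun n => (t n).1 with hh
  set K : ℕ → ℕ := fun n => (t n).2.1 with hK
  set d' : ℕ → Bool × Bool → ℕ → ℕ → ℝ := fun n => (t n).2.2 with hd'
  set Y : ℕ → ℕ → Ω → ℝ := fun n =>
    blockSum (truncatedCount n (a n) (h n) (d' n) ξ) (K n) (q n) (4 ≤ ·) with hY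
  set G : ℕ → ℕ → Ω → ℝ := fun n =>
    blockSum (truncatedCount n (a n) (h n) (d' n) ξ) (K n) (q n) (· < 4) with hG
  obtain ⟨C₂, hC₂, hvarC⟩ := hvar.exists_pos
  have hv : ∀ᶠ n in atTop, L n / C₂ ≤ Var[coreRoots coeff ξ a b n; P] := by
    filter_upwards [hvarC.bound, hL0] with n hn hLn
    rw [Real.norm_of_nonneg (variance_nonneg _ _), Real.norm_of_nonneg hLn.le] at hn
    rwa [div_le_iff₀' hC₂]
  have hmom : ∀ᶠ n in atTop,
      ∑ m ∈ Finset.range (K n), ∫ ω, Y n m ω ^ 4 ∂P ≤ 10 ^ 7 * D * (g n ^ 20 * L n) ∧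
      ∑ m ∈ Finset.range (K n), ∫ ω, G n m ω ^ 2 ∂P ≤ 10 ^ 6 * D * (L n / g n + g n ^ 5) ∧
      ∫ ω, (coreRoots coeff ξ a b n ω - ∑ m ∈ Finset.range (K n), Y n m ω -
          ∑ m ∈ Finset.range (K n), G n m ω) ^ 2 ∂P ≤
        10 ^ 5 * D * (g n ^ 5 + L n ^ 2 * g n ^ 5 * Real.exp (-(κ / 2 * g n))) := by
    filter_upwards [ht, hg1, hq, eventually_gt_atTop N₀] with n hn hgn hqn hnN
    obtain ⟨H, hK0, hend, hgh, hhg, hKg, bad, hbad⟩ := hn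
    exact block_moments_le hξ H hK0 hend hgn hgh hhg hKg hκ hD
      (hcoeff.orientedCoeff_ne_zero hτ₁ hN₀ hnN) hbad hqn.1 hqn.2
  have hind : ∀ᶠ n in atTop, iIndepFun (Y n) P ∧ iIndepFun (G n) P := by
    filter_upwards [ht] with n hn
    obtain ⟨H, hK0, hend, hgh, hhg, hKg, bad, hbad⟩ := hn
    exact iIndepFun_blockSum hξ (by linarith [H.one_le]) (by simp [hqdef])
      fun τ j i => (hbad τ).window j i
  -- the four error terms
  have hpow : ∀ m : ℕ, m ≤ 20 → Tendsto (fun n => g n ^ m / L n) atTop (𝓝 0) := fun m hm => by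
    have hm' : (m : ℝ) ≤ 20 := by exact_mod_cast hm
    have h1 : θ * m < 1 := by rw [hθ]; nlinarith
    refine ((tendsto_rpow_div_self h1).comp hLtop).congr' ?_
    filter_upwards [hL0] with n hn
    simp only [Function.comp_apply, hgdef]
    rw [Real.rpow_mul hn.le, Real.rpow_natCast]
  have hinv : Tendsto (fun n => (g n)⁻¹) atTop (𝓝 0) := hgtop.inv_tendsto_atTop
  have hexp : Tendsto (fun n => L n * g n ^ 5 * Real.exp (-(κ / 2 * g n))) atTop (𝓝 0) := by
    refine ((tendsto_rpow_mul_exp_neg_mul_atTop_nhds_zero (1 / θ + 5) (κ / 2)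
      (by positivity)).comp hgtop).congr' ?_
    filter_upwards [hL0, hg1] with n hn hgn
    simp only [Function.comp_apply]
    rw [Real.rpow_add (by linarith)]
    have h1 : g n ^ (1 / θ) = L n := by
      simp only [hgdef]
      rw [← Real.rpow_mul hn.le, mul_one_div_cancel hθ0.ne', Real.rpow_one]
    rw [h1, show (5 : ℝ) = ((5 : ℕ) : ℝ) by norm_num, Real.rpow_natCast, neg_mul]
  refine tendstoInDistribution_of_blocks (X := coreRoots coeff ξ a b) (K := K) (Y := Y) (G := G)
    (fun n => memLp_rootCount hξ.measurable n _ (isSigmaCompact_core _ _) 2)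
    (fun n m => memLp_blockSum (memLp_truncatedCount hξ n _ _ _) _ m)
    (fun n m => (memLp_blockSum (memLp_truncatedCount hξ n _ _ _) _ m).mono_exponent (by norm_num))
    (hind.mono fun n hn => hn.1) (hind.mono fun n hn => hn.2) ?_ ?_ ?_ ?_
  · filter_upwards [hv, hL0] with n hn hLn
    exact lt_of_lt_of_le (by positivity) hn
  · -- Lyapunov's condition for the blocks
    have hlim := (hpow 20 le_rfl).const_mul (10 ^ 7 * D * C₂ ^ 2)
    rw [mul_zero] at hlim
    refine squeeze_zero' (Eventually.of_forall fun n => ?_) ?_ hlim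
    · exact div_nonneg (Finset.sum_nonneg fun m _ => integral_nonneg fun ω => by positivity)
        (sq_nonneg _)
    · filter_upwards [hmom, hv, hL0, hg1] with n hn hvn hLn hgn
      calc _ ≤ 10 ^ 7 * D * (g n ^ 20 * L n) / (L n / C₂) ^ 2 := by
            gcongr
            exact hn.1
        _ = _ := by field_simp
  · -- the gaps
    have hlim := (hinv.add (hpow 5 (by norm_num))).const_mul (10 ^ 6 * D * C₂)
    rw [add_zero, mul_zero] at hlim
    refine squeeze_zero' (Eventually.of_forall fun n => ?_) ?_ hlim
    · exact div_nonneg (Finset.sum_nonneg fun m _ => integral_nonneg fun ω => sq_nonneg _)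
        (variance_nonneg _ _)
    · filter_upwards [hmom, hv, hL0, hg1] with n hn hvn hLn hgn
      have hg0 : 0 < g n := by linarith
      calc _ ≤ 10 ^ 6 * D * (L n / g n + g n ^ 5) / (L n / C₂) := by
            gcongr
            exact hn.2.1
        _ = _ := by field_simp
  · -- the truncation error
    have hlim := ((hpow 5 (by norm_num)).add hexp).const_mul (10 ^ 5 * D * C₂)
    rw [add_zero, mul_zero] at hlim
    refine squeeze_zero' (Eventually.of_forall fun n => ?_) ?_ hlim
    · exact div_nonneg (integral_nonneg fun ω => sq_nonneg _) (variance_nonneg _ _)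
    · filter_upwards [hmom, hv, hL0, hg1] with n hn hvn hLn hgn
      have hg0 : 0 < g n := by linarith
      calc _ ≤ 10 ^ 5 * D * (g n ^ 5 + L n ^ 2 * g n ^ 5 * Real.exp (-(κ / 2 * g n))) /
            (L n / C₂) := by
            gcongr
            exact hn.2.2
        _ = _ := by field_simp

theorem lemma8 {Ω : Type*} [MeasurableSpace Ω] (P : Measure Ω) [IsProbabilityMeasure P]
    -- the random variables are i.i.d. standard Gaussian
    (ξ : ℕ → Ω → ℝ) (hξ : iIndepFun ξ P) (hgauss : ∀ i, HasLaw (ξ i) (gaussianReal 0 1) P)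
    -- the coefficients grow polynomially
    (N₀ : ℕ) (hN₀ : 0 < N₀) (τ₁ τ₂ ρ : ℝ) (hτ₁ : 0 < τ₁) (hτ₂ : 0 < τ₂) (hρ : -(1 / 2 : ℝ) < ρ)
    (coeff : ℕ → ℕ → ℝ) (hcoeff : PolynomialGrowth N₀ τ₁ τ₂ ρ coeff)
    -- the endpoints of the core
    (c : ℝ) (hc : 0 < c) (hc1 : c < 1) (a b : ℕ → ℝ)
    (hab : ∀ᶠ n : ℕ in atTop, Real.log n ^ 2 / n ≤ b n ∧ b n < a n ∧
      a n ≤ Real.exp (-(Real.log n) ^ c))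
    (hlog : (fun n : ℕ => Real.log (a n / b n)) =Θ[atTop] (fun n : ℕ => Real.log n))
    -- the variance is at least of order `log n`
    (hvar : (fun n : ℕ => Real.log n) =O[atTop]
      (fun n : ℕ => Var[coreRoots coeff ξ a b n; P])) :
    TendstoInDistribution
      (fun (n : ℕ) (ω : Ω) =>
        (coreRoots coeff ξ a b n ω - ∫ ω', coreRoots coeff ξ a b n ω' ∂P) /
          √(Var[coreRoots coeff ξ a b n; P]))
      atTop (id : ℝ → ℝ) (fun _ => P) (gaussianReal 0 1) := by
  -- the variables are almost everywhere equal to measurable ones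
  set ζ : ℕ → Ω → ℝ := fun i => (hgauss i).aemeasurable.mk (ξ i) with hζ
  have hae : ∀ i, ξ i =ᵐ[P] ζ i := fun i => (hgauss i).aemeasurable.ae_eq_mk
  have hstd : IsStdGaussianSeq ζ P := ⟨fun i => (hgauss i).aemeasurable.measurable_mk,
    hξ.congr hae, fun i => (hgauss i).congr (hae i).symm⟩
  have hcore : ∀ n, coreRoots coeff ζ a b n =ᵐ[P] coreRoots coeff ξ a b n := fun n => by
    filter_upwards [ae_all_iff.2 hae] with ω hω
    unfold coreRoots
    simp_rw [hω]
  have hv : ∀ n, Var[coreRoots coeff ζ a b n; P] = Var[coreRoots coeff ξ a b n; P] := fun n =>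
    variance_congr (hcore n)
  simp_rw [← hv] at hvar
  refine (hstd.tendstoInDistribution_coreRoots hN₀ hτ₁ hρ hcoeff hc hc1 hab hlog.2 hvar).congr
    (fun n => ?_) (ae_eq_refl _)
  rw [hv, integral_congr_ae (hcore n)]
  filter_upwards [hcore n] with ω hω
  rw [hω]
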